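/- Let $E:\mathbb C\to\mathbb C^2\otimes\mathbb C^2$, $E':\mathbb C^2\otimes\mathbb C^2\to\mathbb C$ and an invertible $X:\mathbb C^2\otimes\mathbb C^2\to\mathbb C^2\otimes\mathbb C^2$ be linear and let $\beta\in\mathbb C\setminus\{0\}$, such that $E'E\neq 0$ and $$(E'\otimes 1)(1\otimes E)=1,\qquad (X\otimes 1)(1\otimes X)(E\otimes 1)=1\otimes E,\qquad \tau\bar X\tau=\beta^{-1}X,$$ where $\tau(x\otimes y)=y\otimes x$ and the bar denotes the entrywise complex conjugate. Put $\tilde E=\tau\bar E$, $\tilde E'=\bar E'\tau$. For matrices $v,v'$ over an algebra, $(v\otimes v')_{ij,kl}=v_{ik}v'_{jl}$. The quantum Lorentz group given by these data is the Hopf $*$-algebra $(\mathcal A,\Delta)$: $\mathcal A$ is the unital complex algebra generated by the entries of the $2\times 2$ matrices $w,\tilde w$ with the relations $$(w\otimes w)E=E,\quad(\tilde w\otimes\tilde w)\tilde E=\tilde E,\quad E'(w\otimes w)=E',\quad\tilde E'(\tilde w\otimes\tilde w)=\tilde E',\quad X(w\otimes\tilde w)=(\tilde w\otimes w)X,$$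 $\Delta w_{ij}=\sum_k w_{ik}\otimes w_{kj}$, $\Delta\tilde w_{ij}=\sum_k\tilde w_{ik}\otimes\tilde w_{kj}$, $\varepsilon(w_{ij})=\varepsilon(\tilde w_{ij})=\delta_{ij}$, $w_{ij}^*=\tilde w_{ij}$; thus $\bar w=\tilde w$. Let $q\in\mathbb C\setminus\{0\}$ be such that $E'E=-(q+q^{-1})$ (this holds for $E=e_1\otimes e_2-qe_2\otimes e_1$, and with $q=1$ for $E=e_1\otimes e_2-e_2\otimes e_1+e_1\otimes e_1$). Fix a square root $q^{1/2}$ and put $q_{1,2}=\pm q^{1/2}$, $q_{3,4}=\pm q^{-1/2}$, $L_i=q_i(1+q_i^{-2}EE')$. A coquasitriangular (CQT) structure on $(\mathcal A,\Delta)$ is a linear functional $\mathcal R$ on $\mathcal A\otimes\mathcal A$ with $$\mathcal R(1\otimes x)=\mathcal R(x\otimes 1)=\varepsilon(x),\qquad \mathcal R(xy\otimes z)=\mathcal R(x\otimes z^{(1)})\mathcal R(y\otimes z^{(2)}),$$ $$\mathcal R(x\otimes yz)=\mathcal R(x^{(1)}\otimes z)\mathcal R(x^{(2)}\otimes y),\qquad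 y^{(1)}x^{(1)}\mathcal R(x^{(2)}\otimes y^{(2)})=\mathcal R(x^{(1)}\otimes y^{(1)})x^{(2)}y^{(2)}.$$ It is a CQT $*$-structure if $\overline{\mathcal R(y^*\otimes x^*)}=\mathcal R(x\otimes y)$ for all $x,y$, and it is cotriangular (CT) if $\mathcal R(x^{(1)}\otimes y^{(1)})\mathcal R(y^{(2)}\otimes x^{(2)})=\varepsilon(x)\varepsilon(y)$ for all $x,y$. Write $(R^{vv'})_{ij,kl}=\mathcal R(v_{jk}\otimes v'_{il})$ for $v,v'\in\{w,\bar w\}$. Then: 1. If $\mathcal R$ is a CQT structure, then $\beta=\pm1$ and $$R^{ww}=L_i,\quad R^{\bar w\bar w}=\tau\overline{L_j^{-1}}\tau,\quad R^{w\bar w}=\varepsilon_XX,\quad R^{\bar ww}=\varepsilon'_XX^{-1}\qquad(*)$$ for some $i,j\in\{1,2,3,4\}$ and $\varepsilon_X,\varepsilon'_X\in\{1,-1\}$. 2. If $\beta=\pm1$, then for all $i,j\in\{1,2,3,4\}$ and $\varepsilon_X,\varepsilon'_X\in\{1,-1\}$ there is exactly one CQT structure satisfying $(*)$. 3. There are exactly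 $64$ CQT structures if $\beta=\pm1$ and $q\neq\pm1$, exactly $16$ if $\beta=\pm1$ and $q=\pm1$, and none if $\beta\neq\pm1$ (in particular none if $\beta=\pm i$). 4. A CQT structure satisfying $(*)$ is a CQT $*$-structure if and only if $\beta=1$ and $q_j=q_i^{-1}$. There are exactly $16$ CQT $*$-structures if $\beta=1$ and $q\neq\pm1$, exactly $8$ if $\beta=1$ and $q=\pm1$, and none if $\beta\neq1$. 5. A CQT structure satisfying $(*)$ is CT if and only if $q=1$ and $\varepsilon_X=\varepsilon'_X$. There are exactly $8$ CT structures if $q=1$ and $\beta=\pm1$, and none otherwise. 6. A CQT structure satisfying $(*)$ is both CT and a CQT $*$-structure if and only if $q=\beta=1$, $q_j=q_i^{-1}$ and $\varepsilon_X=\varepsilon'_X$. There are exactly $4$ such structures if $q=\beta=1$, and none otherwise. -/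

import Mathlib

open scoped TensorProduct Kronecker

noncomputable section

namespace QLorentz

/-- `cst M`: a complex matrix regarded as a matrix over a complex algebra `B`. -/
def cst (B : Type*) [Ring B] [Algebra ℂ B] {m n : Type*} (M : Matrix m n ℂ) : Matrix m n B :=
  M.map (algebraMap ℂ B)

/-- `τ M̄ τ`, where `M̄` is the entrywise complex conjugate of `M` and `τ` is the flip
`τ (x ⊗ y) = y ⊗ x` of `ℂ² ⊗ ℂ²`; in coordinates `(τ M̄ τ)_{ij,kl} = conj M_{ji,lk}`. -/
def tauConj (M : Matrix (Fin 2 × Fin 2) (Fin 2 × Fin 2) ℂ) :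
    Matrix (Fin 2 × Fin 2) (Fin 2 × Fin 2) ℂ :=
  (M.map (starRingEnd ℂ)).submatrix Prod.swap Prod.swap

/-- The data `(E, E', X, β)` defining a quantum Lorentz group. Here `E : ℂ → ℂ² ⊗ ℂ²`,
`E' : ℂ² ⊗ ℂ² → ℂ` and `X : ℂ² ⊗ ℂ² → ℂ² ⊗ ℂ²` are given by their matrices in the canonical
bases. -/
structure Data where
  E : Matrix (Fin 2 × Fin 2) Unit ℂ
  E' : Matrix Unit (Fin 2 × Fin 2) ℂ
  X : Matrix (Fin 2 × Fin 2) (Fin 2 × Fin 2) ℂ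
  β : ℂ
  /-- `(E' ⊗ 1)(1 ⊗ E) = 1` -/
  zigzag : ∀ a c : Fin 2, ∑ b, E' () (a, b) * E (b, c) () = if a = c then 1 else 0
  /-- `(X ⊗ 1)(1 ⊗ X)(E ⊗ 1) = 1 ⊗ E`, the coefficient of `e_i ⊗ e_j ⊗ e_l` in the image
  of `e_k` -/
  X_E : ∀ i j l k : Fin 2,
    ∑ a, ∑ b, ∑ c, X (i, j) (a, c) * X (c, l) (b, k) * E (a, b) () =
      if i = k then E (j, l) () else 0
  /-- `τ X̄ τ = β⁻¹ X` -/
  tauConj_X : tauConj X = β⁻¹ • X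
  E'_mul_E_ne : E' * E ≠ 0
  isUnit_X : IsUnit X
  β_ne : β ≠ 0

variable (G : Data)

/-- `Ẽ = τ Ē` -/
def Data.Et : Matrix (Fin 2 × Fin 2) Unit ℂ := fun p u => starRingEnd ℂ (G.E p.swap u)

/-- `Ẽ' = Ē' τ` -/
def Data.Et' : Matrix Unit (Fin 2 × Fin 2) ℂ := fun u p => starRingEnd ℂ (G.E' u p.swap)

/-- Generators `w_{ij}`, `w̃_{ij}`. -/
inductive Gen : Type
  | w (i j : Fin 2) : Gen
  | wt (i j : Fin 2) : Gen

/-- The matrix `w` over the free algebra. -/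
def freeW : Matrix (Fin 2) (Fin 2) (FreeAlgebra ℂ Gen) :=
  fun i j => FreeAlgebra.ι ℂ (Gen.w i j)

/-- The matrix `w̃` over the free algebra. -/
def freeWt : Matrix (Fin 2) (Fin 2) (FreeAlgebra ℂ Gen) :=
  fun i j => FreeAlgebra.ι ℂ (Gen.wt i j)

/-- The defining relations, entry by entry:
`(w ⊗ w) E = E`, `(w̃ ⊗ w̃) Ẽ = Ẽ`, `E' (w ⊗ w) = E'`, `Ẽ' (w̃ ⊗ w̃) = Ẽ'`,
`X (w ⊗ w̃) = (w̃ ⊗ w) X`. -/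
inductive Rel : FreeAlgebra ℂ Gen → FreeAlgebra ℂ Gen → Prop
  | E (p : Fin 2 × Fin 2) (u : Unit) :
      Rel (((freeW ⊗ₖ freeW) * cst (FreeAlgebra ℂ Gen) G.E) p u) (cst (FreeAlgebra ℂ Gen) G.E p u)
  | Et (p : Fin 2 × Fin 2) (u : Unit) :
      Rel (((freeWt ⊗ₖ freeWt) * cst (FreeAlgebra ℂ Gen) G.Et) p u) (cst (FreeAlgebra ℂ Gen) G.Et p u)
  | E' (u : Unit) (p : Fin 2 × Fin 2) :
      Rel ((cst (FreeAlgebra ℂ Gen) G.E' * (freeW ⊗ₖ freeW)) u p) (cst (FreeAlgebra ℂ Gen) G.E' u p)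
  | Et' (u : Unit) (p : Fin 2 × Fin 2) :
      Rel ((cst (FreeAlgebra ℂ Gen) G.Et' * (freeWt ⊗ₖ freeWt)) u p) (cst (FreeAlgebra ℂ Gen) G.Et' u p)
  | X (p r : Fin 2 × Fin 2) :
      Rel ((cst (FreeAlgebra ℂ Gen) G.X * (freeW ⊗ₖ freeWt)) p r) (((freeWt ⊗ₖ freeW) * cst (FreeAlgebra ℂ Gen) G.X) p r)

/-- The algebra `𝒜` of the quantum Lorentz group. -/
def Poly : Type := RingQuot (Rel G)

instance : Ring (Poly G) := inferInstanceAs (Ring (RingQuot (Rel G)))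

instance : Algebra ℂ (Poly G) := inferInstanceAs (Algebra ℂ (RingQuot (Rel G)))

/-- The quotient map from the free algebra. -/
def mk : FreeAlgebra ℂ Gen →ₐ[ℂ] Poly G := RingQuot.mkAlgHom ℂ (Rel G)

/-- The fundamental representation `w`. -/
def w : Matrix (Fin 2) (Fin 2) (Poly G) := fun i j => mk G (freeW i j)

/-- The fundamental representation `w̃`, which is the conjugate `w̄` of `w`, see `star_w`. -/
def wt : Matrix (Fin 2) (Fin 2) (Poly G) := fun i j => mk G (freeWt i j)

/-- Matrices `W`, `W'` over `B` satisfy the defining relations of `w`, `w̃`. -/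
structure Sat {B : Type*} [Ring B] [Algebra ℂ B] (W W' : Matrix (Fin 2) (Fin 2) B) : Prop where
  E : (W ⊗ₖ W) * cst B G.E = cst B G.E
  Et : (W' ⊗ₖ W') * cst B G.Et = cst B G.Et
  E' : cst B G.E' * (W ⊗ₖ W) = cst B G.E'
  Et' : cst B G.Et' * (W' ⊗ₖ W') = cst B G.Et'
  X : cst B G.X * (W ⊗ₖ W') = (W' ⊗ₖ W) * cst B G.X

theorem map_cst {B C : Type*} [Ring B] [Algebra ℂ B] [Ring C] [Algebra ℂ C] (f : B →ₐ[ℂ] C)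
    {m n : Type*} (M : Matrix m n ℂ) : (cst B M).map f = cst C M := by
  ext i j; simp [cst]

theorem map_kron {B C : Type*} [Ring B] [Algebra ℂ B] [Ring C] [Algebra ℂ C] (f : B →ₐ[ℂ] C)
    (V W : Matrix (Fin 2) (Fin 2) B) : (V ⊗ₖ W).map f = V.map f ⊗ₖ W.map f := by
  ext i j; simp

theorem map_mul' {B C : Type*} [Ring B] [Algebra ℂ B] [Ring C] [Algebra ℂ C] (f : B →ₐ[ℂ] C)
    {l m n : Type*} [Fintype m] (V : Matrix l m B) (W : Matrix m n B) :
    (V * W).map f = V.map f * W.map f := by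
  ext i j; simp [Matrix.mul_apply, map_sum]

theorem sat_w : Sat G (w G) (wt G) := by
  have hw : w G = freeW.map (mk G) := rfl
  have hwt : wt G = freeWt.map (mk G) := rfl
  rw [hw, hwt]
  constructor <;> simp only [← map_cst (mk G), ← map_kron, ← map_mul'] <;> ext p r <;>
    simp only [Matrix.map_apply] <;> apply RingQuot.mkAlgHom_rel
  · exact Rel.E p r
  · exact Rel.Et p r
  · exact Rel.E' p r
  · exact Rel.Et' p r
  · exact Rel.X p r

theorem Sat.map {B C : Type*} [Ring B] [Algebra ℂ B] [Ring C] [Algebra ℂ C] (f : B →ₐ[ℂ] C)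
    {W W' : Matrix (Fin 2) (Fin 2) B} (h : Sat G W W') : Sat G (W.map f) (W'.map f) := by
  constructor <;> simp only [← map_cst f, ← map_kron, ← map_mul']
  · rw [h.E]
  · rw [h.Et]
  · rw [h.E']
  · rw [h.Et']
  · rw [h.X]

/-- The homomorphism from the free algebra with given values on generators. -/
def freeLift {B : Type*} [Ring B] [Algebra ℂ B] (W W' : Matrix (Fin 2) (Fin 2) B) :
    FreeAlgebra ℂ Gen →ₐ[ℂ] B :=
  FreeAlgebra.lift ℂ fun g => match g with
    | Gen.w i j => W i j
    | Gen.wt i j => W' i j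

theorem freeLift_w {B : Type*} [Ring B] [Algebra ℂ B] (W W' : Matrix (Fin 2) (Fin 2) B) :
    freeW.map (freeLift W W') = W := by
  ext i j; simp [freeW, freeLift]

theorem freeLift_wt {B : Type*} [Ring B] [Algebra ℂ B] (W W' : Matrix (Fin 2) (Fin 2) B) :
    freeWt.map (freeLift W W') = W' := by
  ext i j; simp [freeWt, freeLift]

variable {G} in
theorem freeLift_rel {B : Type*} [Ring B] [Algebra ℂ B] {W W' : Matrix (Fin 2) (Fin 2) B}
    (h : Sat G W W') ⦃x y : FreeAlgebra ℂ Gen⦄ (hxy : Rel G x y) :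
    freeLift W W' x = freeLift W W' y := by
  have key : ∀ {m n : Type} (M N : Matrix m n (FreeAlgebra ℂ Gen)),
      M.map (freeLift W W') = N.map (freeLift W W') →
      ∀ p r, freeLift W W' (M p r) = freeLift W W' (N p r) :=
    fun M N hMN p r => congrFun (congrFun hMN p) r
  cases hxy <;> apply key <;>
    simp only [map_cst, map_kron, map_mul', freeLift_w, freeLift_wt, h.E, h.Et, h.E', h.Et', h.X]

variable {G} in
/-- The universal property of `𝒜`. -/
def lift {B : Type*} [Ring B] [Algebra ℂ B] {W W' : Matrix (Fin 2) (Fin 2) B}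
    (h : Sat G W W') : Poly G →ₐ[ℂ] B :=
  RingQuot.liftAlgHom ℂ ⟨freeLift W W', freeLift_rel h⟩

variable {G} in
theorem lift_mk {B : Type*} [Ring B] [Algebra ℂ B] {W W' : Matrix (Fin 2) (Fin 2) B}
    (h : Sat G W W') (x : FreeAlgebra ℂ Gen) : lift h (mk G x) = freeLift W W' x :=
  RingQuot.liftAlgHom_mkAlgHom_apply ..

variable {G} in
@[simp] theorem lift_w {B : Type*} [Ring B] [Algebra ℂ B] {W W' : Matrix (Fin 2) (Fin 2) B}
    (h : Sat G W W') (i j : Fin 2) : lift h (w G i j) = W i j := by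
  rw [w, lift_mk]; exact congrFun (congrFun (freeLift_w W W') i) j

variable {G} in
@[simp] theorem lift_wt {B : Type*} [Ring B] [Algebra ℂ B] {W W' : Matrix (Fin 2) (Fin 2) B}
    (h : Sat G W W') (i j : Fin 2) : lift h (wt G i j) = W' i j := by
  rw [wt, lift_mk]; exact congrFun (congrFun (freeLift_wt W W') i) j

variable {G} in
@[ext] theorem hom_ext {B : Type*} [Ring B] [Algebra ℂ B] {f g : Poly G →ₐ[ℂ] B}
    (h : ∀ i j, f (w G i j) = g (w G i j)) (h' : ∀ i j, f (wt G i j) = g (wt G i j)) : f = g := by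
  apply RingQuot.ringQuot_ext'
  apply FreeAlgebra.hom_ext
  funext x
  cases x with
  | w i j => exact h i j
  | wt i j => exact h' i j

variable {G} in
/-- Induction on the elements of `𝒜`. -/
theorem induction {P : Poly G → Prop} (h_alg : ∀ c : ℂ, P (algebraMap ℂ _ c))
    (h_w : ∀ i j, P (w G i j)) (h_wt : ∀ i j, P (wt G i j))
    (h_add : ∀ x y, P x → P y → P (x + y)) (h_mul : ∀ x y, P x → P y → P (x * y))
    (x : Poly G) : P x := by
  obtain ⟨y, rfl⟩ := RingQuot.mkAlgHom_surjective ℂ (Rel G) x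
  change P (mk G y)
  induction y using FreeAlgebra.induction with
  | grade0 c => simpa using h_alg c
  | grade1 x =>
    cases x with
    | w i j => exact h_w i j
    | wt i j => exact h_wt i j
  | mul a b ha hb => simpa using h_mul _ _ ha hb
  | add a b ha hb => simpa using h_add _ _ ha hb

/-! ### Comultiplication and counit -/

theorem kron_mul {B : Type*} [Ring B] (V₁ V₂ W₁ W₂ : Matrix (Fin 2) (Fin 2) B)
    (hc : ∀ i j k l, Commute (V₂ i j) (W₁ k l)) :
    (V₁ * V₂) ⊗ₖ (W₁ * W₂) = (V₁ ⊗ₖ W₁) * (V₂ ⊗ₖ W₂) := by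
  ext ⟨i, j⟩ ⟨k, l⟩
  simp only [Matrix.kroneckerMap_apply, Matrix.mul_apply, Fintype.sum_prod_type,
    Finset.sum_mul_sum]
  refine Finset.sum_congr rfl fun a _ => Finset.sum_congr rfl fun b _ => ?_
  rw [mul_assoc, ← mul_assoc (V₂ a k), (hc a k j b).eq]
  simp only [mul_assoc]

variable {G} in
theorem Sat.mul {B : Type*} [Ring B] [Algebra ℂ B] {V V' W W' : Matrix (Fin 2) (Fin 2) B}
    (h : Sat G V V') (h' : Sat G W W')
    (h1 : ∀ i j k l, Commute (W i j) (V k l)) (h2 : ∀ i j k l, Commute (W i j) (V' k l))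
    (h3 : ∀ i j k l, Commute (W' i j) (V k l)) (h4 : ∀ i j k l, Commute (W' i j) (V' k l)) :
    Sat G (V * W) (V' * W') := by
  constructor
  · rw [kron_mul _ _ _ _ h1, Matrix.mul_assoc, h'.E, h.E]
  · rw [kron_mul _ _ _ _ h4, Matrix.mul_assoc, h'.Et, h.Et]
  · rw [kron_mul _ _ _ _ h1, ← Matrix.mul_assoc, h.E', h'.E']
  · rw [kron_mul _ _ _ _ h4, ← Matrix.mul_assoc, h.Et', h'.Et']
  · rw [kron_mul _ _ _ _ h2, kron_mul _ _ _ _ h3, ← Matrix.mul_assoc, h.X, Matrix.mul_assoc,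
      h'.X, Matrix.mul_assoc]

/-- `w_{ij} ↦ Σ_k w_{ik} ⊗ w_{kj}` and `w̃_{ij} ↦ Σ_k w̃_{ik} ⊗ w̃_{kj}` are compatible with the
relations. -/
theorem sat_comul : Sat G
    ((w G).map (Algebra.TensorProduct.includeLeft : Poly G →ₐ[ℂ] Poly G ⊗[ℂ] Poly G) *
      (w G).map (Algebra.TensorProduct.includeRight : Poly G →ₐ[ℂ] Poly G ⊗[ℂ] Poly G))
    ((wt G).map (Algebra.TensorProduct.includeLeft : Poly G →ₐ[ℂ] Poly G ⊗[ℂ] Poly G) *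
      (wt G).map (Algebra.TensorProduct.includeRight : Poly G →ₐ[ℂ] Poly G ⊗[ℂ] Poly G)) := by
  apply Sat.mul ((sat_w G).map G _) ((sat_w G).map G _) <;> intro i j k l <;>
    simp [commute_iff_eq]

/-- The comultiplication. -/
def comulHom : Poly G →ₐ[ℂ] Poly G ⊗[ℂ] Poly G := lift (sat_comul G)

theorem comulHom_w (i j : Fin 2) : comulHom G (w G i j) = ∑ k, w G i k ⊗ₜ w G k j := by
  simp [comulHom, Matrix.mul_apply]

theorem comulHom_wt (i j : Fin 2) : comulHom G (wt G i j) = ∑ k, wt G i k ⊗ₜ wt G k j := by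
  simp [comulHom, Matrix.mul_apply]

theorem sat_one : Sat G (1 : Matrix (Fin 2) (Fin 2) ℂ) 1 := by
  constructor <;> simp

/-- The counit. -/
def counitHom : Poly G →ₐ[ℂ] ℂ := lift (sat_one G)

theorem counitHom_w (i j : Fin 2) : counitHom G (w G i j) = (1 : Matrix (Fin 2) (Fin 2) ℂ) i j := by
  simp [counitHom]

theorem counitHom_wt (i j : Fin 2) :
    counitHom G (wt G i j) = (1 : Matrix (Fin 2) (Fin 2) ℂ) i j := by
  simp [counitHom]

instance : Bialgebra ℂ (Poly G) := Bialgebra.ofAlgHom (comulHom G) (counitHom G)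
  (by
    ext i j <;>
      simp [comulHom_w, comulHom_wt, TensorProduct.add_tmul, TensorProduct.tmul_add] <;> abel)
  (by
    ext i j <;> fin_cases i <;> fin_cases j <;>
      simp [comulHom_w, comulHom_wt, counitHom_w, counitHom_wt])
  (by
    ext i j <;> fin_cases i <;> fin_cases j <;>
      simp [comulHom_w, comulHom_wt, counitHom_w, counitHom_wt])

theorem comul_w (i j : Fin 2) :
    Coalgebra.comul (R := ℂ) (w G i j) = ∑ k, w G i k ⊗ₜ[ℂ] w G k j := comulHom_w G i j

theorem comul_wt (i j : Fin 2) :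
    Coalgebra.comul (R := ℂ) (wt G i j) = ∑ k, wt G i k ⊗ₜ[ℂ] wt G k j := comulHom_wt G i j

theorem counit_w (i j : Fin 2) :
    Coalgebra.counit (R := ℂ) (w G i j) = (1 : Matrix (Fin 2) (Fin 2) ℂ) i j := counitHom_w G i j

theorem counit_wt (i j : Fin 2) :
    Coalgebra.counit (R := ℂ) (wt G i j) = (1 : Matrix (Fin 2) (Fin 2) ℂ) i j := counitHom_wt G i j

/-! ### Antipode -/

/-- A 2-tensor `M : ℂ → ℂ² ⊗ ℂ²`, as a square matrix. -/
def sqL (M : Matrix (Fin 2 × Fin 2) Unit ℂ) : Matrix (Fin 2) (Fin 2) ℂ := fun i j => M (i, j) ()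

/-- A 2-tensor `M : ℂ² ⊗ ℂ² → ℂ`, as a square matrix. -/
def sqR (M : Matrix Unit (Fin 2 × Fin 2) ℂ) : Matrix (Fin 2) (Fin 2) ℂ := fun i j => M () (i, j)

theorem sqR_mul_sqL : sqR G.E' * sqL G.E = 1 := by
  ext a c; simp [Matrix.mul_apply, sqR, sqL, G.zigzag, Matrix.one_apply]

theorem sqL_mul_sqR : sqL G.E * sqR G.E' = 1 := mul_eq_one_comm.mp (sqR_mul_sqL G)

theorem sqR_mul_sqL_t : sqR G.Et' * sqL G.Et = 1 := by
  ext a c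
  have := congrFun (congrFun (sqL_mul_sqR G) c) a
  have h2 := congrArg (starRingEnd ℂ) this
  simp only [Matrix.mul_apply, sqR, sqL, map_sum, map_mul, Matrix.one_apply] at h2 ⊢
  simp only [Data.Et, Data.Et', Prod.swap]
  rw [show (if a = c then (1 : ℂ) else 0) = starRingEnd ℂ (if c = a then 1 else 0) by
    by_cases h : a = c
    · rw [if_pos h, if_pos h.symm, map_one]
    · rw [if_neg h, if_neg (Ne.symm h), map_zero], ← h2]
  exact Finset.sum_congr rfl fun _ _ => mul_comm _ _

/-- The inverse of a representation with invariant tensors `e`, `e'`. -/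
def invMat {B : Type*} [Ring B] [Algebra ℂ B] (e : Matrix (Fin 2 × Fin 2) Unit ℂ)
    (e' : Matrix Unit (Fin 2 × Fin 2) ℂ) (W : Matrix (Fin 2) (Fin 2) B) :
    Matrix (Fin 2) (Fin 2) B :=
  cst B (sqL e) * W.transpose * cst B (sqR e')

theorem cst_mul {B : Type*} [Ring B] [Algebra ℂ B] {l m n : Type*} [Fintype m]
    (M : Matrix l m ℂ) (N : Matrix m n ℂ) : cst B (M * N) = cst B M * cst B N := by
  ext i j; simp [cst, Matrix.mul_apply, map_sum]

theorem cst_one {B : Type*} [Ring B] [Algebra ℂ B] {m : Type*} [Fintype m] [DecidableEq m] :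
    cst B (1 : Matrix m m ℂ) = 1 := by
  ext i j; by_cases h : i = j <;> simp [cst, Matrix.one_apply, h]

theorem mul_invMat {B : Type*} [Ring B] [Algebra ℂ B] {e : Matrix (Fin 2 × Fin 2) Unit ℂ}
    {e' : Matrix Unit (Fin 2 × Fin 2) ℂ} {W : Matrix (Fin 2) (Fin 2) B}
    (he : sqR e' * sqL e = 1) (h : (W ⊗ₖ W) * cst B e = cst B e) :
    W * invMat e e' W = 1 := by
  have key : W * cst B (sqL e) * W.transpose = cst B (sqL e) := by
    ext i j
    have := congrFun (congrFun h (i, j)) ()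
    rw [Matrix.mul_apply, Fintype.sum_prod_type] at this
    change _ = cst B e (i, j) ()
    rw [← this]
    simp only [Matrix.mul_apply, Finset.sum_mul, Matrix.transpose_apply]
    rw [Finset.sum_comm]
    refine Finset.sum_congr rfl fun a _ => Finset.sum_congr rfl fun b _ => ?_
    simp only [cst, Matrix.map_apply, sqL, Matrix.kroneckerMap_apply]
    rw [mul_assoc, Algebra.commutes, mul_assoc]
  rw [invMat, ← Matrix.mul_assoc, ← Matrix.mul_assoc, key, ← cst_mul, mul_eq_one_comm.mp he,
    cst_one]

theorem invMat_mul {B : Type*} [Ring B] [Algebra ℂ B] {e : Matrix (Fin 2 × Fin 2) Unit ℂ}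
    {e' : Matrix Unit (Fin 2 × Fin 2) ℂ} {W : Matrix (Fin 2) (Fin 2) B}
    (he : sqR e' * sqL e = 1) (h : cst B e' * (W ⊗ₖ W) = cst B e') :
    invMat e e' W * W = 1 := by
  have key : W.transpose * cst B (sqR e') * W = cst B (sqR e') := by
    ext i j
    have := congrFun (congrFun h ()) (i, j)
    rw [Matrix.mul_apply, Fintype.sum_prod_type] at this
    change _ = cst B e' () (i, j)
    rw [← this]
    simp only [Matrix.mul_apply, Finset.sum_mul, Matrix.transpose_apply]
    rw [Finset.sum_comm]
    refine Finset.sum_congr rfl fun a _ => Finset.sum_congr rfl fun b _ => ?_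
    simp only [cst, Matrix.map_apply, sqR, Matrix.kroneckerMap_apply]
    rw [← Algebra.commutes, mul_assoc]
  rw [invMat, Matrix.mul_assoc, Matrix.mul_assoc, ← Matrix.mul_assoc W.transpose, key, ← cst_mul,
    mul_eq_one_comm.mp he, cst_one]

/-- `w⁻¹` -/
def wInv : Matrix (Fin 2) (Fin 2) (Poly G) := invMat G.E G.E' (w G)

/-- `w̃⁻¹` -/
def wtInv : Matrix (Fin 2) (Fin 2) (Poly G) := invMat G.Et G.Et' (wt G)

theorem w_mul_wInv : w G * wInv G = 1 := mul_invMat (sqR_mul_sqL G) (sat_w G).E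
theorem wInv_mul_w : wInv G * w G = 1 := invMat_mul (sqR_mul_sqL G) (sat_w G).E'
theorem wt_mul_wtInv : wt G * wtInv G = 1 := mul_invMat (sqR_mul_sqL_t G) (sat_w G).Et
theorem wtInv_mul_wt : wtInv G * wt G = 1 := invMat_mul (sqR_mul_sqL_t G) (sat_w G).Et'

/-- The tensor product with the opposite multiplication. -/
def opKron {B : Type*} [Ring B] (V W : Matrix (Fin 2) (Fin 2) B) :
    Matrix (Fin 2 × Fin 2) (Fin 2 × Fin 2) B := fun p r => W p.2 r.2 * V p.1 r.1

theorem kron_mul_opKron {B : Type*} [Ring B] {V V' W W' : Matrix (Fin 2) (Fin 2) B}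
    (hV : V * V' = 1) (hW : W * W' = 1) : (V ⊗ₖ W) * opKron V' W' = 1 := by
  ext ⟨i, j⟩ ⟨k, l⟩
  have h1 : ∀ a, ∑ b, V i a * W j b * (W' b l * V' a k) =
      V i a * (W * W') j l * V' a k := by
    intro a
    simp only [Matrix.mul_apply, Finset.mul_sum, Finset.sum_mul, mul_assoc]
  rw [Matrix.mul_apply, Fintype.sum_prod_type]
  simp only [Matrix.kroneckerMap_apply, opKron, h1, hW]
  have h2 := congrFun (congrFun hV i) k
  rw [Matrix.mul_apply] at h2
  by_cases hjl : j = l <;> simp [hjl, Matrix.one_apply, h2]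

theorem opKron_mul_kron {B : Type*} [Ring B] {V V' W W' : Matrix (Fin 2) (Fin 2) B}
    (hV : V' * V = 1) (hW : W' * W = 1) : opKron V' W' * (V ⊗ₖ W) = 1 := by
  ext ⟨i, j⟩ ⟨k, l⟩
  have h1 : ∀ b, ∑ a, W' j b * V' i a * (V a k * W b l) =
      W' j b * (V' * V) i k * W b l := by
    intro b
    simp only [Matrix.mul_apply, Finset.mul_sum, Finset.sum_mul, mul_assoc]
  rw [Matrix.mul_apply, Fintype.sum_prod_type, Finset.sum_comm]
  simp only [Matrix.kroneckerMap_apply, opKron, h1, hV]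
  have h2 := congrFun (congrFun hW j) l
  rw [Matrix.mul_apply] at h2
  by_cases hik : i = k <;> simp [hik, Matrix.one_apply, h2]

theorem kron_op {B : Type*} [Ring B] (V W : Matrix (Fin 2) (Fin 2) B) :
    (V.map MulOpposite.op) ⊗ₖ (W.map MulOpposite.op) = (opKron V W).map MulOpposite.op := by
  ext p r; simp [opKron]

theorem map_op_mul_cst {B : Type*} [Ring B] [Algebra ℂ B] {l m n : Type*} [Fintype m]
    (V : Matrix l m B) (M : Matrix m n ℂ) :
    V.map MulOpposite.op * cst Bᵐᵒᵖ M = (V * cst B M).map MulOpposite.op := by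
  ext p r
  simp only [Matrix.mul_apply, Matrix.map_apply, cst, MulOpposite.algebraMap_apply,
    ← MulOpposite.op_mul, Algebra.commutes, Finset.op_sum]

theorem cst_mul_map_op {B : Type*} [Ring B] [Algebra ℂ B] {l m n : Type*} [Fintype m]
    (M : Matrix l m ℂ) (V : Matrix m n B) :
    cst Bᵐᵒᵖ M * V.map MulOpposite.op = (cst B M * V).map MulOpposite.op := by
  ext p r
  simp only [Matrix.mul_apply, Matrix.map_apply, cst, MulOpposite.algebraMap_apply,
    ← MulOpposite.op_mul, ← Algebra.commutes, Finset.op_sum]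

theorem cst_op {B : Type*} [Ring B] [Algebra ℂ B] {m n : Type*} (M : Matrix m n ℂ) :
    cst Bᵐᵒᵖ M = (cst B M).map MulOpposite.op := by
  rfl

theorem sat_antipode :
    Sat G ((wInv G).map MulOpposite.op) ((wtInv G).map MulOpposite.op) := by
  have a1 := opKron_mul_kron (wInv_mul_w G) (wInv_mul_w G)
  have a2 := opKron_mul_kron (wtInv_mul_wt G) (wtInv_mul_wt G)
  have a3 := kron_mul_opKron (w_mul_wInv G) (w_mul_wInv G)
  have a4 := kron_mul_opKron (wt_mul_wtInv G) (wt_mul_wtInv G)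
  have a5 := kron_mul_opKron (w_mul_wInv G) (wt_mul_wtInv G)
  have a6 := opKron_mul_kron (wtInv_mul_wt G) (wInv_mul_w G)
  constructor <;> simp only [kron_op, map_op_mul_cst, cst_mul_map_op] <;> try rw [cst_op]
  · congr 1; conv_lhs => rw [← (sat_w G).E, ← Matrix.mul_assoc, a1, Matrix.one_mul]
  · congr 1; conv_lhs => rw [← (sat_w G).Et, ← Matrix.mul_assoc, a2, Matrix.one_mul]
  · congr 1; conv_lhs => rw [← (sat_w G).E', Matrix.mul_assoc, a3, Matrix.mul_one]
  · congr 1; conv_lhs => rw [← (sat_w G).Et', Matrix.mul_assoc, a4, Matrix.mul_one]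
  · congr 1
    have := congrArg (fun M => opKron (wtInv G) (wInv G) * M * opKron (wInv G) (wtInv G))
      (sat_w G).X
    simp only at this
    rw [Matrix.mul_assoc, Matrix.mul_assoc (cst _ G.X), a5, Matrix.mul_one,
      ← Matrix.mul_assoc (opKron _ _) (_ ⊗ₖ _), a6, Matrix.one_mul] at this
    exact this.symm

/-- The antipode, as a homomorphism to the opposite algebra. -/
def antipodeHom : Poly G →ₐ[ℂ] (Poly G)ᵐᵒᵖ := lift (sat_antipode G)

/-- The antipode, as a linear map. -/
def antipodeLin : Poly G →ₗ[ℂ] Poly G :=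
  (MulOpposite.opLinearEquiv ℂ).symm.toLinearMap ∘ₗ (antipodeHom G).toLinearMap

theorem antipodeLin_mul (x y : Poly G) :
    antipodeLin G (x * y) = antipodeLin G y * antipodeLin G x := by
  simp [antipodeLin]

theorem antipodeLin_algebraMap (c : ℂ) :
    antipodeLin G (algebraMap ℂ _ c) = algebraMap ℂ _ c := by
  change MulOpposite.unop (antipodeHom G (algebraMap ℂ _ c)) = _
  rw [AlgHom.commutes]; rfl

theorem antipodeLin_w (i j : Fin 2) : antipodeLin G (w G i j) = wInv G i j := by
  simp [antipodeLin, antipodeHom]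

theorem antipodeLin_wt (i j : Fin 2) : antipodeLin G (wt G i j) = wtInv G i j := by
  simp [antipodeLin, antipodeHom]

/-- `x ⊗ y ↦ S(x) y` -/
def antL : Poly G ⊗[ℂ] Poly G →ₗ[ℂ] Poly G :=
  LinearMap.mul' ℂ (Poly G) ∘ₗ (antipodeLin G).rTensor (Poly G)

/-- `x ⊗ y ↦ x S(y)` -/
def antR : Poly G ⊗[ℂ] Poly G →ₗ[ℂ] Poly G :=
  LinearMap.mul' ℂ (Poly G) ∘ₗ (antipodeLin G).lTensor (Poly G)

theorem antL_tmul (x y : Poly G) : antL G (x ⊗ₜ y) = antipodeLin G x * y := by simp [antL]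

theorem antR_tmul (x y : Poly G) : antR G (x ⊗ₜ y) = x * antipodeLin G y := by simp [antR]

theorem antL_mul_tmul (s : Poly G ⊗[ℂ] Poly G) (x y : Poly G) :
    antL G (s * x ⊗ₜ y) = antipodeLin G x * antL G s * y := by
  induction s using TensorProduct.induction_on with
  | zero => simp
  | tmul a b => simp [antL_tmul, antipodeLin_mul, mul_assoc]
  | add a b ha hb => simp [add_mul, mul_add, ha, hb]

theorem antR_tmul_mul (s : Poly G ⊗[ℂ] Poly G) (x y : Poly G) :
    antR G (x ⊗ₜ y * s) = x * antR G s * antipodeLin G y := by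
  induction s using TensorProduct.induction_on with
  | zero => simp
  | tmul a b => simp [antR_tmul, antipodeLin_mul, mul_assoc]
  | add a b ha hb => simp [add_mul, mul_add, ha, hb]

theorem antL_comul (x : Poly G) : antL G (comulHom G x) = algebraMap ℂ _ (counitHom G x) := by
  induction x using induction with
  | h_alg c =>
    rw [AlgHom.commutes, AlgHom.commutes, Algebra.TensorProduct.algebraMap_apply, antL_tmul,
      antipodeLin_algebraMap]
    simp
  | h_w i j =>
    have := congrFun (congrFun (wInv_mul_w G) i) j
    rw [Matrix.mul_apply] at this
    simp only [comulHom_w, map_sum, antL_tmul, antipodeLin_w, this, counitHom_w]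
    by_cases h : i = j <;> simp [Matrix.one_apply, h]
  | h_wt i j =>
    have := congrFun (congrFun (wtInv_mul_wt G) i) j
    rw [Matrix.mul_apply] at this
    simp only [comulHom_wt, map_sum, antL_tmul, antipodeLin_wt, this, counitHom_wt]
    by_cases h : i = j <;> simp [Matrix.one_apply, h]
  | h_add x y hx hy => simp [hx, hy]
  | h_mul x y hx hy =>
    have key : ∀ t, antL G (comulHom G x * t) = algebraMap ℂ _ (counitHom G x) * antL G t := by
      intro t
      induction t using TensorProduct.induction_on with
      | zero => simp
      | tmul a b => rw [antL_mul_tmul, hx, antL_tmul, ← Algebra.commutes, mul_assoc]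
      | add a b ha hb => simp [mul_add, ha, hb]
    rw [map_mul, key, hy, map_mul, map_mul]

theorem antR_comul (x : Poly G) : antR G (comulHom G x) = algebraMap ℂ _ (counitHom G x) := by
  induction x using induction with
  | h_alg c =>
    rw [AlgHom.commutes, AlgHom.commutes, Algebra.TensorProduct.algebraMap_apply, antR_tmul,
      ← map_one (algebraMap ℂ (Poly G)), antipodeLin_algebraMap]
    simp
  | h_w i j =>
    have := congrFun (congrFun (w_mul_wInv G) i) j
    rw [Matrix.mul_apply] at this
    simp only [comulHom_w, map_sum, antR_tmul, antipodeLin_w, this, counitHom_w]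
    by_cases h : i = j <;> simp [Matrix.one_apply, h]
  | h_wt i j =>
    have := congrFun (congrFun (wt_mul_wtInv G) i) j
    rw [Matrix.mul_apply] at this
    simp only [comulHom_wt, map_sum, antR_tmul, antipodeLin_wt, this, counitHom_wt]
    by_cases h : i = j <;> simp [Matrix.one_apply, h]
  | h_add x y hx hy => simp [hx, hy]
  | h_mul x y hx hy =>
    have key : ∀ t, antR G (t * comulHom G y) = algebraMap ℂ _ (counitHom G y) * antR G t := by
      intro t
      induction t using TensorProduct.induction_on with
      | zero => simp
      | tmul a b => rw [antR_tmul_mul, hy, antR_tmul, ← Algebra.commutes, mul_assoc]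
      | add a b ha hb => simp [add_mul, mul_add, ha, hb]
    rw [map_mul, key, hx, ← map_mul (algebraMap ℂ (Poly G)), map_mul (counitHom G), mul_comm]

/-- `(𝒜, Δ)` is a Hopf algebra. -/
instance : HopfAlgebra ℂ (Poly G) where
  antipode := antipodeLin G
  mul_antipode_rTensor_comul := LinearMap.ext (antL_comul G)
  mul_antipode_lTensor_comul := LinearMap.ext (antR_comul G)

/-! ### The `*`-structure -/

/-- The opposite algebra with the conjugate complex structure. -/
def ConjOp (B : Type*) : Type _ := Bᵐᵒᵖ

instance (B : Type*) [Ring B] : Ring (ConjOp B) := inferInstanceAs (Ring Bᵐᵒᵖ)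

instance (B : Type*) [Ring B] [Algebra ℂ B] : Algebra ℂ (ConjOp B) :=
  RingHom.toAlgebra' ((algebraMap ℂ Bᵐᵒᵖ).comp (starRingEnd ℂ))
    fun c x => Algebra.commutes (A := Bᵐᵒᵖ) (starRingEnd ℂ c) x

/-- The identity map `B → ConjOp B`. -/
def cop {B : Type*} (x : B) : ConjOp B := MulOpposite.op x

theorem map_cop_mul_cst {B : Type*} [Ring B] [Algebra ℂ B] {l m n : Type*} [Fintype m]
    (V : Matrix l m B) (M : Matrix m n ℂ) :
    V.map cop * cst (ConjOp B) M = (V * cst B (M.map (starRingEnd ℂ))).map cop :=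
  map_op_mul_cst V (M.map (starRingEnd ℂ))

theorem cst_mul_map_cop {B : Type*} [Ring B] [Algebra ℂ B] {l m n : Type*} [Fintype m]
    (M : Matrix l m ℂ) (V : Matrix m n B) :
    cst (ConjOp B) M * V.map cop = (cst B (M.map (starRingEnd ℂ)) * V).map cop :=
  cst_mul_map_op (M.map (starRingEnd ℂ)) V

theorem cst_cop {B : Type*} [Ring B] [Algebra ℂ B] {m n : Type*} (M : Matrix m n ℂ) :
    cst (ConjOp B) M = (cst B (M.map (starRingEnd ℂ))).map cop :=
  cst_op (M.map (starRingEnd ℂ))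

theorem kron_cop {B : Type*} [Ring B] (V W : Matrix (Fin 2) (Fin 2) B) :
    (V.map cop) ⊗ₖ (W.map cop) = ((W ⊗ₖ V).submatrix Prod.swap Prod.swap).map cop := kron_op V W

theorem submatrix_mul_swap {B : Type*} [Ring B] {l m n l' n' : Type*} [Fintype m]
    (V : Matrix l (m × m) B) (W : Matrix (m × m) n B) (f : l' → l) (g : n' → n) :
    V.submatrix f Prod.swap * W.submatrix Prod.swap g = (V * W).submatrix f g :=
  Matrix.submatrix_mul_equiv V W f (Equiv.prodComm m m) g

/-- `w_{ij} ↦ w̃_{ij}`, `w̃_{ij} ↦ w_{ij}` is compatible with the relations. -/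
theorem sat_star : Sat G ((wt G).map cop) ((w G).map cop) := by
  have hE : cst (Poly G) (G.E.map (starRingEnd ℂ)) =
      (cst (Poly G) G.Et).submatrix Prod.swap id := by
    ext p u; simp [cst, Data.Et]
  have hEt : cst (Poly G) (G.Et.map (starRingEnd ℂ)) =
      (cst (Poly G) G.E).submatrix Prod.swap id := by
    ext p u; simp [cst, Data.Et]
  have hE' : cst (Poly G) (G.E'.map (starRingEnd ℂ)) =
      (cst (Poly G) G.Et').submatrix id Prod.swap := by
    ext p u; simp [cst, Data.Et']
  have hEt' : cst (Poly G) (G.Et'.map (starRingEnd ℂ)) =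
      (cst (Poly G) G.E').submatrix id Prod.swap := by
    ext p u; simp [cst, Data.Et']
  have hX : cst (Poly G) (G.X.map (starRingEnd ℂ)) =
      (G.β⁻¹ • cst (Poly G) G.X).submatrix Prod.swap Prod.swap := by
    ext p r
    have := congrFun (congrFun G.tauConj_X p.swap) r.swap
    simp only [tauConj, Matrix.submatrix_apply, Matrix.map_apply, Prod.swap_swap,
      Matrix.smul_apply, smul_eq_mul] at this
    simp only [cst, Matrix.submatrix_apply, Matrix.map_apply, this, map_mul]
    rw [Matrix.smul_apply, Algebra.smul_def, Matrix.map_apply]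
  constructor <;> simp only [kron_cop, map_cop_mul_cst, cst_mul_map_cop] <;> try rw [cst_cop]
  · rw [hE, submatrix_mul_swap, (sat_w G).Et]
  · rw [hEt, submatrix_mul_swap, (sat_w G).E]
  · rw [hE', submatrix_mul_swap, (sat_w G).Et']
  · rw [hEt', submatrix_mul_swap, (sat_w G).E']
  · rw [hX, submatrix_mul_swap, submatrix_mul_swap, Matrix.smul_mul, Matrix.mul_smul, (sat_w G).X]

/-- The conjugation, as a homomorphism to the conjugate opposite algebra. -/
def starHom : Poly G →ₐ[ℂ] ConjOp (Poly G) := lift (sat_star G)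

/-- The `*`-operation on `𝒜`: the conjugate-linear antimultiplicative map with `w_{ij}* = w̃_{ij}`
and `w̃_{ij}* = w_{ij}`. -/
instance : Star (Poly G) := ⟨fun x => MulOpposite.unop (starHom G x)⟩

theorem star_w (i j : Fin 2) : star (w G i j) = wt G i j :=
  congrArg MulOpposite.unop (lift_w (sat_star G) i j)

theorem star_wt (i j : Fin 2) : star (wt G i j) = w G i j :=
  congrArg MulOpposite.unop (lift_wt (sat_star G) i j)

theorem star_mul' (x y : Poly G) : star (x * y) = star y * star x :=
  congrArg MulOpposite.unop (map_mul (starHom G) x y)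

theorem star_add' (x y : Poly G) : star (x + y) = star x + star y :=
  congrArg MulOpposite.unop (map_add (starHom G) x y)

theorem star_algebraMap (c : ℂ) :
    star (algebraMap ℂ (Poly G) c) = algebraMap ℂ (Poly G) (starRingEnd ℂ c) :=
  congrArg MulOpposite.unop ((starHom G).commutes c)

instance : StarRing (Poly G) where
  star_involutive x := by
    induction x using induction with
    | h_alg c => simp [star_algebraMap]
    | h_w i j => rw [star_w, star_wt]
    | h_wt i j => rw [star_wt, star_w]
    | h_add x y hx hy => rw [star_add', star_add', hx, hy]
    | h_mul x y hx hy => rw [star_mul', star_mul', hx, hy]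
  star_mul := star_mul' G
  star_add := star_add' G

instance : StarModule ℂ (Poly G) where
  star_smul c x := by
    rw [Algebra.smul_def, star_mul', star_algebraMap, ← Algebra.commutes, Algebra.smul_def]; rfl

/-- `(* ⊗ *) Δ(x) = Δ(x*)`, so that `(𝒜, Δ)` is a Hopf `*`-algebra. -/
theorem comul_star (x : Poly G) :
    Coalgebra.comul (R := ℂ) (star x) = star (Coalgebra.comul (R := ℂ) x) := by
  induction x using induction with
  | h_alg c =>
    rw [star_algebraMap, Bialgebra.comul_algebraMap, Bialgebra.comul_algebraMap,
      Algebra.TensorProduct.algebraMap_apply, Algebra.TensorProduct.algebraMap_apply,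
      TensorProduct.star_tmul, star_algebraMap, star_one]
  | h_w i j => simp only [star_w, comul_w, comul_wt, star_sum, TensorProduct.star_tmul]
  | h_wt i j => simp only [star_wt, comul_w, comul_wt, star_sum, TensorProduct.star_tmul]
  | h_add x y hx hy => rw [star_add, map_add, hx, hy, map_add, star_add]
  | h_mul x y hx hy =>
    rw [star_mul, Bialgebra.comul_mul, hx, hy, Bialgebra.comul_mul, star_mul]

/-! ### Coquasitriangular structures -/

section CQT

variable {B : Type*} [Ring B] [Bialgebra ℂ B]

/-- The convolution `f * g = (f ⊗ g) Δ` of linear functionals on a coalgebra. -/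
def conv {C : Type*} [AddCommGroup C] [Module ℂ C] [Coalgebra ℂ C] (f g : C →ₗ[ℂ] ℂ) :
    C →ₗ[ℂ] ℂ :=
  LinearMap.mul' ℂ ℂ ∘ₗ TensorProduct.map f g ∘ₗ Coalgebra.comul

/-- `R` is a coquasitriangular structure on the bialgebra `B`, where `R` is a linear functional
on `B ⊗ B`. In the last axiom, `B ⊗ B` carries the comultiplication
`x ⊗ y ↦ (x⁽¹⁾ ⊗ y⁽¹⁾) ⊗ (x⁽²⁾ ⊗ y⁽²⁾)`. -/
structure IsCQT (R : B ⊗[ℂ] B →ₗ[ℂ] ℂ) : Prop where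
  one_left : ∀ x : B, R (1 ⊗ₜ x) = Coalgebra.counit x
  one_right : ∀ x : B, R (x ⊗ₜ 1) = Coalgebra.counit x
  /-- `R(xy ⊗ z) = R(x ⊗ z⁽¹⁾) R(y ⊗ z⁽²⁾)` -/
  mul_left : ∀ x y z : B, R ((x * y) ⊗ₜ z) =
    conv (R ∘ₗ TensorProduct.mk ℂ B B x) (R ∘ₗ TensorProduct.mk ℂ B B y) z
  /-- `R(x ⊗ yz) = R(x⁽¹⁾ ⊗ z) R(x⁽²⁾ ⊗ y)` -/
  mul_right : ∀ x y z : B, R (x ⊗ₜ (y * z)) =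
    conv (R ∘ₗ (TensorProduct.mk ℂ B B).flip z) (R ∘ₗ (TensorProduct.mk ℂ B B).flip y) x
  /-- `y⁽¹⁾ x⁽¹⁾ R(x⁽²⁾ ⊗ y⁽²⁾) = R(x⁽¹⁾ ⊗ y⁽¹⁾) x⁽²⁾ y⁽²⁾` -/
  comm : ∀ x y : B,
    TensorProduct.rid ℂ B (TensorProduct.map
      (LinearMap.mul' ℂ B ∘ₗ (TensorProduct.comm ℂ B B).toLinearMap) R
      (Coalgebra.comul (R := ℂ) (x ⊗ₜ[ℂ] y))) =
    TensorProduct.lid ℂ B (TensorProduct.map R (LinearMap.mul' ℂ B)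
      (Coalgebra.comul (R := ℂ) (x ⊗ₜ[ℂ] y)))

/-- `R` is a cotriangular structure: moreover
`R(x⁽¹⁾ ⊗ y⁽¹⁾) R(y⁽²⁾ ⊗ x⁽²⁾) = ε(x) ε(y)`. -/
structure IsCT (R : B ⊗[ℂ] B →ₗ[ℂ] ℂ) : Prop extends IsCQT R where
  inv : ∀ x y : B, conv R (R ∘ₗ (TensorProduct.comm ℂ B B).toLinearMap) (x ⊗ₜ[ℂ] y) =
    Coalgebra.counit (R := ℂ) x * Coalgebra.counit (R := ℂ) y

/-- The reality condition `conj R(y* ⊗ x*) = R(x ⊗ y)` of a C(Q)T `*`-structure. -/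
def IsReal [StarRing B] (R : B ⊗[ℂ] B →ₗ[ℂ] ℂ) : Prop :=
  ∀ x y : B, starRingEnd ℂ (R (star y ⊗ₜ star x)) = R (x ⊗ₜ y)

/-- The matrix `(R^{vv'})_{ij,kl} = R(v_{jk} ⊗ v'_{il})`. -/
def Rmat (R : B ⊗[ℂ] B →ₗ[ℂ] ℂ) (v v' : Matrix (Fin 2) (Fin 2) B) :
    Matrix (Fin 2 × Fin 2) (Fin 2 × Fin 2) ℂ :=
  fun p r => R (v p.2 r.1 ⊗ₜ v' p.1 r.2)

end CQT

/-- `L_c = c (1 + c⁻² E E')` -/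
def Data.L (c : ℂ) : Matrix (Fin 2 × Fin 2) (Fin 2 × Fin 2) ℂ :=
  c • (1 + (c ^ 2)⁻¹ • (G.E * G.E'))

/-- For a chosen square root `r` of `q`, the numbers `q₁, q₂ = ± q^{1/2}`,
`q₃, q₄ = ± q^{-1/2}`. -/
def qroot (r : ℂ) : Fin 4 → ℂ := ![r, -r, r⁻¹, -r⁻¹]

/-- `R^{ww} = L_c`, `R^{w̄w̄} = τ conj(L_d⁻¹) τ`, `R^{ww̄} = s X`, `R^{w̄w} = s' X⁻¹`. -/
structure HasForm (R : Poly G ⊗[ℂ] Poly G →ₗ[ℂ] ℂ) (c d : ℂ) (s s' : ℤˣ) : Prop where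
  w_w : Rmat R (w G) (w G) = G.L c
  wt_wt : Rmat R (wt G) (wt G) = tauConj (G.L d)⁻¹
  w_wt : Rmat R (w G) (wt G) = ((s : ℤ) : ℂ) • G.X
  wt_w : Rmat R (wt G) (w G) = ((s' : ℤ) : ℂ) • G.X⁻¹

end QLorentz

end

/-! A CQT structure is determined by its four matrices `R^{vv'}` on generators (`IsBichar.ext_V`),
and the axioms constrain these in two ways. The commutation axiom makes `R^{vv'}` an intertwiner
from `v ⊗ v'` to `v' ⊗ v`. The multiplicativity axioms make `x ↦ R(x ⊗ v)` and, up to a transpose,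
`y ↦ R(v ⊗ y)` representations of 𝒜 in `M₂(ℂ)`, so the 2×2 blocks of the matrices satisfy the
defining relations. In pictures, an auxiliary strand slides past the cups `E`, `Ẽ` and past the
crossing `X`.

The intertwiner spaces are small: `End(w ⊗ w)` is spanned by `1` and `EE'`, `End(w̃ ⊗ w̃)` by `1`
and `ẼẼ'`, and `End(w ⊗ w̃)` consists of scalars. Hence `R^{ww} = x + y EE'`, `R^{ww̃} = sX` and
`R^{w̃w} = s'X⁻¹`, and sliding past the cups gives `xy = 1`, `x² + x⁻² = -E'E`, `s² = 1`, `s²β² = 1`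
and `s'²β⁻² = 1` (`IsCQT.exists_params`).

Conversely, for admissible parameters both families of block representations exist. They agree on
generators and glue to a bicharacter (`RepPair.bichar`). Since both sides of the commutation
relation are multiplicative in a suitable sense, it spreads from generators to 𝒜 (`IsBichar.isCQT`).

The delicate point is the upper bound on intertwiners, obtained without a basis of 𝒜. Let 𝒜 act on
the split algebra, with the same `E` but `X = τ`: `w` by left multiplication, and `w̃` by a left
translation along `σ(w) = X` composed with a right translation along `σ'(w) = X⁻¹` (`sat_twist`).
Acting on the unit sends `w̃` to the identity matrix and carries intertwiners of `w ⊗ w` and `w ⊗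
w̃` to the split algebra. That algebra maps to `M₂(ℂ)` by any `W` preserving `E`, with `w̃ ↦ 1`. A
triangular family of such `W` already has the right commutant (`commutant_tri`); `E'E ≠ 0` enters
there as `t⁴ + 1 ≠ 0`. Each translation preserves `Ẽ` only up to the character `w ↦ β²`, which
exists because `β⁴ = 1` always holds (`beta_pow_four`); the two defects cancel.

Reality and cotriangularity also reduce to generators (`IsBichar.real_iff`, `IsBichar.inv_iff`), and
the numbers of structures are numbers of parameter tuples (`encard_cqt`). -/

noncomputable section

namespace QLorentz

section

/-! ### Tensor calculus on `ℂ² ⊗ ℂ² ⊗ ℂ²` -/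

/-- The index set of the canonical basis of `ℂ² ⊗ ℂ²`. -/
abbrev I2 : Type := Fin 2 × Fin 2

/-- The index set of the canonical basis of `ℂ² ⊗ ℂ² ⊗ ℂ²`. -/
abbrev I3 : Type := Fin 2 × Fin 2 × Fin 2

/-- `M ⊗ 1` -/
def op12 (M : Matrix I2 I2 ℂ) : Matrix I3 I3 ℂ :=
  fun p r => if p.2.2 = r.2.2 then M (p.1, p.2.1) (r.1, r.2.1) else 0

/-- `1 ⊗ M` -/
def op23 (M : Matrix I2 I2 ℂ) : Matrix I3 I3 ℂ :=
  fun p r => if p.1 = r.1 then M p.2 r.2 else 0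

/-- `E ⊗ 1` -/
def col12 (E : Matrix I2 Unit ℂ) : Matrix I3 (Fin 2) ℂ :=
  fun p r => if p.2.2 = r then E (p.1, p.2.1) () else 0

/-- `1 ⊗ E` -/
def col23 (E : Matrix I2 Unit ℂ) : Matrix I3 (Fin 2) ℂ :=
  fun p r => if p.1 = r then E p.2 () else 0

/-- `E' ⊗ 1` -/
def row12 (E' : Matrix Unit I2 ℂ) : Matrix (Fin 2) I3 ℂ :=
  fun r p => if r = p.2.2 then E' () (p.1, p.2.1) else 0

/-- `1 ⊗ E'` -/
def row23 (E' : Matrix Unit I2 ℂ) : Matrix (Fin 2) I3 ℂ :=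
  fun r p => if r = p.1 then E' () p.2 else 0

theorem op12_mul (M N : Matrix I2 I2 ℂ) : op12 (M * N) = op12 M * op12 N := by
  ext ⟨i, j, k⟩ ⟨l, m, n⟩
  simp [op12, Matrix.mul_apply, Fintype.sum_prod_type]

theorem op23_mul (M N : Matrix I2 I2 ℂ) : op23 (M * N) = op23 M * op23 N := by
  ext ⟨i, j, k⟩ ⟨l, m, n⟩
  simp only [op23, Matrix.mul_apply, Fintype.sum_prod_type]
  by_cases h : i = l <;> simp [h]

@[simp] theorem op12_one : op12 1 = 1 := by
  ext ⟨i, j, k⟩ ⟨l, m, n⟩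
  simp only [op12, Matrix.one_apply, Prod.mk.injEq]
  split_ifs <;> simp_all

@[simp] theorem op23_one : op23 1 = 1 := by
  ext ⟨i, j, k⟩ ⟨l, m, n⟩
  simp only [op23, Matrix.one_apply, Prod.mk.injEq]
  split_ifs <;> simp_all

theorem op12_add (M N : Matrix I2 I2 ℂ) : op12 (M + N) = op12 M + op12 N := by
  ext p r; simp only [op12, Matrix.add_apply]; split_ifs <;> simp

theorem op23_add (M N : Matrix I2 I2 ℂ) : op23 (M + N) = op23 M + op23 N := by
  ext p r; simp only [op23, Matrix.add_apply]; split_ifs <;> simp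

theorem op12_smul (c : ℂ) (M : Matrix I2 I2 ℂ) : op12 (c • M) = c • op12 M := by
  ext p r; simp only [op12, Matrix.smul_apply]; split_ifs <;> simp

theorem op23_smul (c : ℂ) (M : Matrix I2 I2 ℂ) : op23 (c • M) = c • op23 M := by
  ext p r; simp only [op23, Matrix.smul_apply]; split_ifs <;> simp

theorem op12_col_row (E : Matrix I2 Unit ℂ) (E' : Matrix Unit I2 ℂ) :
    op12 (E * E') = col12 E * row12 E' := by
  ext ⟨i, j, k⟩ ⟨l, m, n⟩
  simp only [op12, col12, row12, Matrix.mul_apply]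
  by_cases h : k = n <;> simp [h]

theorem op23_col_row (E : Matrix I2 Unit ℂ) (E' : Matrix Unit I2 ℂ) :
    op23 (E * E') = col23 E * row23 E' := by
  ext ⟨i, j, k⟩ ⟨l, m, n⟩
  simp only [op23, col23, row23, Matrix.mul_apply]
  by_cases h : i = l <;> simp [h]

theorem row12_mul_col12 (E : Matrix I2 Unit ℂ) (E' : Matrix Unit I2 ℂ) :
    row12 E' * col12 E = (E' * E) () () • (1 : Matrix (Fin 2) (Fin 2) ℂ) := by
  ext i j
  simp only [col12, row12, Matrix.mul_apply, Fintype.sum_prod_type, Matrix.smul_apply,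
    Matrix.one_apply]
  by_cases h : i = j <;> simp [h]

theorem row23_mul_col23 (E : Matrix I2 Unit ℂ) (E' : Matrix Unit I2 ℂ) :
    row23 E' * col23 E = (E' * E) () () • (1 : Matrix (Fin 2) (Fin 2) ℂ) := by
  ext i j
  simp only [col23, row23, Matrix.mul_apply, Fintype.sum_prod_type, Matrix.smul_apply,
    Matrix.one_apply]
  by_cases h : i = j <;> simp [h]

theorem row12_mul_col23 {E : Matrix I2 Unit ℂ} {E' : Matrix Unit I2 ℂ}
    (h : sqR E' * sqL E = 1) : row12 E' * col23 E = 1 := by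
  rw [← Matrix.transpose_one, ← h]
  ext i j
  simp [col23, row12, sqR, sqL, Matrix.mul_apply, Fintype.sum_prod_type]

/-- The second zigzag identity comes for free: the first says that two square matrices are one-sided
inverses, hence two-sided ones. -/
theorem row23_mul_col12 {E : Matrix I2 Unit ℂ} {E' : Matrix Unit I2 ℂ}
    (h : sqR E' * sqL E = 1) : row23 E' * col12 E = 1 := by
  rw [← mul_eq_one_comm.mp h]
  ext i j
  simp [col12, row23, sqR, sqL, Matrix.mul_apply, Fintype.sum_prod_type, mul_comm]

/-! ### Blocks of endomorphisms of `ℂ² ⊗ ℂ²` -/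

/-- The algebra `M₂(ℂ)`. -/
abbrev M2 : Type := Matrix (Fin 2) (Fin 2) ℂ

/-- `M` as a matrix over `M₂(ℂ)`, see `Rmat`: `R(v_{jk} ⊗ v')`. -/
def blkL (M : Matrix I2 I2 ℂ) : Matrix (Fin 2) (Fin 2) M2 := fun j k i l => M (i, j) (k, l)

/-- `M` as a matrix over `M₂(ℂ)`, see `Rmat`: the transpose of `R(v ⊗ v'_{il})`. -/
def blkR (M : Matrix I2 I2 ℂ) : Matrix (Fin 2) (Fin 2) M2 := fun i l k j => M (i, j) (k, l)

theorem cst_matrix_apply {m n : Type*} (N : Matrix m n ℂ) (p : m) (r : n) :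
    cst M2 N p r = N p r • (1 : M2) := by
  rw [cst, Matrix.map_apply, Algebra.algebraMap_eq_smul_one]

/-- The inner product of `M₂(ℂ)` composes along an auxiliary strand. `blkL M` moves it from the
right of a strand to its left, so two blocks carry it from the third leg to the first. -/
theorem blkL_col (M : Matrix I2 I2 ℂ) (E : Matrix I2 Unit ℂ) (i j m n : Fin 2) (u : Unit) :
    ((blkL M ⊗ₖ blkL M) * cst M2 E) (i, j) u m n = (op12 M * op23 M * col12 E) (m, i, j) n := by
  simp only [Matrix.mul_apply, Matrix.kroneckerMap_apply, cst_matrix_apply,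
    Matrix.mul_smul, Matrix.mul_one, blkL, op12, op23, col12, Fintype.sum_prod_type,
    Matrix.sum_apply, Matrix.smul_apply, Fin.sum_univ_two]
  fin_cases j <;> fin_cases n <;> simp <;> ring

/-- Here the auxiliary strand runs from the first leg to the third, and its indices are transposed;
this reverses the order of the two factors. -/
theorem blkR_col (M : Matrix I2 I2 ℂ) (E : Matrix I2 Unit ℂ) (i j m n : Fin 2) (u : Unit) :
    ((blkR M ⊗ₖ blkR M) * cst M2 E) (i, j) u m n = (op23 M * op12 M * col23 E) (i, j, n) m := by
  simp only [Matrix.mul_apply, Matrix.kroneckerMap_apply, cst_matrix_apply,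
    Matrix.mul_smul, Matrix.mul_one, blkR, op12, op23, col23, Fintype.sum_prod_type,
    Matrix.sum_apply, Matrix.smul_apply, Fin.sum_univ_two]
  fin_cases i <;> fin_cases m <;> simp <;> ring

theorem blkL_row (M : Matrix I2 I2 ℂ) (E' : Matrix Unit I2 ℂ) (i j m n : Fin 2) (u : Unit) :
    (cst M2 E' * (blkL M ⊗ₖ blkL M)) u (i, j) m n = (row23 E' * (op12 M * op23 M)) m (i, j, n) := by
  simp only [Matrix.mul_apply, Matrix.kroneckerMap_apply, cst_matrix_apply,
    Matrix.smul_mul, Matrix.one_mul, blkL, op12, op23, row23, Fintype.sum_prod_type,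
    Matrix.sum_apply, Matrix.smul_apply, Fin.sum_univ_two]
  fin_cases i <;> fin_cases m <;> simp

theorem blkR_row (M : Matrix I2 I2 ℂ) (E' : Matrix Unit I2 ℂ) (i j m n : Fin 2) (u : Unit) :
    (cst M2 E' * (blkR M ⊗ₖ blkR M)) u (i, j) m n = (row12 E' * (op23 M * op12 M)) n (m, i, j) := by
  simp only [Matrix.mul_apply, Matrix.kroneckerMap_apply, cst_matrix_apply,
    Matrix.smul_mul, Matrix.one_mul, blkR, op12, op23, row12, Fintype.sum_prod_type,
    Matrix.sum_apply, Matrix.smul_apply, Fin.sum_univ_two]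
  fin_cases j <;> fin_cases n <;> simp <;> ring

theorem blkL_kron (M N : Matrix I2 I2 ℂ) (i j k l m n : Fin 2) :
    (blkL M ⊗ₖ blkL N) (i, j) (k, l) m n = (op12 M * op23 N) (m, i, j) (k, l, n) := by
  simp [Matrix.mul_apply, blkL, op12, op23, Fintype.sum_prod_type]

theorem blkR_kron (M N : Matrix I2 I2 ℂ) (i j k l m n : Fin 2) :
    (blkR M ⊗ₖ blkR N) (i, j) (k, l) m n = (op23 N * op12 M) (i, j, n) (m, k, l) := by
  simp [Matrix.mul_apply, blkR, op12, op23, Fintype.sum_prod_type, mul_comm]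

theorem blkL_X_left (X M N : Matrix I2 I2 ℂ) (i j k l m n : Fin 2) :
    (cst M2 X * (blkL M ⊗ₖ blkL N)) (i, j) (k, l) m n =
      (op23 X * (op12 M * op23 N)) (m, i, j) (k, l, n) := by
  rw [Matrix.mul_apply, Matrix.mul_apply, Matrix.sum_apply]
  simp only [Fintype.sum_prod_type, cst_matrix_apply, Matrix.smul_mul, Matrix.one_mul,
    Matrix.smul_apply, blkL_kron]
  fin_cases m <;> simp [op23]

theorem blkL_X_right (X M N : Matrix I2 I2 ℂ) (i j k l m n : Fin 2) :
    ((blkL M ⊗ₖ blkL N) * cst M2 X) (i, j) (k, l) m n =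
      (op12 M * op23 N * op12 X) (m, i, j) (k, l, n) := by
  rw [Matrix.mul_apply, Matrix.mul_apply, Matrix.sum_apply]
  simp only [Fintype.sum_prod_type, cst_matrix_apply, Matrix.mul_smul, Matrix.mul_one,
    Matrix.smul_apply, blkL_kron]
  fin_cases n <;> simp [op12, mul_comm]

theorem blkR_X_left (X M N : Matrix I2 I2 ℂ) (i j k l m n : Fin 2) :
    (cst M2 X * (blkR M ⊗ₖ blkR N)) (i, j) (k, l) m n =
      (op12 X * (op23 N * op12 M)) (i, j, n) (m, k, l) := by
  rw [Matrix.mul_apply, Matrix.mul_apply, Matrix.sum_apply]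
  simp only [Fintype.sum_prod_type, cst_matrix_apply, Matrix.smul_mul, Matrix.one_mul,
    Matrix.smul_apply, blkR_kron]
  fin_cases n <;> simp [op12]

theorem blkR_X_right (X M N : Matrix I2 I2 ℂ) (i j k l m n : Fin 2) :
    ((blkR M ⊗ₖ blkR N) * cst M2 X) (i, j) (k, l) m n =
      (op23 N * op12 M * op23 X) (i, j, n) (m, k, l) := by
  rw [Matrix.mul_apply, Matrix.mul_apply, Matrix.sum_apply]
  simp only [Fintype.sum_prod_type, cst_matrix_apply, Matrix.mul_smul, Matrix.mul_one,
    Matrix.smul_apply, blkR_kron]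
  fin_cases m <;> simp [op23, mul_comm]

theorem cst_col_apply (E : Matrix I2 Unit ℂ) (i j m n : Fin 2) (u : Unit) :
    cst M2 E (i, j) u m n = col23 E (m, i, j) n := by
  rw [cst_matrix_apply]
  simp [col23, Matrix.one_apply]

theorem cst_col_apply' (E : Matrix I2 Unit ℂ) (i j m n : Fin 2) (u : Unit) :
    cst M2 E (i, j) u m n = col12 E (i, j, n) m := by
  rw [cst_matrix_apply]
  simp [col12, Matrix.one_apply, eq_comm]

theorem cst_row_apply (E' : Matrix Unit I2 ℂ) (i j m n : Fin 2) (u : Unit) :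
    cst M2 E' u (i, j) m n = row12 E' m (i, j, n) := by
  rw [cst_matrix_apply]
  simp [row12, Matrix.one_apply]

theorem cst_row_apply' (E' : Matrix Unit I2 ℂ) (i j m n : Fin 2) (u : Unit) :
    cst M2 E' u (i, j) m n = row23 E' n (m, i, j) := by
  rw [cst_matrix_apply]
  simp [row23, Matrix.one_apply, eq_comm]

/-- Invariance of a cup under the blocks means that the auxiliary strand slides past the cup. This
translates the defining relations into identities on three legs. -/
theorem blkL_col_iff {M : Matrix I2 I2 ℂ} {E : Matrix I2 Unit ℂ} :
    (blkL M ⊗ₖ blkL M) * cst M2 E = cst M2 E ↔ op12 M * op23 M * col12 E = col23 E := by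
  constructor
  · intro h
    ext ⟨m, i, j⟩ n
    rw [← blkL_col M E i j m n (), h, cst_col_apply]
  · intro h
    ext ⟨i, j⟩ u m n
    rw [blkL_col, h, cst_col_apply]

theorem blkR_col_iff {M : Matrix I2 I2 ℂ} {E : Matrix I2 Unit ℂ} :
    (blkR M ⊗ₖ blkR M) * cst M2 E = cst M2 E ↔ op23 M * op12 M * col23 E = col12 E := by
  constructor
  · intro h
    ext ⟨i, j, n⟩ m
    rw [← blkR_col M E i j m n (), h, cst_col_apply']
  · intro h
    ext ⟨i, j⟩ u m n
    rw [blkR_col, h, cst_col_apply']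

theorem blkL_row_iff {M : Matrix I2 I2 ℂ} {E' : Matrix Unit I2 ℂ} :
    cst M2 E' * (blkL M ⊗ₖ blkL M) = cst M2 E' ↔ row23 E' * (op12 M * op23 M) = row12 E' := by
  constructor
  · intro h
    ext m ⟨i, j, n⟩
    rw [← blkL_row M E' i j m n (), h, cst_row_apply]
  · intro h
    ext u ⟨i, j⟩ m n
    rw [blkL_row, h, cst_row_apply]

theorem blkR_row_iff {M : Matrix I2 I2 ℂ} {E' : Matrix Unit I2 ℂ} :
    cst M2 E' * (blkR M ⊗ₖ blkR M) = cst M2 E' ↔ row12 E' * (op23 M * op12 M) = row23 E' := by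
  constructor
  · intro h
    ext n ⟨m, i, j⟩
    rw [← blkR_row M E' i j m n (), h, cst_row_apply']
  · intro h
    ext u ⟨i, j⟩ m n
    rw [blkR_row, h, cst_row_apply']

/-- The relation of `w` and `w̃` becomes a Yang–Baxter type relation: the auxiliary strand slides
past the crossing `X`. -/
theorem blkL_X_iff {X M N : Matrix I2 I2 ℂ} :
    cst M2 X * (blkL M ⊗ₖ blkL N) = (blkL N ⊗ₖ blkL M) * cst M2 X ↔
      op23 X * (op12 M * op23 N) = op12 N * op23 M * op12 X := by
  constructor
  · intro h
    ext ⟨m, i, j⟩ ⟨k, l, n⟩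
    rw [← blkL_X_left, h, blkL_X_right]
  · intro h
    ext ⟨i, j⟩ ⟨k, l⟩ m n
    rw [blkL_X_left, h, blkL_X_right]

theorem blkR_X_iff {X M N : Matrix I2 I2 ℂ} :
    cst M2 X * (blkR M ⊗ₖ blkR N) = (blkR N ⊗ₖ blkR M) * cst M2 X ↔
      op12 X * (op23 N * op12 M) = op23 M * op12 N * op23 X := by
  constructor
  · intro h
    ext ⟨i, j, n⟩ ⟨m, k, l⟩
    rw [← blkR_X_left, h, blkR_X_right]
  · intro h
    ext ⟨i, j⟩ ⟨k, l⟩ m n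
    rw [blkR_X_left, h, blkR_X_right]

/-- Over `M₂(ℂ)`, invariance of `e` implies invariance of the inverse form `e'`. -/
theorem row_of_col {e : Matrix I2 Unit ℂ} {e' : Matrix Unit I2 ℂ} {W : Matrix (Fin 2) (Fin 2) M2}
    (he : sqR e' * sqL e = 1) (h : (W ⊗ₖ W) * cst M2 e = cst M2 e) :
    cst M2 e' * (W ⊗ₖ W) = cst M2 e' := by
  -- Finite dimensionality enters here: for matrices over `M₂(ℂ)` a right inverse is also a left
  -- inverse.
  have h1 : invMat e e' W * W = 1 := mul_eq_one_comm.mp (mul_invMat he h)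
  have h2 : W.transpose * cst M2 (sqR e') * W = cst M2 (sqR e') := by
    have := congrArg (cst M2 (sqR e') * ·) h1
    simp only [invMat, Matrix.mul_one] at this
    rwa [← Matrix.mul_assoc, ← Matrix.mul_assoc, ← Matrix.mul_assoc, ← cst_mul, he, cst_one,
      Matrix.one_mul] at this
  ext1 u ⟨i, j⟩
  have h3 := congrFun (congrFun h2 i) j
  change _ = cst M2 (sqR e') i j
  rw [← h3, Matrix.mul_apply, Fintype.sum_prod_type]
  simp only [Matrix.mul_apply, Finset.sum_mul, Matrix.transpose_apply]
  rw [Finset.sum_comm]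
  refine Finset.sum_congr rfl fun a _ => Finset.sum_congr rfl fun b _ => ?_
  simp only [cst, Matrix.map_apply, sqR, Matrix.kroneckerMap_apply]
  rw [← Algebra.commutes, mul_assoc]

theorem row23_of_col {e : Matrix I2 Unit ℂ} {e' : Matrix Unit I2 ℂ} {M : Matrix I2 I2 ℂ}
    (he : sqR e' * sqL e = 1) (h : op12 M * op23 M * col12 e = col23 e) :
    row23 e' * (op12 M * op23 M) = row12 e' :=
  blkL_row_iff.mp (row_of_col he (blkL_col_iff.mpr h))

theorem row12_of_col {e : Matrix I2 Unit ℂ} {e' : Matrix Unit I2 ℂ} {M : Matrix I2 I2 ℂ}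
    (he : sqR e' * sqL e = 1) (h : op23 M * op12 M * col23 e = col12 e) :
    row12 e' * (op23 M * op12 M) = row23 e' :=
  blkR_row_iff.mp (row_of_col he (blkR_col_iff.mpr h))

end

section

/-! ### The braid-like endomorphisms `c + c⁻¹ E E'` -/

/-- `c + c⁻¹ e e'` -/
def braid (e : Matrix I2 Unit ℂ) (e' : Matrix Unit I2 ℂ) (c : ℂ) : Matrix I2 I2 ℂ :=
  c • (1 : Matrix I2 I2 ℂ) + c⁻¹ • (e * e')

section Braid

variable {e : Matrix I2 Unit ℂ} {e' : Matrix Unit I2 ℂ}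

/-- Every composite of cups and caps applied to `e ⊗ 1` either straightens by a zigzag or closes a
loop of value `e'e`, so only the two cups `e ⊗ 1` and `1 ⊗ e` survive. -/
theorem span_col12 (he : sqR e' * sqL e = 1) (x y : ℂ) :
    op12 (x • 1 + y • (e * e')) * op23 (x • 1 + y • (e * e')) * col12 e =
      (x ^ 2 + x * y * (e' * e) () () + y ^ 2) • col12 e + (x * y) • col23 e := by
  simp only [op12_add, op23_add, op12_smul, op23_smul, op12_one, op23_one, op12_col_row,
    op23_col_row, Matrix.add_mul, Matrix.mul_add, Matrix.smul_mul, Matrix.mul_smul,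
    Matrix.one_mul, Matrix.mul_one, Matrix.mul_assoc, row23_mul_col12 he, row12_mul_col12,
    row12_mul_col23 he, smul_smul]
  module

theorem span_col23 (he : sqR e' * sqL e = 1) (x y : ℂ) :
    op23 (x • 1 + y • (e * e')) * op12 (x • 1 + y • (e * e')) * col23 e =
      (x ^ 2 + x * y * (e' * e) () () + y ^ 2) • col23 e + (x * y) • col12 e := by
  simp only [op12_add, op23_add, op12_smul, op23_smul, op12_one, op23_one, op12_col_row,
    op23_col_row, Matrix.add_mul, Matrix.mul_add, Matrix.smul_mul, Matrix.mul_smul,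
    Matrix.one_mul, Matrix.mul_one, Matrix.mul_assoc, row23_mul_col12 he, row23_mul_col23,
    row12_mul_col23 he, smul_smul]
  module

theorem braid_coeff {c D : ℂ} (hc : c ≠ 0) (hD : c ^ 2 + (c ^ 2)⁻¹ = -D) :
    c ^ 2 + c * c⁻¹ * D + c⁻¹ ^ 2 = 0 := by
  rw [mul_inv_cancel₀ hc, inv_pow]; linear_combination hD

theorem braid_col12 (he : sqR e' * sqL e = 1) {c : ℂ} (hc : c ≠ 0)
    (hD : c ^ 2 + (c ^ 2)⁻¹ = -(e' * e) () ()) :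
    op12 (braid e e' c) * op23 (braid e e' c) * col12 e = col23 e := by
  rw [braid, span_col12 he, braid_coeff hc hD, mul_inv_cancel₀ hc, zero_smul, one_smul, zero_add]

theorem braid_col23 (he : sqR e' * sqL e = 1) {c : ℂ} (hc : c ≠ 0)
    (hD : c ^ 2 + (c ^ 2)⁻¹ = -(e' * e) () ()) :
    op23 (braid e e' c) * op12 (braid e e' c) * col23 e = col12 e := by
  rw [braid, span_col23 he, braid_coeff hc hD, mul_inv_cancel₀ hc, zero_smul, one_smul, zero_add]

theorem exists_ne_zero_of_form (he : sqR e' * sqL e = 1) : ∃ i j, e (i, j) () ≠ 0 := by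
  by_contra! h
  have : sqL e = 0 := by ext i j; exact h i j
  rw [this, Matrix.mul_zero] at he
  exact zero_ne_one he

theorem col_independent (he : sqR e' * sqL e = 1) {x y : ℂ}
    (h : x • col12 e + y • col23 e = 0) : x = 0 ∧ y = 0 := by
  obtain ⟨i, j, hij⟩ := exists_ne_zero_of_form he
  -- At a nonzero entry `e_{ij}`, a free index different from `i` kills `1 ⊗ e`, and one different
  -- from `j` kills `e ⊗ 1`. Dimension at least two is needed for this.
  obtain ⟨m, hm⟩ : ∃ m : Fin 2, m ≠ i := exists_ne i
  obtain ⟨n, hn⟩ : ∃ n : Fin 2, n ≠ j := exists_ne j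
  have h1 := congrFun (congrFun h (i, j, m)) m
  have h2 := congrFun (congrFun h (n, i, j)) n
  simp [col12, col23, hij, hm.symm] at h1
  simp [col12, col23, hij, hn.symm] at h2
  exact ⟨h1, h2⟩

/-- The endomorphisms in the span of `1` and `e e'` compatible with the invariance of `e` are
`c + c⁻¹ e e'` with `c² + c⁻² = -e' e`. -/
theorem exists_braid_of_col12 (he : sqR e' * sqL e = 1) {x y : ℂ}
    (h : op12 (x • 1 + y • (e * e')) * op23 (x • 1 + y • (e * e')) * col12 e = col23 e) :
    x ≠ 0 ∧ y = x⁻¹ ∧ x ^ 2 + (x ^ 2)⁻¹ = -(e' * e) () () := by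
  rw [span_col12 he] at h
  obtain ⟨h1, h2⟩ := col_independent he (x := x ^ 2 + x * y * (e' * e) () () + y ^ 2)
    (y := x * y - 1) (by rw [sub_smul, one_smul, ← add_sub_assoc, h, sub_self])
  have hxy : x * y = 1 := by linear_combination h2
  have hx : x ≠ 0 := left_ne_zero_of_mul_eq_one hxy
  have hy : y = x⁻¹ := eq_inv_of_mul_eq_one_right hxy
  refine ⟨hx, hy, ?_⟩
  rw [hxy, hy] at h1
  rw [← inv_pow]; linear_combination h1

/-- Since `(ee')² = (e'e) ee'`, the coefficient of `ee'` in the product is `c² + c⁻² + e'e`, which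
vanishes. -/
theorem braid_mul_braid_inv {c : ℂ} (hc : c ≠ 0)
    (hD : c ^ 2 + (c ^ 2)⁻¹ = -(e' * e) () ()) : braid e e' c * braid e e' c⁻¹ = 1 := by
  have h : e * e' * (e * e') = (e' * e) () () • (e * e') := by
    rw [Matrix.mul_assoc, ← Matrix.mul_assoc e' e e']
    ext p r; simp [Matrix.mul_apply]; ring
  have h2 : (e' * e) () () = -(c * c + c⁻¹ * c⁻¹) := by
    rw [← neg_eq_iff_eq_neg, ← hD, ← inv_pow]; ring
  have h3 : c⁻¹ * c = 1 := inv_mul_cancel₀ hc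
  simp only [braid, Matrix.add_mul, Matrix.mul_add, Matrix.smul_mul, Matrix.mul_smul,
    Matrix.one_mul, Matrix.mul_one, h, smul_smul, inv_inv]
  rw [h2]
  ext p r
  simp only [Matrix.add_apply, Matrix.smul_apply, smul_eq_mul]
  linear_combination ((1 : Matrix I2 I2 ℂ) p r - (c * c + c⁻¹ * c⁻¹) * (e * e') p r) * h3

/-- Applied on legs 2 and 3 to `e ⊗ 1`, the endomorphisms `1` and `ee'` give the two independent
cups. -/
theorem smul_one_add_inj (he : sqR e' * sqL e = 1) {a b a' b' : ℂ}
    (h : a • (1 : Matrix I2 I2 ℂ) + b • (e * e') = a' • 1 + b' • (e * e')) : a = a' ∧ b = b' := by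
  have h1 : (a - a') • col12 e + (b - b') • col23 e = 0 := by
    have := congrArg (fun M => op23 M * col12 e) h
    simp only [op23_add, op23_smul, op23_one, op23_col_row, Matrix.add_mul, Matrix.smul_mul,
      Matrix.one_mul, Matrix.mul_assoc, row23_mul_col12 he, Matrix.mul_one] at this
    rw [sub_smul, sub_smul, sub_add_sub_comm, this, sub_self]
  have := col_independent he h1
  exact ⟨sub_eq_zero.mp this.1, sub_eq_zero.mp this.2⟩

end Braid

/-! ### Consequences of the axioms for `X` -/

variable (G : Data)

theorem X_col12 : op12 G.X * op23 G.X * col12 G.E = col23 G.E := by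
  ext ⟨i, j, l⟩ k
  have := G.X_E i j l k
  simp only [col23]
  rw [← this]
  simp only [Matrix.mul_apply, op12, op23, col12, Fintype.sum_prod_type, Fin.sum_univ_two]
  fin_cases l <;> fin_cases k <;> simp <;> ring

theorem conj_X (i j k l : Fin 2) :
    starRingEnd ℂ (G.X (i, j) (k, l)) = G.β⁻¹ * G.X (j, i) (l, k) := by
  have := congrFun (congrFun G.tauConj_X (j, i)) (l, k)
  simpa [tauConj] using this

/-- Conjugating the axiom for `X` and reversing the order of the legs replaces `E` by `Ẽ`. Each of
the two factors `X̄` costs a `β⁻¹`, whence `β²`. -/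
theorem X_col23 : op23 G.X * op12 G.X * col23 G.Et = G.β ^ 2 • col12 G.Et := by
  ext ⟨l, j, i⟩ k
  have := congrArg (starRingEnd ℂ) (G.X_E i j l k)
  simp only [map_sum, map_mul, conj_X] at this
  have h2 : (G.β ^ 2 • col12 G.Et) (l, j, i) k =
      G.β ^ 2 * starRingEnd ℂ (if i = k then G.E (j, l) () else 0) := by
    simp only [col12, Data.Et, Matrix.smul_apply, smul_eq_mul]
    split_ifs <;> simp
  rw [h2, ← this]
  have hb : ∀ x y z, G.β ^ 2 * (G.β⁻¹ * x * (G.β⁻¹ * y) * z) = x * y * z := by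
    intro x y z
    have := G.β_ne
    field_simp
  simp only [Finset.mul_sum, hb]
  simp only [Matrix.mul_apply, op12, op23, col23, Fintype.sum_prod_type, Fin.sum_univ_two,
    Data.Et]
  fin_cases l <;> fin_cases k <;> simp <;> ring

theorem X_mul_inv : G.X * G.X⁻¹ = 1 :=
  Matrix.mul_nonsing_inv _ ((Matrix.isUnit_iff_isUnit_det _).mp G.isUnit_X)

theorem inv_mul_X : G.X⁻¹ * G.X = 1 :=
  Matrix.nonsing_inv_mul _ ((Matrix.isUnit_iff_isUnit_det _).mp G.isUnit_X)

theorem op12_X_mul_inv : op12 G.X * op12 G.X⁻¹ = 1 := by rw [← op12_mul, X_mul_inv, op12_one]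
theorem op12_inv_mul_X : op12 G.X⁻¹ * op12 G.X = 1 := by rw [← op12_mul, inv_mul_X, op12_one]
theorem op23_X_mul_inv : op23 G.X * op23 G.X⁻¹ = 1 := by rw [← op23_mul, X_mul_inv, op23_one]
theorem op23_inv_mul_X : op23 G.X⁻¹ * op23 G.X = 1 := by rw [← op23_mul, inv_mul_X, op23_one]

theorem inv_op12_op23 : op23 G.X⁻¹ * op12 G.X⁻¹ * (op12 G.X * op23 G.X) = 1 := by
  rw [Matrix.mul_assoc, ← Matrix.mul_assoc (op12 _) (op12 _), op12_inv_mul_X, Matrix.one_mul,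
    op23_inv_mul_X]

theorem inv_op23_op12 : op12 G.X⁻¹ * op23 G.X⁻¹ * (op23 G.X * op12 G.X) = 1 := by
  rw [Matrix.mul_assoc, ← Matrix.mul_assoc (op23 _) (op23 _), op23_inv_mul_X, Matrix.one_mul,
    op12_inv_mul_X]

theorem X_inv_col23 : op23 G.X⁻¹ * op12 G.X⁻¹ * col23 G.E = col12 G.E := by
  rw [← X_col12, ← Matrix.mul_assoc, inv_op12_op23, Matrix.one_mul]

theorem X_inv_col12 : op12 G.X⁻¹ * op23 G.X⁻¹ * col12 G.Et = (G.β ^ 2)⁻¹ • col23 G.Et := by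
  have h := congrArg (fun M => op12 G.X⁻¹ * op23 G.X⁻¹ * M) (X_col23 G)
  simp only [← Matrix.mul_assoc _ _ (col23 G.Et), inv_op23_op12, Matrix.one_mul,
    Matrix.mul_smul] at h
  rw [h, smul_smul, inv_mul_cancel₀ (pow_ne_zero 2 G.β_ne), one_smul]

theorem smul_op12_op23 (c : ℂ) (M : Matrix I2 I2 ℂ) :
    op12 (c • M) * op23 (c • M) = c ^ 2 • (op12 M * op23 M) := by
  rw [op12_smul, op23_smul, Matrix.smul_mul, Matrix.mul_smul, smul_smul, sq]

theorem smul_op23_op12 (c : ℂ) (M : Matrix I2 I2 ℂ) :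
    op23 (c • M) * op12 (c • M) = c ^ 2 • (op23 M * op12 M) := by
  rw [op12_smul, op23_smul, Matrix.smul_mul, Matrix.mul_smul, smul_smul, sq]

theorem X_row23 : row23 G.E' * (op12 G.X * op23 G.X) = row12 G.E' :=
  row23_of_col (sqR_mul_sqL G) (X_col12 G)

theorem X_row12 : row12 G.Et' * (op23 G.X * op12 G.X) = G.β ^ 2 • row23 G.Et' := by
  have hb := G.β_ne
  -- The rescaled matrix `β⁻¹X` preserves `Ẽ` exactly, so the passage from cups to caps applies to
  -- it.
  have h := row12_of_col (sqR_mul_sqL_t G) (M := G.β⁻¹ • G.X) (by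
    rw [smul_op23_op12, Matrix.smul_mul, X_col23, smul_smul, inv_pow,
      inv_mul_cancel₀ (pow_ne_zero 2 hb), one_smul])
  rw [smul_op23_op12, Matrix.mul_smul, inv_pow] at h
  rw [← h, smul_smul, mul_inv_cancel₀ (pow_ne_zero 2 hb), one_smul]

/-- The braid relation between `X` and an endomorphism of the span of `1` and `E E'`. -/
theorem X_braid (x y : ℂ) :
    op12 G.X * op23 G.X * op12 (x • 1 + y • (G.E * G.E')) =
      op23 (x • 1 + y • (G.E * G.E')) * (op12 G.X * op23 G.X) := by
  simp only [op12_add, op23_add, op12_smul, op23_smul, op12_one, op23_one, op12_col_row,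
    op23_col_row, Matrix.mul_add, Matrix.add_mul, Matrix.smul_mul, Matrix.mul_smul,
    Matrix.one_mul, Matrix.mul_one]
  rw [← Matrix.mul_assoc _ (col12 _), X_col12, Matrix.mul_assoc (col23 _), X_row23]

/-- The braid relation between `X` and an endomorphism of the span of `1` and `Ẽ Ẽ'`. -/
theorem X_braid_t (x y : ℂ) :
    op23 G.X * op12 G.X * op23 (x • 1 + y • (G.Et * G.Et')) =
      op12 (x • 1 + y • (G.Et * G.Et')) * (op23 G.X * op12 G.X) := by
  simp only [op12_add, op23_add, op12_smul, op23_smul, op12_one, op23_one, op12_col_row,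
    op23_col_row, Matrix.mul_add, Matrix.add_mul, Matrix.smul_mul, Matrix.mul_smul,
    Matrix.one_mul, Matrix.mul_one]
  -- The cup on one side and the cap on the other produce the same factor `β²`, so this relation
  -- holds for every `β`.
  rw [← Matrix.mul_assoc _ (col23 _), X_col23, Matrix.mul_assoc (col12 _), X_row12,
    Matrix.smul_mul, Matrix.mul_smul]

/-! ### Representations of `𝒜` in `M₂(ℂ)` -/

/-- A sufficient condition for two matrices over `M₂(ℂ)` to satisfy the defining relations. -/
theorem Sat.of_col {W W' : Matrix (Fin 2) (Fin 2) M2} (hE : (W ⊗ₖ W) * cst M2 G.E = cst M2 G.E)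
    (hEt : (W' ⊗ₖ W') * cst M2 G.Et = cst M2 G.Et)
    (hX : cst M2 G.X * (W ⊗ₖ W') = (W' ⊗ₖ W) * cst M2 G.X) : Sat G W W' :=
  ⟨hE, hEt, row_of_col (sqR_mul_sqL G) hE, row_of_col (sqR_mul_sqL_t G) hEt, hX⟩

theorem et_mul_et : (G.Et' * G.Et) () () = starRingEnd ℂ ((G.E' * G.E) () ()) := by
  simp [Matrix.mul_apply, Data.Et, Data.Et', Fintype.sum_prod_type]
  ring

theorem L_eq_braid (c : ℂ) : G.L c = braid G.E G.E' c := by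
  rw [Data.L, braid, smul_add, smul_smul]
  congr 2
  -- With the convention `0⁻¹ = 0` the identity also holds at `c = 0`, so no hypothesis on `c` is
  -- needed.
  rcases eq_or_ne c 0 with rfl | hc
  · simp
  · field_simp

theorem tauConj_one : tauConj 1 = 1 := by
  ext ⟨i, j⟩ ⟨k, l⟩
  simp only [tauConj, Matrix.submatrix_apply, Matrix.map_apply, Matrix.one_apply, Prod.swap,
    Prod.mk.injEq]
  split_ifs <;> simp_all

theorem tauConj_mul (M N : Matrix I2 I2 ℂ) : tauConj (M * N) = tauConj M * tauConj N := by
  simp only [tauConj]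
  rw [submatrix_mul_swap, Matrix.map_mul]

theorem tauConj_smul (c : ℂ) (M : Matrix I2 I2 ℂ) :
    tauConj (c • M) = starRingEnd ℂ c • tauConj M := by
  ext p r; simp [tauConj]

theorem tauConj_add (M N : Matrix I2 I2 ℂ) : tauConj (M + N) = tauConj M + tauConj N := by
  ext p r; simp [tauConj]

theorem tauConj_tauConj (M : Matrix I2 I2 ℂ) : tauConj (tauConj M) = M := by
  ext p r; simp [tauConj]

theorem tauConj_col_row : tauConj (G.E * G.E') = G.Et * G.Et' := by
  ext p r; simp [tauConj, Data.Et, Data.Et', Matrix.mul_apply]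

theorem tauConj_braid (c : ℂ) :
    tauConj (braid G.E G.E' c) = braid G.Et G.Et' (starRingEnd ℂ c) := by
  rw [braid, tauConj_add, tauConj_smul, tauConj_smul, tauConj_one, tauConj_col_row, braid, map_inv₀]

variable {G} in
theorem L_inv {c : ℂ} (hc : c ≠ 0) (hD : c ^ 2 + (c ^ 2)⁻¹ = -(G.E' * G.E) () ()) :
    (G.L c)⁻¹ = G.L c⁻¹ := by
  apply Matrix.inv_eq_right_inv
  rw [L_eq_braid, L_eq_braid, braid_mul_braid_inv hc hD]

/-- The data of a bicharacter on the generators. -/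
structure Params where
  c : ℂ
  d : ℂ
  s : ℂ
  s' : ℂ

/-- The matrix `R^{v_a v_b}`, where `v_false = w` and `v_true = w̃`. -/
def Params.mat (P : Params) : Bool → Bool → Matrix I2 I2 ℂ
  | false, false => braid G.E G.E' P.c
  | false, true => P.s • G.X
  | true, false => P.s' • G.X⁻¹
  | true, true => braid G.Et G.Et' P.d

/-- The conditions for the existence of a bicharacter. -/
structure Params.Good (P : Params) : Prop where
  c_ne : P.c ≠ 0
  d_ne : P.d ≠ 0
  hc : P.c ^ 2 + (P.c ^ 2)⁻¹ = -(G.E' * G.E) () ()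
  hd : P.d ^ 2 + (P.d ^ 2)⁻¹ = -(G.Et' * G.Et) () ()
  hs : P.s ^ 2 = 1
  hs' : P.s' ^ 2 = 1
  hβ : G.β ^ 2 = 1

variable {G}

/-- The cup relations use `c² + c⁻² = -E'E`, its analogue for `d`, the signs and `β² = 1`. The
crossing relations are the braid relations between `X` and the span of `1` and `EE'` or `ẼẼ'`. -/
theorem Params.Good.satL {P : Params} (h : P.Good G) (b : Bool) :
    Sat G (blkL (P.mat G false b)) (blkL (P.mat G true b)) := by
  cases b
  · refine Sat.of_col G (blkL_col_iff.mpr (braid_col12 (sqR_mul_sqL G) h.c_ne h.hc))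
      (blkL_col_iff.mpr ?_) (blkL_X_iff.mpr ?_)
    · simp only [Params.mat]
      rw [smul_op12_op23, h.hs', one_smul, X_inv_col12, h.hβ, inv_one, one_smul]
    · simp only [Params.mat, op12_smul, op23_smul, Matrix.mul_smul, Matrix.smul_mul]
      congr 1
      -- For `X⁻¹` the braid relation is multiplied by inverses of `X` on both sides.
      have := congrArg (fun M => op12 G.X⁻¹ * M * op23 G.X⁻¹) (X_braid G P.c P.c⁻¹)
      simp only [← Matrix.mul_assoc, op12_inv_mul_X, Matrix.one_mul] at this
      rw [Matrix.mul_assoc _ (op23 G.X), op23_X_mul_inv, Matrix.mul_one] at this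
      rw [← Matrix.mul_assoc]; exact this
  · refine Sat.of_col G (blkL_col_iff.mpr ?_)
      (blkL_col_iff.mpr (braid_col12 (sqR_mul_sqL_t G) h.d_ne h.hd)) (blkL_X_iff.mpr ?_)
    · simp only [Params.mat]
      rw [smul_op12_op23, h.hs, one_smul, X_col12]
    · simp only [Params.mat, op12_smul, op23_smul, Matrix.mul_smul, Matrix.smul_mul]
      congr 1
      rw [← Matrix.mul_assoc, braid, X_braid_t, Matrix.mul_assoc]

theorem Params.Good.satR {P : Params} (h : P.Good G) (a : Bool) :
    Sat G (blkR (P.mat G a false)) (blkR (P.mat G a true)) := by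
  cases a
  · refine Sat.of_col G (blkR_col_iff.mpr (braid_col23 (sqR_mul_sqL G) h.c_ne h.hc))
      (blkR_col_iff.mpr ?_) (blkR_X_iff.mpr ?_)
    · simp only [Params.mat]
      rw [smul_op23_op12, h.hs, one_smul, X_col23, h.hβ, one_smul]
    · simp only [Params.mat, op12_smul, op23_smul, Matrix.mul_smul, Matrix.smul_mul]
      congr 1
      rw [← Matrix.mul_assoc, braid, X_braid, Matrix.mul_assoc]
  · refine Sat.of_col G (blkR_col_iff.mpr ?_)
      (blkR_col_iff.mpr (braid_col23 (sqR_mul_sqL_t G) h.d_ne h.hd)) (blkR_X_iff.mpr ?_)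
    · simp only [Params.mat]
      rw [smul_op23_op12, h.hs', one_smul, X_inv_col23]
    · simp only [Params.mat, op12_smul, op23_smul, Matrix.mul_smul, Matrix.smul_mul]
      congr 1
      have := congrArg (fun M => op23 G.X⁻¹ * M * op12 G.X⁻¹) (X_braid_t G P.d P.d⁻¹)
      simp only [← Matrix.mul_assoc, op23_inv_mul_X, Matrix.one_mul] at this
      rw [Matrix.mul_assoc _ (op12 G.X), op12_X_mul_inv, Matrix.mul_one] at this
      rw [← Matrix.mul_assoc]; exact this

end

section

/-! ### The convolution algebra of functionals -/

variable (G : Data)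

/-- `V false = w` and `V true = w̃`. -/
def V : Bool → Matrix (Fin 2) (Fin 2) (Poly G)
  | false => w G
  | true => wt G

@[simp] theorem V_false : V G false = w G := rfl
@[simp] theorem V_true : V G true = wt G := rfl

theorem comul_V (b : Bool) (i j : Fin 2) :
    Coalgebra.comul (R := ℂ) (V G b i j) = ∑ k, V G b i k ⊗ₜ[ℂ] V G b k j := by
  cases b
  · exact comul_w G i j
  · exact comul_wt G i j

theorem counit_V (b : Bool) (i j : Fin 2) :
    Coalgebra.counit (R := ℂ) (V G b i j) = (1 : M2) i j := by
  cases b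
  · exact counit_w G i j
  · exact counit_wt G i j

variable {G} in
theorem induction_V {P : Poly G → Prop} (h_one : P 1) (h_V : ∀ b i j, P (V G b i j))
    (h_smul : ∀ (c : ℂ) x, P x → P (c • x))
    (h_add : ∀ x y, P x → P y → P (x + y)) (h_mul : ∀ x y, P x → P y → P (x * y))
    (x : Poly G) : P x := by
  induction x using induction with
  | h_alg c => rw [Algebra.algebraMap_eq_smul_one]; exact h_smul _ _ h_one
  | h_w i j => exact h_V false i j
  | h_wt i j => exact h_V true i j
  | h_add x y hx hy => exact h_add x y hx hy
  | h_mul x y hx hy => exact h_mul x y hx hy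

variable {G} in
theorem hom_ext_V {B : Type*} [Ring B] [Algebra ℂ B] {f g : Poly G →ₐ[ℂ] B}
    (h : ∀ b i j, f (V G b i j) = g (V G b i j)) : f = g :=
  hom_ext (h false) (h true)

/-- The convolution algebra of linear functionals on `𝒜`. -/
abbrev Fn : Type := WithConv (Poly G →ₗ[ℂ] ℂ)

variable {G}

/-- The matrix of functionals of a matrix representation of `𝒜`. -/
def fe {n : Type*} [Fintype n] [DecidableEq n] (F : Poly G →ₐ[ℂ] Matrix n n ℂ) :
    Matrix n n (Fn G) :=
  fun i j => WithConv.toConv (Matrix.entryLinearMap ℂ ℂ i j ∘ₗ F.toLinearMap)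

section

variable {m n : Type*} [Fintype n] [DecidableEq n] [Fintype m] [DecidableEq m]

@[simp] theorem fe_apply (F : Poly G →ₐ[ℂ] Matrix n n ℂ) (i j : n) (x : Poly G) :
    (fe F i j).ofConv x = F x i j := rfl

/-- The convolution product of matrix representations. -/
def kconv (F : Poly G →ₐ[ℂ] Matrix m m ℂ) (F' : Poly G →ₐ[ℂ] Matrix n n ℂ) :
    Poly G →ₐ[ℂ] Matrix (m × n) (m × n) ℂ :=
  (Matrix.kroneckerAlgEquiv m n ℂ).toAlgHom.comp
    ((Algebra.TensorProduct.map F F').comp (Bialgebra.comulAlgHom ℂ (Poly G)))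

theorem kconv_V (F : Poly G →ₐ[ℂ] Matrix m m ℂ) (F' : Poly G →ₐ[ℂ] Matrix n n ℂ)
    (b : Bool) (i j : Fin 2) :
    kconv F F' (V G b i j) = ∑ k, F (V G b i k) ⊗ₖ F' (V G b k j) := by
  simp [kconv, comul_V]

/-- Tensor products of representations become Kronecker products over the convolution algebra, so
relations between functionals can be tested as intertwining relations. -/
theorem fe_kconv (F : Poly G →ₐ[ℂ] Matrix m m ℂ) (F' : Poly G →ₐ[ℂ] Matrix n n ℂ) :
    fe (kconv F F') = fe F ⊗ₖ fe F' := by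
  ext ⟨i, j⟩ ⟨k, l⟩ x
  rw [fe_apply, Matrix.kroneckerMap_apply]
  change Matrix.kroneckerAlgEquiv m n ℂ (Algebra.TensorProduct.map F F'
    (Coalgebra.comul (R := ℂ) x)) (i, j) (k, l) =
    LinearMap.mul' ℂ ℂ (TensorProduct.map (fe F i k).ofConv (fe F' j l).ofConv
      (Coalgebra.comul (R := ℂ) x))
  induction Coalgebra.comul (R := ℂ) x using TensorProduct.induction_on with
  | zero => simp
  | tmul a b => simp
  | add a b ha hb => simp only [map_add, Matrix.add_apply, ha, hb]

/-- The convolution product of matrix representations, in the reversed order. -/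
def sconv (F : Poly G →ₐ[ℂ] Matrix m m ℂ) (F' : Poly G →ₐ[ℂ] Matrix n n ℂ) :
    Poly G →ₐ[ℂ] Matrix (m × n) (m × n) ℂ :=
  (Matrix.reindexAlgEquiv ℂ ℂ (Equiv.prodComm n m)).toAlgHom.comp (kconv F' F)

theorem sconv_V (F : Poly G →ₐ[ℂ] Matrix m m ℂ) (F' : Poly G →ₐ[ℂ] Matrix n n ℂ)
    (b : Bool) (i j : Fin 2) (p r : m × n) :
    sconv F F' (V G b i j) p r = ∑ k, F' (V G b i k) p.2 r.2 * F (V G b k j) p.1 r.1 := by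
  simp [sconv, kconv_V]

theorem fe_sconv (F F' : Poly G →ₐ[ℂ] M2) : fe (sconv F F') = opKron (fe F) (fe F') := by
  ext1 p r
  change fe (kconv F' F) p.swap r.swap = _
  rw [fe_kconv]
  rfl

/-- The counit, as a representation by `1 × 1` matrices. -/
def counitRep : Poly G →ₐ[ℂ] Matrix Unit Unit ℂ :=
  (Algebra.ofId ℂ (Matrix Unit Unit ℂ)).comp (Bialgebra.counitAlgHom ℂ (Poly G))

theorem counitRep_V (b : Bool) (i j : Fin 2) :
    counitRep (V G b i j) = (1 : M2) i j • (1 : Matrix Unit Unit ℂ) := by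
  rw [counitRep, AlgHom.comp_apply, Bialgebra.counitAlgHom_apply, counit_V, Algebra.ofId_apply,
    Algebra.algebraMap_eq_smul_one]

theorem fe_counitRep : fe (counitRep : Poly G →ₐ[ℂ] _) = 1 := by
  ext i j x
  simp [counitRep, Algebra.ofId_apply, Algebra.algebraMap_eq_smul_one]

/-- Intertwining is inherited by sums and products, so generators suffice; the result is then read
off coefficientwise as an identity over the convolution algebra. -/
theorem intertwine {F : Poly G →ₐ[ℂ] Matrix n n ℂ} {F' : Poly G →ₐ[ℂ] Matrix m m ℂ}
    {N : Matrix m n ℂ} (h : ∀ b i j, N * F (V G b i j) = F' (V G b i j) * N) :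
    cst (Fn G) N * fe F = fe F' * cst (Fn G) N := by
  have key : ∀ x, N * F x = F' x * N := by
    intro x
    induction x using induction_V with
    | h_one => simp
    | h_V b i j => exact h b i j
    | h_smul c x hx => simp [hx]
    | h_add x y hx hy => simp [Matrix.mul_add, Matrix.add_mul, hx, hy]
    | h_mul x y hx hy => rw [map_mul, map_mul, ← Matrix.mul_assoc, hx, Matrix.mul_assoc, hy,
        Matrix.mul_assoc]
  ext p r x
  have := congrFun (congrFun (key x) p) r
  simp only [Matrix.mul_apply] at this
  simp only [Matrix.mul_apply, cst, Matrix.map_apply, WithConv.ofConv_sum, LinearMap.sum_apply,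
    Algebra.algebraMap_eq_smul_one, smul_mul_assoc, one_mul, mul_smul_comm, mul_one,
    WithConv.ofConv_smul, LinearMap.smul_apply, fe_apply, smul_eq_mul]
  rw [this]
  exact Finset.sum_congr rfl fun _ _ => mul_comm _ _

end

theorem mul_cst_apply {m n k : Type*} [Fintype n] (K : Matrix m n M2) (N : Matrix n k ℂ) (p : m)
    (r : k) (i j : Fin 2) : (K * cst M2 N) p r i j = ∑ q, K p q i j * N q r := by
  rw [Matrix.mul_apply, Matrix.sum_apply]
  refine Finset.sum_congr rfl fun q _ => ?_
  rw [cst_matrix_apply, Matrix.mul_smul, Matrix.mul_one, Matrix.smul_apply, smul_eq_mul, mul_comm]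

theorem cst_mul_apply {m n k : Type*} [Fintype n] (N : Matrix m n ℂ) (K : Matrix n k M2) (p : m)
    (r : k) (i j : Fin 2) : (cst M2 N * K) p r i j = ∑ q, N p q * K q r i j := by
  rw [Matrix.mul_apply, Matrix.sum_apply]
  refine Finset.sum_congr rfl fun q _ => ?_
  rw [cst_matrix_apply, Matrix.smul_mul, Matrix.one_mul, Matrix.smul_apply, smul_eq_mul]

/-! ### Bicharacters -/

/-- A bicharacter: a functional satisfying all axioms of a coquasitriangular structure except the
commutation relation. -/
structure IsBichar (R : Poly G ⊗[ℂ] Poly G →ₗ[ℂ] ℂ) : Prop where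
  one_left : ∀ x : Poly G, R (1 ⊗ₜ x) = Coalgebra.counit x
  one_right : ∀ x : Poly G, R (x ⊗ₜ 1) = Coalgebra.counit x
  mul_left : ∀ x y z : Poly G, R ((x * y) ⊗ₜ z) =
    conv (R ∘ₗ TensorProduct.mk ℂ _ _ x) (R ∘ₗ TensorProduct.mk ℂ _ _ y) z
  mul_right : ∀ x y z : Poly G, R (x ⊗ₜ (y * z)) =
    conv (R ∘ₗ (TensorProduct.mk ℂ _ _).flip z) (R ∘ₗ (TensorProduct.mk ℂ _ _).flip y) x

theorem IsCQT.isBichar {R : Poly G ⊗[ℂ] Poly G →ₗ[ℂ] ℂ} (h : IsCQT R) : IsBichar R :=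
  ⟨h.one_left, h.one_right, h.mul_left, h.mul_right⟩

theorem conv_V (f g : Poly G →ₗ[ℂ] ℂ) (b : Bool) (i j : Fin 2) :
    conv f g (V G b i j) = ∑ k, f (V G b i k) * g (V G b k j) := by
  simp [conv, comul_V]

namespace IsBichar

variable {R : Poly G ⊗[ℂ] Poly G →ₗ[ℂ] ℂ}

theorem mul_left_V (hR : IsBichar R) (x y : Poly G) (b : Bool) (i j : Fin 2) :
    R ((x * y) ⊗ₜ V G b i j) = ∑ k, R (x ⊗ₜ V G b i k) * R (y ⊗ₜ V G b k j) := by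
  rw [hR.mul_left, conv_V]; rfl

theorem mul_right_V (hR : IsBichar R) (y z : Poly G) (b : Bool) (i j : Fin 2) :
    R (V G b i j ⊗ₜ (y * z)) = ∑ k, R (V G b i k ⊗ₜ z) * R (V G b k j ⊗ₜ y) := by
  rw [hR.mul_right, conv_V]; rfl

/-- The representation `x ↦ (R(x ⊗ v_{ij}))_{ij}`. -/
def repL (hR : IsBichar R) (b : Bool) : Poly G →ₐ[ℂ] M2 :=
  AlgHom.ofLinearMap
    { toFun := fun x => Matrix.of fun i j => R (x ⊗ₜ V G b i j)
      map_add' := fun x y => by ext i j; simp [TensorProduct.add_tmul]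
      map_smul' := fun c x => by ext i j; simp [← TensorProduct.smul_tmul'] }
    (by ext i j; exact (hR.one_left _).trans (counit_V G b i j))
    (fun x y => by
      ext i j
      refine (hR.mul_left_V x y b i j).trans ?_
      rw [Matrix.mul_apply]
      rfl)

@[simp] theorem repL_apply (hR : IsBichar R) (b : Bool) (x : Poly G) (i j : Fin 2) :
    hR.repL b x i j = R (x ⊗ₜ V G b i j) := rfl

/-- The representation `y ↦ (R(v_{ij} ⊗ y))_{ji}`. -/
def repR (hR : IsBichar R) (a : Bool) : Poly G →ₐ[ℂ] M2 :=
  AlgHom.ofLinearMap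
    { toFun := fun y => Matrix.of fun j i => R (V G a i j ⊗ₜ y)
      map_add' := fun x y => by ext i j; simp [TensorProduct.tmul_add]
      map_smul' := fun c x => by ext i j; simp }
    (by
      ext i j
      refine (hR.one_right _).trans ((counit_V G a j i).trans ?_)
      simp [Matrix.one_apply, eq_comm])
    (fun x y => by
      ext i j
      refine (hR.mul_right_V x y a j i).trans ((Matrix.mul_apply ..).trans ?_).symm
      exact Finset.sum_congr rfl fun _ _ => mul_comm _ _)

@[simp] theorem repR_apply (hR : IsBichar R) (a : Bool) (y : Poly G) (i j : Fin 2) :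
    hR.repR a y j i = R (V G a i j ⊗ₜ y) := rfl

theorem map_repR (hR : IsBichar R) (a b : Bool) :
    (V G b).map (hR.repR a) = blkR (Rmat R (V G a) (V G b)) := rfl

/-- The defining relations pushed through the representation `repL`: this is how multiplicativity
constrains the matrices `R^{vv'}`. -/
theorem satL (hR : IsBichar R) (b : Bool) :
    Sat G (blkL (Rmat R (V G false) (V G b))) (blkL (Rmat R (V G true) (V G b))) :=
  (sat_w G).map G (hR.repL b)

theorem satR (hR : IsBichar R) (a : Bool) :
    Sat G (blkR (Rmat R (V G a) (V G false))) (blkR (Rmat R (V G a) (V G true))) :=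
  (sat_w G).map G (hR.repR a)

/-- `x ↦ R(x ⊗ ·)`, as a homomorphism to the convolution algebra. -/
def homL (hR : IsBichar R) : Poly G →ₐ[ℂ] Fn G :=
  AlgHom.ofLinearMap
    { toFun := fun x => WithConv.toConv (R ∘ₗ TensorProduct.mk ℂ _ _ x)
      map_add' := fun x y => by ext z; simp
      map_smul' := fun c x => by ext z; simp }
    (by ext z; simp [hR.one_left])
    (fun x y => by ext z; exact hR.mul_left x y z)

@[simp] theorem homL_apply (hR : IsBichar R) (x y : Poly G) :
    (hR.homL x).ofConv y = R (x ⊗ₜ y) := rfl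

/-- `y ↦ R(· ⊗ y)`, as a homomorphism to the opposite of the convolution algebra. -/
def homR (hR : IsBichar R) : Poly G →ₐ[ℂ] (Fn G)ᵐᵒᵖ :=
  AlgHom.ofLinearMap
    { toFun := fun y => MulOpposite.op
        (WithConv.toConv (R ∘ₗ (TensorProduct.mk ℂ (Poly G) (Poly G)).flip y))
      map_add' := fun x y => by
        rw [← MulOpposite.op_add]; congr 1; ext z; simp
      map_smul' := fun c x => by
        rw [RingHom.id_apply, ← MulOpposite.op_smul]; congr 1; ext z; simp }
    (by
      apply MulOpposite.unop_injective
      ext z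
      simp [hR.one_right])
    (fun x y => by
      change MulOpposite.op _ = MulOpposite.op (_ * _)
      congr 1; ext z; exact hR.mul_right z x y)

@[simp] theorem homR_apply (hR : IsBichar R) (x y : Poly G) :
    (hR.homR y).unop.ofConv x = R (x ⊗ₜ y) := rfl

/-- A bicharacter is determined by its values on the generators. -/
theorem ext_V {R' : Poly G ⊗[ℂ] Poly G →ₗ[ℂ] ℂ} (hR : IsBichar R) (hR' : IsBichar R')
    (h : ∀ a b, Rmat R (V G a) (V G b) = Rmat R' (V G a) (V G b)) : R = R' := by
  -- With a generator on the left, the values on generators on the right determine a representation.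
  -- This then fixes `homL` on generators, hence everywhere.
  have h1 : ∀ a, hR.repR a = hR'.repR a := by
    intro a
    apply hom_ext_V
    intro b i j
    change (V G b).map (hR.repR a) i j = (V G b).map (hR'.repR a) i j
    rw [map_repR, map_repR, h]
  have h2 : hR.homL = hR'.homL := by
    apply hom_ext_V
    intro a i j
    ext y
    exact congrFun (congrFun (DFunLike.congr_fun (h1 a) y) j) i
  ext x y
  exact congrArg (fun f => f.ofConv y) (DFunLike.congr_fun h2 x)

end IsBichar

/-! ### Construction of bicharacters -/

/-- Two pairs of representations of `𝒜` that agree on the generators. -/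
structure RepPair (G : Data) where
  f : Bool → (Poly G →ₐ[ℂ] M2)
  h : Bool → (Poly G →ₐ[ℂ] M2)
  compat : ∀ a b i j k l, f b (V G a j k) i l = h a (V G b i l) k j

namespace RepPair

variable (P : RepPair G)

/-- Compatibility exchanges the two families: a tensor product of the representations `f`, evaluated
on a generator, is a tensor product of values of a single representation `h a`. -/
theorem sconv_V (b b' a : Bool) (m n : Fin 2) (p r : Fin 2 × Fin 2) :
    sconv (P.f b) (P.f b') (V G a m n) p r =
      ((V G b).map (P.h a) ⊗ₖ (V G b').map (P.h a)) p r n m := by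
  simp [QLorentz.sconv_V, P.compat, Matrix.mul_apply, mul_comm]

/-- These relations are what makes `y ↦ R(· ⊗ y)` well defined. They are intertwining relations
between tensor products of the `f b`, hence need checking only on generators, where they are the
relations satisfied by the images of `w`, `w̃` under `h a`. -/
theorem sat : Sat G ((fe (P.f false)).map MulOpposite.op) ((fe (P.f true)).map MulOpposite.op) := by
  have hcol : ∀ b (e : Matrix (Fin 2 × Fin 2) Unit ℂ),
      (∀ a, ((V G b).map (P.h a) ⊗ₖ (V G b).map (P.h a)) * cst M2 e = cst M2 e) →
      opKron (fe (P.f b)) (fe (P.f b)) * cst (Fn G) e = cst (Fn G) e := by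
    intro b e he
    rw [← fe_sconv, ← intertwine (F := counitRep), fe_counitRep, Matrix.mul_one]
    intro a m n
    ext p u
    rw [counitRep_V, Matrix.mul_smul, Matrix.mul_one]
    have := congrFun (congrFun (congrFun (congrFun (he a) p) u) n) m
    rw [mul_cst_apply, cst_matrix_apply] at this
    simp only [Matrix.mul_apply, sconv_V]
    rw [this]
    simp [Matrix.one_apply, eq_comm]
  have hrow : ∀ b (e : Matrix Unit (Fin 2 × Fin 2) ℂ),
      (∀ a, cst M2 e * ((V G b).map (P.h a) ⊗ₖ (V G b).map (P.h a)) = cst M2 e) →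
      cst (Fn G) e * opKron (fe (P.f b)) (fe (P.f b)) = cst (Fn G) e := by
    intro b e he
    rw [← fe_sconv, intertwine (F' := counitRep), fe_counitRep, Matrix.one_mul]
    intro a m n
    ext u p
    rw [counitRep_V, Matrix.smul_mul, Matrix.one_mul]
    have := congrFun (congrFun (congrFun (congrFun (he a) u) p) n) m
    rw [cst_mul_apply, cst_matrix_apply] at this
    simp only [Matrix.mul_apply, sconv_V]
    rw [this]
    simp [Matrix.one_apply, eq_comm]
  have hs := fun a => (sat_w G).map G (P.h a)
  constructor <;> simp only [kron_op, map_op_mul_cst, cst_mul_map_op] <;> try rw [cst_op]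
  · rw [hcol false G.E fun a => (hs a).E]
  · rw [hcol true G.Et fun a => (hs a).Et]
  · rw [hrow false G.E' fun a => (hs a).E']
  · rw [hrow true G.Et' fun a => (hs a).Et']
  · rw [← fe_sconv, ← fe_sconv]
    congr 1
    apply intertwine
    intro a m n
    ext p r
    have := congrFun (congrFun (congrFun (congrFun (hs a).X p) r) n) m
    rw [mul_cst_apply, cst_mul_apply] at this
    simp only [Matrix.mul_apply, sconv_V]
    exact this

/-- `y ↦ R(· ⊗ y)` -/
def theta : Poly G →ₐ[ℂ] (Fn G)ᵐᵒᵖ := lift P.sat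

theorem theta_V (b : Bool) (i j : Fin 2) (x : Poly G) :
    (P.theta (V G b i j)).unop.ofConv x = P.f b x i j := by
  cases b
  · rw [V_false, theta, lift_w]; rfl
  · rw [V_true, theta, lift_wt]; rfl

/-- The bicharacter with given values on generators. -/
def bichar : Poly G ⊗[ℂ] Poly G →ₗ[ℂ] ℂ :=
  TensorProduct.lift (LinearMap.flip
    { toFun := fun y => (P.theta y).unop.ofConv
      map_add' := fun x y => by simp
      map_smul' := fun c y => by simp })

@[simp] theorem bichar_tmul (x y : Poly G) :
    P.bichar (x ⊗ₜ y) = (P.theta y).unop.ofConv x := rfl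

theorem bichar_mul_right (x y z : Poly G) : P.bichar (x ⊗ₜ (y * z)) =
    conv (P.bichar ∘ₗ (TensorProduct.mk ℂ _ _).flip z)
      (P.bichar ∘ₗ (TensorProduct.mk ℂ _ _).flip y) x := by
  rw [bichar_tmul, map_mul, MulOpposite.unop_mul]; rfl

theorem bichar_one_left (y : Poly G) : P.bichar (1 ⊗ₜ y) = Coalgebra.counit y := by
  induction y using induction_V with
  | h_one => simp
  | h_V b i j => rw [bichar_tmul, theta_V, map_one, counit_V]
  | h_smul c x hx => rw [TensorProduct.tmul_smul, map_smul, hx, map_smul]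
  | h_add x y hx hy => rw [TensorProduct.tmul_add, map_add, hx, hy, map_add]
  | h_mul x y hx hy =>
    rw [bichar_mul_right, Bialgebra.counit_mul, ← hx, ← hy, mul_comm]
    simp [conv, Algebra.TensorProduct.one_def]

/-- Only multiplicativity on the right is built into the construction. On the left it holds when `z`
is a generator, since `f b` is a homomorphism, and passes to products of `z` because `Δ` is
multiplicative and scalars commute. -/
theorem bichar_mul_left (x y z : Poly G) : P.bichar ((x * y) ⊗ₜ z) =
    conv (P.bichar ∘ₗ TensorProduct.mk ℂ _ _ x) (P.bichar ∘ₗ TensorProduct.mk ℂ _ _ y) z := by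
  induction z using induction_V generalizing x y with
  | h_one =>
    simp [conv, Algebra.TensorProduct.one_def]
  | h_V b i j =>
    rw [conv_V, bichar_tmul, theta_V, map_mul, Matrix.mul_apply]
    simp [theta_V]
  | h_smul c z hz => rw [TensorProduct.tmul_smul, map_smul, hz, map_smul]
  | h_add z z' hz hz' => rw [TensorProduct.tmul_add, map_add, hz, hz', map_add]
  | h_mul z z' hz hz' =>
    rw [bichar_mul_right]
    -- Writing `Δx` and `Δy` as finite sums of pure tensors turns the claim into a rearrangement of
    -- a double sum of products of four scalars.
    have hx := (Coalgebra.Repr.arbitrary ℂ x).eq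
    have hy := (Coalgebra.Repr.arbitrary ℂ y).eq
    generalize Coalgebra.Repr.arbitrary ℂ x = rx at hx
    generalize Coalgebra.Repr.arbitrary ℂ y = ry at hy
    simp only [conv, LinearMap.comp_apply, Bialgebra.comul_mul] at hz hz' ⊢
    rw [← hx, ← hy, Finset.sum_mul_sum]
    simp only [map_sum, Algebra.TensorProduct.tmul_mul_tmul, TensorProduct.map_tmul,
      LinearMap.mul'_apply, LinearMap.comp_apply, LinearMap.flip_apply, TensorProduct.mk_apply,
      hz, hz']
    generalize Coalgebra.comul (R := ℂ) z = t
    generalize Coalgebra.comul (R := ℂ) z' = t'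
    induction t using TensorProduct.induction_on with
    | zero => simp
    | add a b ha hb => simp only [map_add, mul_add, add_mul, Finset.sum_add_distrib, ha, hb]
    | tmul a b =>
      induction t' using TensorProduct.induction_on with
      | zero => simp
      | add a b ha hb => simp only [map_add, mul_add, add_mul, Finset.sum_add_distrib, ha, hb]
      | tmul c d =>
        simp only [Algebra.TensorProduct.tmul_mul_tmul, TensorProduct.map_tmul,
          LinearMap.mul'_apply, LinearMap.comp_apply, TensorProduct.mk_apply]
        rw [bichar_mul_right, bichar_mul_right]
        simp only [conv, LinearMap.comp_apply]
        rw [← hx, ← hy]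
        simp only [map_sum, TensorProduct.map_tmul, LinearMap.mul'_apply, LinearMap.comp_apply,
          LinearMap.flip_apply, TensorProduct.mk_apply]
        rw [Finset.sum_mul_sum]
        exact Finset.sum_congr rfl fun i _ => Finset.sum_congr rfl fun j _ => by ring

theorem isBichar : IsBichar P.bichar where
  one_left := P.bichar_one_left
  one_right x := by simp
  mul_left := P.bichar_mul_left
  mul_right := P.bichar_mul_right

theorem Rmat_bichar (a b : Bool) :
    Rmat P.bichar (V G a) (V G b) = fun p r => P.f b (V G a p.2 r.1) p.1 r.2 := by
  ext p r
  rw [Rmat, bichar_tmul, theta_V]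

end RepPair

/-- The pair of representations with the given values on generators. -/
def Params.Good.repPair {P : Params} (hP : P.Good G) : RepPair G where
  f b := lift (hP.satL b)
  h a := lift (hP.satR a)
  compat a b i j k l := by
    cases a <;> cases b <;> simp [blkL, blkR]

theorem Params.Good.exists_isBichar {P : Params} (hP : P.Good G) :
    ∃ R : Poly G ⊗[ℂ] Poly G →ₗ[ℂ] ℂ, IsBichar R ∧
      ∀ a b, Rmat R (V G a) (V G b) = P.mat G a b := by
  refine ⟨hP.repPair.bichar, hP.repPair.isBichar, fun a b => ?_⟩
  rw [RepPair.Rmat_bichar]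
  ext p r
  cases a <;> simp [repPair, blkL]

end

section

variable {G : Data}

/-! ### The commutation relation -/

/-- The algebra of linear endomorphisms of `𝒜`, with the convolution product. -/
abbrev ConvEnd (G : Data) : Type := WithConv (Poly G →ₗ[ℂ] Poly G)

theorem mul_counit_left (a : Poly G) (g : ConvEnd G) (z : Poly G) :
    (WithConv.toConv (LinearMap.toSpanSingleton ℂ (Poly G) a ∘ₗ Coalgebra.counit) * g).ofConv z =
      a * g.ofConv z := by
  have h : TensorProduct.map (LinearMap.toSpanSingleton ℂ (Poly G) a ∘ₗ
      Coalgebra.counit (R := ℂ) (A := Poly G)) g.ofConv =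
      TensorProduct.map (LinearMap.toSpanSingleton ℂ (Poly G) a) g.ofConv ∘ₗ
        LinearMap.rTensor (Poly G) (Coalgebra.counit (R := ℂ) (A := Poly G)) :=
      TensorProduct.ext' fun x y => by simp
  rw [LinearMap.convMul_apply, WithConv.ofConv_toConv, h, LinearMap.comp_apply,
    Coalgebra.rTensor_counit_comul]
  simp

theorem mul_counit_right (a : Poly G) (g : ConvEnd G) (z : Poly G) :
    (g * WithConv.toConv (LinearMap.toSpanSingleton ℂ (Poly G) a ∘ₗ Coalgebra.counit)).ofConv z =
      g.ofConv z * a := by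
  have h : TensorProduct.map g.ofConv (LinearMap.toSpanSingleton ℂ (Poly G) a ∘ₗ
      Coalgebra.counit (R := ℂ) (A := Poly G)) =
      TensorProduct.map g.ofConv (LinearMap.toSpanSingleton ℂ (Poly G) a) ∘ₗ
        LinearMap.lTensor (Poly G) (Coalgebra.counit (R := ℂ) (A := Poly G)) :=
      TensorProduct.ext' fun x y => by simp
  rw [LinearMap.convMul_apply, WithConv.ofConv_toConv, h, LinearMap.comp_apply,
    Coalgebra.lTensor_counit_comul]
  simp

/-- `a ↦ ε(·) a` -/
def constHom : Poly G →ₐ[ℂ] ConvEnd G :=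
  AlgHom.ofLinearMap
    { toFun := fun a => WithConv.toConv
        (LinearMap.toSpanSingleton ℂ (Poly G) a ∘ₗ Coalgebra.counit)
      map_add' := fun x y => by ext z; simp
      map_smul' := fun c x => by ext z; simp [smul_comm _ c] }
    (by ext z; simp [Algebra.algebraMap_eq_smul_one])
    (fun x y => by
      ext z
      refine Eq.trans ?_ (mul_counit_left _ _ _).symm
      simp)

theorem constHom_mul (a : Poly G) (g : ConvEnd G) (z : Poly G) :
    (constHom a * g).ofConv z = a * g.ofConv z := mul_counit_left a g z

theorem mul_constHom (a : Poly G) (g : ConvEnd G) (z : Poly G) :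
    (g * constHom a).ofConv z = g.ofConv z * a := mul_counit_right a g z

/-- Functionals as scalar-valued endomorphisms. -/
def scalHom : Fn G →ₐ[ℂ] ConvEnd G :=
  AlgHom.ofLinearMap
    { toFun := fun f => WithConv.toConv (Algebra.linearMap ℂ (Poly G) ∘ₗ f.ofConv)
      map_add' := fun x y => by ext z; simp
      map_smul' := fun c x => by ext z; simp only [WithConv.ofConv_smul, LinearMap.comp_apply,
                                                    LinearMap.smul_apply, map_smul]; rfl }
    (by ext z; simp)
    (fun f g => by
      ext z
      exact congrArg (fun F => F z)
        (LinearMap.algHom_comp_convMul_distrib (Algebra.ofId ℂ (Poly G)) f g))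

theorem scalHom_apply (f : Fn G) (z : Poly G) :
    (scalHom f).ofConv z = algebraMap ℂ (Poly G) (f.ofConv z) := rfl

theorem commute_constHom_scalHom (a : Poly G) (f : Fn G) :
    Commute (constHom a) (scalHom f) := by
  ext z
  rw [constHom_mul, mul_constHom, scalHom_apply, Algebra.commutes]

/-- `a ⊗ b ↦ a ⊗ R(b ⊗ ·)` -/
def IsBichar.homPP {R : Poly G ⊗[ℂ] Poly G →ₗ[ℂ] ℂ} (hR : IsBichar R) :
    Poly G ⊗[ℂ] Poly G →ₐ[ℂ] ConvEnd G :=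
  Algebra.TensorProduct.lift constHom (scalHom.comp hR.homL)
    fun a b => commute_constHom_scalHom a (hR.homL b)

/-- `a ⊗ b ↦ R(a ⊗ ·) ⊗ b` -/
def IsBichar.homQQ {R : Poly G ⊗[ℂ] Poly G →ₗ[ℂ] ℂ} (hR : IsBichar R) :
    Poly G ⊗[ℂ] Poly G →ₐ[ℂ] ConvEnd G :=
  Algebra.TensorProduct.lift (scalHom.comp hR.homL) constHom
    fun a b => (commute_constHom_scalHom b (hR.homL a)).symm

theorem IsBichar.homPP_apply {R : Poly G ⊗[ℂ] Poly G →ₗ[ℂ] ℂ} (hR : IsBichar R) (a b z : Poly G) :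
    (hR.homPP (a ⊗ₜ b)).ofConv z = R (b ⊗ₜ z) • a := by
  have h : hR.homPP (a ⊗ₜ b) = constHom a * scalHom (hR.homL b) :=
    Algebra.TensorProduct.lift_tmul ..
  rw [h, constHom_mul, scalHom_apply, hR.homL_apply, ← Algebra.commutes, Algebra.smul_def]

theorem IsBichar.homQQ_apply {R : Poly G ⊗[ℂ] Poly G →ₗ[ℂ] ℂ} (hR : IsBichar R) (a b z : Poly G) :
    (hR.homQQ (a ⊗ₜ b)).ofConv z = R (a ⊗ₜ z) • b := by
  have h : hR.homQQ (a ⊗ₜ b) = scalHom (hR.homL a) * constHom b :=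
    Algebra.TensorProduct.lift_tmul ..
  rw [h, mul_constHom, scalHom_apply, hR.homL_apply, Algebra.smul_def]

/-- The left-hand side of the commutation relation. -/
def commL (R : Poly G ⊗[ℂ] Poly G →ₗ[ℂ] ℂ) (x y : Poly G) : Poly G :=
  TensorProduct.rid ℂ (Poly G) (TensorProduct.map
    (LinearMap.mul' ℂ (Poly G) ∘ₗ (TensorProduct.comm ℂ (Poly G) (Poly G)).toLinearMap) R
    (Coalgebra.comul (R := ℂ) (x ⊗ₜ[ℂ] y)))

/-- The right-hand side of the commutation relation. -/
def commR (R : Poly G ⊗[ℂ] Poly G →ₗ[ℂ] ℂ) (x y : Poly G) : Poly G :=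
  TensorProduct.lid ℂ (Poly G) (TensorProduct.map R (LinearMap.mul' ℂ (Poly G))
    (Coalgebra.comul (R := ℂ) (x ⊗ₜ[ℂ] y)))

namespace IsBichar

variable {R : Poly G ⊗[ℂ] Poly G →ₗ[ℂ] ℂ}

/-- As a function of `y`, this side is a convolution product of the identity with an element
depending multiplicatively on `Δx`. The other side has the same shape with the order of the factors
exchanged. -/
theorem commL_eq (hR : IsBichar R) (x y : Poly G) : commL R x y =
    (WithConv.toConv LinearMap.id * hR.homPP (Coalgebra.comul (R := ℂ) x)).ofConv y := by
  rw [commL, TensorProduct.comul_tmul, LinearMap.convMul_apply]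
  generalize Coalgebra.comul (R := ℂ) x = t
  generalize Coalgebra.comul (R := ℂ) y = s
  induction t using TensorProduct.induction_on with
  | zero => simp
  | add a b ha hb =>
    rw [TensorProduct.add_tmul, map_add, map_add, map_add, ha, hb, map_add, WithConv.ofConv_add,
      TensorProduct.map_add_right, LinearMap.add_apply, map_add]
  | tmul a b =>
    induction s using TensorProduct.induction_on with
    | zero => simp
    | add c d hc hd => simp only [TensorProduct.tmul_add, map_add, hc, hd]
    | tmul c d => simp [hR.homPP_apply]

theorem commR_eq (hR : IsBichar R) (x y : Poly G) : commR R x y =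
    (hR.homQQ (Coalgebra.comul (R := ℂ) x) * WithConv.toConv LinearMap.id).ofConv y := by
  rw [commR, TensorProduct.comul_tmul, LinearMap.convMul_apply]
  generalize Coalgebra.comul (R := ℂ) x = t
  generalize Coalgebra.comul (R := ℂ) y = s
  induction t using TensorProduct.induction_on with
  | zero => simp
  | add a b ha hb =>
    rw [TensorProduct.add_tmul, map_add, map_add, map_add, ha, hb, map_add, WithConv.ofConv_add,
      TensorProduct.map_add_left, LinearMap.add_apply, map_add]
  | tmul a b =>
    induction s using TensorProduct.induction_on with
    | zero => simp
    | add c d hc hd => simp only [TensorProduct.tmul_add, map_add, hc, hd]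
    | tmul c d => simp [hR.homQQ_apply]

/-- It suffices to check the commutation relation on generators in the first variable. -/
theorem comm_of_left (hR : IsBichar R)
    (h : ∀ a j k y, commL R (V G a j k) y = commR R (V G a j k) y) (x y : Poly G) :
    commL R x y = commR R x y := by
  -- The relation has the form `id * P(x) = Q(x) * id` with `P` and `Q` homomorphisms in `x`, so it
  -- is inherited by products.
  suffices H : WithConv.toConv LinearMap.id * hR.homPP (Coalgebra.comul (R := ℂ) x) =
      hR.homQQ (Coalgebra.comul (R := ℂ) x) * WithConv.toConv LinearMap.id by
    rw [hR.commL_eq, hR.commR_eq, H]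
  induction x using induction_V with
  | h_one => rw [Bialgebra.comul_one, map_one, map_one, mul_one, one_mul]
  | h_V b i j => ext y; rw [← hR.commL_eq, ← hR.commR_eq, h]
  | h_smul c x hx => rw [map_smul, map_smul, map_smul, mul_smul_comm, smul_mul_assoc, hx]
  | h_add x y hx hy => rw [map_add, map_add, map_add, mul_add, add_mul, hx, hy]
  | h_mul x y hx hy =>
    rw [Bialgebra.comul_mul, map_mul, map_mul, ← mul_assoc, hx, mul_assoc, hy, mul_assoc]

end IsBichar

/-! ### Translations by matrix representations -/

section Translation

variable {n : Type*} [Fintype n] [DecidableEq n]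

/-- A representation by complex matrices as a representation by matrices over `𝒜`. -/
def embHom (F : Poly G →ₐ[ℂ] Matrix n n ℂ) : Poly G →ₐ[ℂ] Matrix n n (Poly G) :=
  (Algebra.ofId ℂ (Poly G)).mapMatrix.comp F

theorem commute_embHom (F : Poly G →ₐ[ℂ] Matrix n n ℂ) (x y : Poly G) :
    Commute (Matrix.scalarAlgHom n ℂ x) (embHom F y) := by
  ext i j
  simp [embHom, Matrix.diagonal_mul, Matrix.mul_diagonal, Algebra.ofId_apply, Algebra.commutes]

/-- `y ↦ y⁽¹⁾ ⊗ F(y⁽²⁾)` -/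
def rhoHom (F : Poly G →ₐ[ℂ] Matrix n n ℂ) : Poly G →ₐ[ℂ] Matrix n n (Poly G) :=
  (Algebra.TensorProduct.lift (Matrix.scalarAlgHom n ℂ) (embHom F)
    (commute_embHom F)).comp (Bialgebra.comulAlgHom ℂ (Poly G))

/-- `y ↦ F(y⁽¹⁾) ⊗ y⁽²⁾` -/
def lamHom (F : Poly G →ₐ[ℂ] Matrix n n ℂ) : Poly G →ₐ[ℂ] Matrix n n (Poly G) :=
  (Algebra.TensorProduct.lift (embHom F) (Matrix.scalarAlgHom n ℂ)
    fun x y => (commute_embHom F y x).symm).comp (Bialgebra.comulAlgHom ℂ (Poly G))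

end Translation

namespace IsBichar

variable {R : Poly G ⊗[ℂ] Poly G →ₗ[ℂ] ℂ}

/-- With a generator in the first variable the commutation relation says that the transpose of `v`
intertwines the homomorphisms `rhoHom` and `lamHom` in `y`; in this form it is inherited by products
of `y`. -/
theorem commL_V (hR : IsBichar R) (a : Bool) (j k : Fin 2) (y : Poly G) :
    commL R (V G a j k) y = (rhoHom (hR.repR a) y * (V G a).transpose) k j := by
  rw [commL, TensorProduct.comul_tmul, comul_V, Matrix.mul_apply, TensorProduct.sum_tmul]
  simp only [map_sum]
  refine Finset.sum_congr rfl fun m _ => ?_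
  rw [rhoHom, AlgHom.comp_apply, Bialgebra.comulAlgHom_apply]
  induction Coalgebra.comul (R := ℂ) y using TensorProduct.induction_on with
  | zero => simp
  | add c d hc hd => simp only [TensorProduct.tmul_add, map_add, hc, hd, Matrix.add_apply, add_mul]
  | tmul c d =>
    simp [embHom, Algebra.ofId_apply, Matrix.diagonal_mul, Algebra.smul_def, mul_assoc,
      Algebra.commutes]

theorem commR_V (hR : IsBichar R) (a : Bool) (j k : Fin 2) (y : Poly G) :
    commR R (V G a j k) y = ((V G a).transpose * lamHom (hR.repR a) y) k j := by
  rw [commR, TensorProduct.comul_tmul, comul_V, Matrix.mul_apply, TensorProduct.sum_tmul]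
  simp only [map_sum]
  refine Finset.sum_congr rfl fun m _ => ?_
  rw [lamHom, AlgHom.comp_apply, Bialgebra.comulAlgHom_apply]
  induction Coalgebra.comul (R := ℂ) y using TensorProduct.induction_on with
  | zero => simp
  | add c d hc hd => simp only [TensorProduct.tmul_add, map_add, hc, hd, Matrix.add_apply, mul_add]
  | tmul c d =>
    simp [embHom, Algebra.ofId_apply, Matrix.mul_diagonal, Algebra.smul_def, ← mul_assoc,
      Algebra.commutes]
    rw [mul_assoc, Algebra.commutes, mul_assoc]

end IsBichar

theorem commL_V_V (R : Poly G ⊗[ℂ] Poly G →ₗ[ℂ] ℂ) (a b : Bool) (i j k l : Fin 2) :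
    commL R (V G a j k) (V G b i l) =
      ((V G b ⊗ₖ V G a) * cst (Poly G) (Rmat R (V G a) (V G b))) (i, j) (k, l) := by
  simp [commL, TensorProduct.comul_tmul, comul_V, Matrix.mul_apply, cst, Rmat,
    Fintype.sum_prod_type, TensorProduct.add_tmul, TensorProduct.tmul_add, Algebra.smul_def,
    Algebra.commutes]

theorem commR_V_V (R : Poly G ⊗[ℂ] Poly G →ₗ[ℂ] ℂ) (a b : Bool) (i j k l : Fin 2) :
    commR R (V G a j k) (V G b i l) =
      (cst (Poly G) (Rmat R (V G a) (V G b)) * (V G a ⊗ₖ V G b)) (i, j) (k, l) := by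
  simp [commR, TensorProduct.comul_tmul, comul_V, Matrix.mul_apply, cst, Rmat,
    Fintype.sum_prod_type, TensorProduct.add_tmul, TensorProduct.tmul_add, Algebra.smul_def]
  abel

/-- The matrices `R^{vv'}` of a coquasitriangular structure are intertwiners. -/
theorem IsCQT.intertwiner {R : Poly G ⊗[ℂ] Poly G →ₗ[ℂ] ℂ} (hR : IsCQT R) (a b : Bool) :
    cst (Poly G) (Rmat R (V G a) (V G b)) * (V G a ⊗ₖ V G b) =
      (V G b ⊗ₖ V G a) * cst (Poly G) (Rmat R (V G a) (V G b)) := by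
  ext1 ⟨i, j⟩ ⟨k, l⟩
  rw [← commL_V_V, ← commR_V_V]
  exact (hR.comm _ _).symm

/-- A bicharacter whose values on generators are intertwiners is a coquasitriangular structure. -/
theorem IsBichar.isCQT {R : Poly G ⊗[ℂ] Poly G →ₗ[ℂ] ℂ} (hR : IsBichar R)
    (h : ∀ a b, cst (Poly G) (Rmat R (V G a) (V G b)) * (V G a ⊗ₖ V G b) =
      (V G b ⊗ₖ V G a) * cst (Poly G) (Rmat R (V G a) (V G b))) : IsCQT R := by
  refine ⟨hR.one_left, hR.one_right, hR.mul_left, hR.mul_right,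
    hR.comm_of_left fun a j k y => ?_⟩
  rw [hR.commL_V, hR.commR_V]
  suffices H : rhoHom (hR.repR a) y * (V G a).transpose =
      (V G a).transpose * lamHom (hR.repR a) y by rw [H]
  induction y using induction_V with
  | h_one => simp
  | h_V b i l =>
    ext k j
    rw [← hR.commL_V, ← hR.commR_V, commL_V_V, commR_V_V, h]
  | h_smul c x hx => rw [map_smul, map_smul, Matrix.smul_mul, Matrix.mul_smul, hx]
  | h_add x y hx hy => rw [map_add, map_add, Matrix.add_mul, Matrix.mul_add, hx, hy]
  | h_mul x y hx hy =>
    rw [map_mul, map_mul, Matrix.mul_assoc, hy, ← Matrix.mul_assoc, hx, Matrix.mul_assoc]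

/-! ### Cotriangularity -/

namespace IsBichar

variable {R : Poly G ⊗[ℂ] Poly G →ₗ[ℂ] ℂ}

/-- `a ⊗ b ↦ R(a ⊗ ·) * R(· ⊗ b)` -/
def invL (hR : IsBichar R) : Poly G ⊗[ℂ] Poly G →ₗ[ℂ] Fn G :=
  TensorProduct.lift ((LinearMap.mul ℂ (Fn G)).compl₁₂ hR.homL.toLinearMap
    ((MulOpposite.opLinearEquiv ℂ).symm.toLinearMap ∘ₗ hR.homR.toLinearMap))

theorem invL_tmul (hR : IsBichar R) (a b : Poly G) :
    hR.invL (a ⊗ₜ b) = hR.homL a * (hR.homR b).unop := rfl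

/-- The functional `R(· ⊗ y)` reverses products while `R(x ⊗ ·)` keeps them, so new factors wrap
around the old value. A scalar in the middle then comes out, and the products telescope. -/
theorem invL_mul (hR : IsBichar R) (a b : Poly G) (s : Poly G ⊗[ℂ] Poly G) :
    hR.invL (a ⊗ₜ b * s) = hR.homL a * hR.invL s * (hR.homR b).unop := by
  induction s using TensorProduct.induction_on with
  | zero => simp
  | tmul c d => simp [invL_tmul, mul_assoc]
  | add c d hc hd => simp [mul_add, add_mul, hc, hd]

/-- `a ⊗ b ↦ R(v ⊗ a) R(b ⊗ v)` -/
def invR (hR : IsBichar R) (v : Bool) : Poly G ⊗[ℂ] Poly G →ₗ[ℂ] M2 :=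
  TensorProduct.lift ((LinearMap.mul ℂ M2).compl₁₂
    ((Matrix.transposeLinearEquiv (Fin 2) (Fin 2) ℂ ℂ).toLinearMap ∘ₗ (hR.repR v).toLinearMap)
    (hR.repL v).toLinearMap)

theorem invR_tmul (hR : IsBichar R) (v : Bool) (a b : Poly G) :
    hR.invR v (a ⊗ₜ b) = (hR.repR v a).transpose * hR.repL v b := rfl

theorem invR_mul (hR : IsBichar R) (v : Bool) (a b : Poly G) (s : Poly G ⊗[ℂ] Poly G) :
    hR.invR v (s * a ⊗ₜ b) = (hR.repR v a).transpose * hR.invR v s * hR.repL v b := by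
  induction s using TensorProduct.induction_on with
  | zero => simp
  | tmul c d => simp [invR_tmul, Matrix.mul_assoc]
  | add c d hc hd => simp [mul_add, add_mul, hc, hd]

theorem conv_eq_invL (hR : IsBichar R) (x y : Poly G) :
    conv R (R ∘ₗ (TensorProduct.comm ℂ _ _).toLinearMap) (x ⊗ₜ[ℂ] y) =
      (hR.invL (Coalgebra.comul (R := ℂ) x)).ofConv y := by
  rw [conv, LinearMap.comp_apply, LinearMap.comp_apply, TensorProduct.comul_tmul]
  induction Coalgebra.comul (R := ℂ) x using TensorProduct.induction_on with
  | zero => simp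
  | add a b ha hb =>
    rw [TensorProduct.add_tmul, map_add, map_add, map_add, ha, hb, map_add, WithConv.ofConv_add,
      LinearMap.add_apply]
  | tmul a b =>
    rw [invL_tmul, LinearMap.convMul_apply]
    induction Coalgebra.comul (R := ℂ) y using TensorProduct.induction_on with
    | zero => simp
    | add c d hc hd => simp only [TensorProduct.tmul_add, map_add, hc, hd]
    | tmul c d => simp

theorem invL_V (hR : IsBichar R) (v : Bool) (j k : Fin 2) (y : Poly G) :
    (hR.invL (Coalgebra.comul (R := ℂ) (V G v j k))).ofConv y =
      hR.invR v (Coalgebra.comul (R := ℂ) y) j k := by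
  rw [comul_V, map_sum, WithConv.ofConv_sum, LinearMap.sum_apply]
  simp only [invL_tmul, LinearMap.convMul_apply]
  induction Coalgebra.comul (R := ℂ) y using TensorProduct.induction_on with
  | zero => simp
  | add c d hc hd => simp only [map_add, Finset.sum_add_distrib, hc, hd, Matrix.add_apply]
  | tmul c d => simp [invR_tmul, Matrix.mul_apply]

theorem invR_V (hR : IsBichar R) (a b : Bool) (i j k l : Fin 2) :
    hR.invR a (Coalgebra.comul (R := ℂ) (V G b i l)) j k =
      (Rmat R (V G a) (V G b) * Rmat R (V G b) (V G a)) (i, j) (l, k) := by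
  rw [comul_V, map_sum, Matrix.sum_apply]
  simp [invR_tmul, Matrix.mul_apply, Rmat, Fintype.sum_prod_type]
  ring

/-- Cotriangularity of a bicharacter, in terms of its values on generators. -/
theorem inv_iff (hR : IsBichar R) :
    (∀ x y : Poly G, conv R (R ∘ₗ (TensorProduct.comm ℂ _ _).toLinearMap) (x ⊗ₜ[ℂ] y) =
      Coalgebra.counit (R := ℂ) x * Coalgebra.counit (R := ℂ) y) ↔
    ∀ a b, Rmat R (V G a) (V G b) * Rmat R (V G b) (V G a) = 1 := by
  constructor
  · intro h a b
    ext ⟨i, j⟩ ⟨l, k⟩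
    rw [← hR.invR_V, ← hR.invL_V, ← hR.conv_eq_invL, h, counit_V, counit_V]
    simp only [Matrix.one_apply, Prod.mk.injEq]
    split_ifs <;> simp_all
  · intro h x y
    -- The first induction treats an arbitrary `y` against a generator; the second extends the
    -- result to an arbitrary first variable.
    have h1 : ∀ v (y : Poly G), hR.invR v (Coalgebra.comul (R := ℂ) y) =
        Coalgebra.counit (R := ℂ) y • (1 : M2) := by
      intro v y
      induction y using induction_V with
      | h_one => rw [Bialgebra.comul_one, Algebra.TensorProduct.one_def, invR_tmul]; simp
      | h_V b i l =>
        ext j k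
        rw [hR.invR_V, h, counit_V]
        simp only [Matrix.smul_apply, Matrix.one_apply, Prod.mk.injEq]
        split_ifs <;> simp_all
      | h_smul c x hx => rw [map_smul, map_smul, hx, map_smul, smul_assoc]
      | h_add x y hx hy => rw [map_add, map_add, hx, hy, map_add, add_smul]
      | h_mul x y hx hy =>
        have key : ∀ t, hR.invR v (Coalgebra.comul (R := ℂ) x * t) =
            Coalgebra.counit (R := ℂ) x • hR.invR v t := by
          intro t
          induction t using TensorProduct.induction_on with
          | zero => simp
          | tmul a b => rw [invR_mul, hx, invR_tmul]; simp
          | add a b ha hb => simp [mul_add, ha, hb]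
        rw [Bialgebra.comul_mul, key, hy, smul_smul, Bialgebra.counit_mul]
    have h2 : ∀ x : Poly G, hR.invL (Coalgebra.comul (R := ℂ) x) =
        Coalgebra.counit (R := ℂ) x • (1 : Fn G) := by
      intro x
      induction x using induction_V with
      | h_one => rw [Bialgebra.comul_one, Algebra.TensorProduct.one_def, invL_tmul]; simp
      | h_V b j k =>
        ext y
        rw [hR.invL_V, h1, counit_V]
        simp [mul_comm]
      | h_smul c x hx => rw [map_smul, map_smul, hx, map_smul, smul_assoc]
      | h_add x y hx hy => rw [map_add, map_add, hx, hy, map_add, add_smul]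
      | h_mul x y hx hy =>
        have key : ∀ t, hR.invL (t * Coalgebra.comul (R := ℂ) y) =
            Coalgebra.counit (R := ℂ) y • hR.invL t := by
          intro t
          induction t using TensorProduct.induction_on with
          | zero => simp
          | tmul a b => rw [invL_mul, hy, invL_tmul]; simp
          | add a b ha hb => simp [add_mul, ha, hb]
        rw [Bialgebra.comul_mul, key, hx, smul_smul, Bialgebra.counit_mul, mul_comm]
    rw [hR.conv_eq_invL, h2]
    simp

/-! ### Reality -/

/-- The involution commutes with `Δ`, so conjugating a convolution at `y*` conjugates each factor
separately. -/
theorem conj_conv_star {f g f' g' : Poly G →ₗ[ℂ] ℂ}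
    (hf : ∀ z, starRingEnd ℂ (f (star z)) = f' z) (hg : ∀ z, starRingEnd ℂ (g (star z)) = g' z)
    (y : Poly G) : starRingEnd ℂ (conv f g (star y)) = conv f' g' y := by
  simp only [conv, LinearMap.comp_apply]
  rw [comul_star]
  induction Coalgebra.comul (R := ℂ) y using TensorProduct.induction_on with
  | zero => simp
  | add a b ha hb => rw [star_add, map_add, map_add, map_add, ha, hb, map_add, map_add]
  | tmul a b => rw [TensorProduct.star_tmul]; simp [hf, hg]

theorem star_V (b : Bool) (i j : Fin 2) : star (V G b i j) = V G (!b) i j := by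
  cases b
  · exact star_w G i j
  · exact star_wt G i j

theorem counit_star (x : Poly G) : starRingEnd ℂ (Coalgebra.counit (R := ℂ) (star x)) =
    Coalgebra.counit (R := ℂ) x := by
  induction x using induction_V with
  | h_one => simp
  | h_V b i j => rw [star_V, counit_V, counit_V, Matrix.one_apply]; split_ifs <;> simp
  | h_smul c x hx => rw [star_smul, map_smul, smul_eq_mul, map_mul, hx, map_smul]; simp
  | h_add x y hx hy => rw [star_add, map_add, map_add, hx, hy, map_add]
  | h_mul x y hx hy => rw [star_mul, Bialgebra.counit_mul, map_mul, hx, hy, Bialgebra.counit_mul,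
      mul_comm]

/-- Reality of a bicharacter, in terms of its values on generators. -/
theorem real_iff (hR : IsBichar R) :
    IsReal R ↔ ∀ a b, tauConj (Rmat R (V G (!b)) (V G (!a))) = Rmat R (V G a) (V G b) := by
  constructor
  · intro h a b
    ext ⟨i, j⟩ ⟨k, l⟩
    have := h (V G a j k) (V G b i l)
    rw [star_V, star_V] at this
    exact this
  · intro h x y
    induction y using induction_V generalizing x with
    | h_one => rw [star_one, hR.one_left, hR.one_right, counit_star]
    | h_V b i l =>
      rw [star_V]
      induction x using induction_V generalizing i l with
      | h_one => rw [star_one, hR.one_left, hR.one_right, ← star_V, counit_star]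
      | h_V a j k =>
        rw [star_V]
        exact congrFun (congrFun (h a b) (i, j)) (k, l)
      | h_smul c x hx =>
        rw [star_smul, TensorProduct.tmul_smul, map_smul, smul_eq_mul, map_mul, hx,
          ← TensorProduct.smul_tmul', map_smul]
        simp
      | h_add x y hx hy =>
        rw [star_add, TensorProduct.tmul_add, map_add, map_add, hx, hy, TensorProduct.add_tmul,
          map_add]
      | h_mul x y hx hy =>
        -- The star reverses the product and so does multiplicativity in the second variable; the
        -- two reversals cancel.
        rw [star_mul, hR.mul_right_V, map_sum, hR.mul_left_V]
        simp only [map_mul, hx, hy]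
    | h_smul c x hx =>
      rw [star_smul, ← TensorProduct.smul_tmul', map_smul, smul_eq_mul, map_mul, hx,
        TensorProduct.tmul_smul, map_smul]
      simp
    | h_add x y hx hy =>
      rw [star_add, TensorProduct.add_tmul, map_add, map_add, hx, hy, TensorProduct.tmul_add,
        map_add]
    | h_mul y z hy hz =>
      rw [star_mul, hR.mul_left, hR.mul_right]
      exact conj_conv_star (fun u => hz u) (fun u => hy u) x

end IsBichar

end

section

variable {G : Data}

/-! ### Translation operators -/

theorem eq_of_functionals {x y : Poly G} (h : ∀ f : Fn G, f.ofConv x = f.ofConv y) : x = y := by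
  rw [← sub_eq_zero, ← Module.forall_dual_apply_eq_zero_iff ℂ]
  intro f
  rw [map_sub, sub_eq_zero]
  exact h (WithConv.toConv f)

/-- `z ↦ f(z⁽¹⁾) z⁽²⁾` -/
def lTr (f : Fn G) : Module.End ℂ (Poly G) :=
  TensorProduct.lid ℂ (Poly G) ∘ₗ LinearMap.rTensor (Poly G) f.ofConv ∘ₗ Coalgebra.comul

/-- `z ↦ z⁽¹⁾ f(z⁽²⁾)` -/
def rTr (f : Fn G) : Module.End ℂ (Poly G) :=
  TensorProduct.rid ℂ (Poly G) ∘ₗ LinearMap.lTensor (Poly G) f.ofConv ∘ₗ Coalgebra.comul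

/-- Seen through functionals, translation by `f` is multiplication by `f` in the convolution
algebra. Identities between translations therefore reduce to associativity there. -/
theorem apply_lTr (f g : Fn G) (z : Poly G) : g.ofConv (lTr f z) = (f * g).ofConv z := by
  rw [LinearMap.convMul_apply, lTr, LinearMap.comp_apply, LinearMap.comp_apply]
  induction Coalgebra.comul (R := ℂ) z using TensorProduct.induction_on with
  | zero => simp
  | add a b ha hb => simp only [map_add, ha, hb]
  | tmul a b => simp

theorem apply_rTr (f g : Fn G) (z : Poly G) : g.ofConv (rTr f z) = (g * f).ofConv z := by
  rw [LinearMap.convMul_apply, rTr, LinearMap.comp_apply, LinearMap.comp_apply]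
  induction Coalgebra.comul (R := ℂ) z using TensorProduct.induction_on with
  | zero => simp
  | add a b ha hb => simp only [map_add, ha, hb]
  | tmul a b => simp [mul_comm]

/-- Left translation, as a homomorphism. -/
def lTrHom : (Fn G)ᵐᵒᵖ →ₐ[ℂ] Module.End ℂ (Poly G) :=
  AlgHom.ofLinearMap
    { toFun := fun f => lTr f.unop
      map_add' := fun f g => LinearMap.ext fun z => eq_of_functionals fun h => by
        simp [apply_lTr, add_mul]
      map_smul' := fun c g => LinearMap.ext fun z => eq_of_functionals fun h => by
        simp only [apply_lTr, RingHom.id_apply, LinearMap.smul_apply, map_smul,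
          MulOpposite.unop_smul, smul_mul_assoc, WithConv.ofConv_smul] }
    (LinearMap.ext fun z => eq_of_functionals fun h => by
      simp only [LinearMap.coe_mk, AddHom.coe_mk, apply_lTr, MulOpposite.unop_one, one_mul]; rfl)
    (fun f g => LinearMap.ext fun z => eq_of_functionals fun h => by
      simp only [LinearMap.coe_mk, AddHom.coe_mk, Module.End.mul_apply, apply_lTr,
        MulOpposite.unop_mul, mul_assoc])

/-- Right translation, as a homomorphism. -/
def rTrHom : Fn G →ₐ[ℂ] Module.End ℂ (Poly G) :=
  AlgHom.ofLinearMap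
    { toFun := fun f => rTr f
      map_add' := fun f g => LinearMap.ext fun z => eq_of_functionals fun h => by
        simp [apply_rTr, mul_add]
      map_smul' := fun c g => LinearMap.ext fun z => eq_of_functionals fun h => by
        simp only [apply_rTr, RingHom.id_apply, LinearMap.smul_apply, map_smul,
          mul_smul_comm, WithConv.ofConv_smul] }
    (LinearMap.ext fun z => eq_of_functionals fun h => by
      simp only [LinearMap.coe_mk, AddHom.coe_mk, apply_rTr, mul_one]; rfl)
    (fun f g => LinearMap.ext fun z => eq_of_functionals fun h => by
      simp only [LinearMap.coe_mk, AddHom.coe_mk, Module.End.mul_apply, apply_rTr, mul_assoc])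

theorem commute_lTr_rTr (f g : Fn G) : Commute (lTr f) (rTr g) :=
  LinearMap.ext fun z => eq_of_functionals fun h => by
    simp only [Module.End.mul_apply, apply_rTr, apply_lTr, mul_assoc]

section

variable {n : Type*} [Fintype n] [DecidableEq n]

theorem lTr_fe (F : Poly G →ₐ[ℂ] Matrix n n ℂ) (i j : n) (z : Poly G) :
    lTr (fe F i j) z = lamHom F z i j := by
  rw [lTr, LinearMap.comp_apply, LinearMap.comp_apply, lamHom, AlgHom.comp_apply,
    Bialgebra.comulAlgHom_apply]
  induction Coalgebra.comul (R := ℂ) z using TensorProduct.induction_on with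
  | zero => simp
  | add a b ha hb => simp only [map_add, ha, hb, Matrix.add_apply]
  | tmul a b =>
    simp [embHom, Algebra.ofId_apply, Matrix.mul_diagonal, Algebra.smul_def]

theorem rTr_fe (F : Poly G →ₐ[ℂ] Matrix n n ℂ) (i j : n) (z : Poly G) :
    rTr (fe F i j) z = rhoHom F z i j := by
  rw [rTr, LinearMap.comp_apply, LinearMap.comp_apply, rhoHom, AlgHom.comp_apply,
    Bialgebra.comulAlgHom_apply]
  induction Coalgebra.comul (R := ℂ) z using TensorProduct.induction_on with
  | zero => simp
  | add a b ha hb => simp only [map_add, ha, hb, Matrix.add_apply]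
  | tmul a b =>
    simp [embHom, Algebra.ofId_apply, Matrix.diagonal_mul, Algebra.smul_def, Algebra.commutes]

theorem lamHom_V (F : Poly G →ₐ[ℂ] Matrix n n ℂ) (b : Bool) (j l : Fin 2) (i k : n) :
    lamHom F (V G b j l) i k = ∑ p, F (V G b j p) i k • V G b p l := by
  simp [lamHom, comul_V, embHom, Algebra.ofId_apply, Matrix.mul_diagonal, Algebra.smul_def]

theorem rhoHom_V (F : Poly G →ₐ[ℂ] Matrix n n ℂ) (b : Bool) (j l : Fin 2) (i k : n) :
    rhoHom F (V G b j l) i k = ∑ p, F (V G b p l) i k • V G b j p := by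
  simp [rhoHom, comul_V, embHom, Algebra.ofId_apply, Matrix.diagonal_mul, Algebra.smul_def,
    Algebra.commutes]

end

/-! ### The split case `X = τ` -/

/-- The flip of `ℂ² ⊗ ℂ²`. -/
def flipMat : Matrix I2 I2 ℂ := fun p r => if p = r.swap then 1 else 0

theorem flipMat_mul_flipMat : flipMat * flipMat = 1 := by
  ext ⟨i, j⟩ ⟨k, l⟩
  simp [flipMat, Matrix.mul_apply, Matrix.one_apply, Prod.ext_iff, Fintype.sum_prod_type,
    ite_and]

variable (G) in
/-- The data with the same form `E`, but `X = τ`. -/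
def Data.flat : Data where
  E := G.E
  E' := G.E'
  X := flipMat
  β := 1
  zigzag := G.zigzag
  X_E i j l k := by
    fin_cases i <;> fin_cases j <;> fin_cases l <;> fin_cases k <;> simp [flipMat]
  tauConj_X := by
    ext ⟨i, j⟩ ⟨k, l⟩
    simp only [tauConj, flipMat, Matrix.submatrix_apply, Matrix.map_apply, Prod.swap,
      Prod.mk.injEq, inv_one, one_smul]
    split_ifs <;> simp_all
  E'_mul_E_ne := G.E'_mul_E_ne
  isUnit_X := IsUnit.of_mul_eq_one _ flipMat_mul_flipMat
  β_ne := one_ne_zero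

theorem flip_comm {B : Type*} [Ring B] [Algebra ℂ B] {W : Matrix (Fin 2) (Fin 2) B} :
    cst B flipMat * (W ⊗ₖ 1) = (1 ⊗ₖ W) * cst B flipMat := by
  ext ⟨i, j⟩ ⟨k, l⟩
  fin_cases i <;> fin_cases j <;> fin_cases k <;> fin_cases l <;>
    simp [Matrix.mul_apply, cst, flipMat, Fintype.sum_prod_type]

/-- Representations of the split algebra that are trivial on `w̃`. -/
theorem sat_flat {W : Matrix (Fin 2) (Fin 2) M2} (h : (W ⊗ₖ W) * cst M2 G.E = cst M2 G.E) :
    Sat G.flat W 1 :=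
  Sat.of_col G.flat h (by rw [Matrix.one_kronecker_one, Matrix.one_mul]) flip_comm

/-- `σ(w) = X` -/
def sigmaRep : Poly G.flat →ₐ[ℂ] M2 :=
  lift (sat_flat (G := G) (blkL_col_iff.mpr (X_col12 G)))

/-- `σ'(w) = X⁻¹` -/
def sigmaRep' : Poly G.flat →ₐ[ℂ] M2 :=
  lift (sat_flat (G := G) (blkR_col_iff.mpr (X_inv_col23 G)))

theorem sigmaRep_w (i j k l : Fin 2) : sigmaRep (w G.flat j k) i l = G.X (i, j) (k, l) := by
  rw [sigmaRep, lift_w]; rfl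

theorem sigmaRep_wt (i j : Fin 2) : sigmaRep (wt G.flat i j) = (1 : Matrix _ _ M2) i j := by
  rw [sigmaRep, lift_wt]

theorem sigmaRep'_w (i j k l : Fin 2) : sigmaRep' (w G.flat i l) k j = G.X⁻¹ (i, j) (k, l) := by
  rw [sigmaRep', lift_w]; rfl

theorem sigmaRep'_wt (i j : Fin 2) : sigmaRep' (wt G.flat i j) = (1 : Matrix _ _ M2) i j := by
  rw [sigmaRep', lift_wt]

end

/-! ### The character `w ↦ β²` of the split algebra and the identity `β⁴ = 1`. -/

section

variable {G : Data}

theorem sconv_sigma_apply (m n i j k l : Fin 2) :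
    sconv sigmaRep sigmaRep (w G.flat m n) (i, j) (k, l) =
      (op23 G.X * op12 G.X) (i, j, m) (n, k, l) := by
  refine (sconv_V sigmaRep sigmaRep false m n (i, j) (k, l)).trans ?_
  simp [sigmaRep_w, Matrix.mul_apply, op12, op23, Fintype.sum_prod_type]

theorem sconv_sigma_wt (m n : Fin 2) :
    sconv sigmaRep sigmaRep (wt G.flat m n) = (1 : M2) m n • 1 := by
  ext ⟨i, j⟩ ⟨k, l⟩
  refine (sconv_V sigmaRep sigmaRep true m n (i, j) (k, l)).trans ?_
  simp only [V_true, sigmaRep_wt, Matrix.one_apply, Prod.mk.injEq, Matrix.smul_apply,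
    Fin.sum_univ_two]
  fin_cases m <;> fin_cases n <;> simp [Matrix.one_apply, ← ite_and]

theorem kconv_sigma_apply (m n i j k l : Fin 2) :
    kconv sigmaRep' sigmaRep' (w G.flat m n) (i, j) (k, l) =
      (op12 G.X⁻¹ * op23 G.X⁻¹) (m, k, l) (i, j, n) := by
  rw [show w G.flat m n = V G.flat false m n from rfl, kconv_V]
  simp [sigmaRep'_w, Matrix.mul_apply, op12, op23, Fintype.sum_prod_type]

theorem kconv_sigma_wt (m n : Fin 2) :
    kconv sigmaRep' sigmaRep' (wt G.flat m n) = (1 : M2) m n • 1 := by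
  rw [show wt G.flat m n = V G.flat true m n from rfl, kconv_V]
  simp only [V_true, sigmaRep'_wt, Fin.sum_univ_two]
  fin_cases m <;> fin_cases n <;> simp [Matrix.one_apply]

theorem col_apply (E : Matrix I2 Unit ℂ) (i j m n : Fin 2) :
    col12 E (i, j, m) n = (1 : M2) m n * E (i, j) () := by
  simp [col12, Matrix.one_apply]

theorem row_apply (E' : Matrix Unit I2 ℂ) (i j m n : Fin 2) :
    row23 E' m (n, i, j) = (1 : M2) m n * E' () (i, j) := by
  simp [row23, Matrix.one_apply]

theorem col23_apply' (E : Matrix I2 Unit ℂ) (i j m n : Fin 2) :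
    col23 E (m, i, j) n = (1 : M2) m n * E (i, j) () := by
  simp [col23, Matrix.one_apply]

theorem row12_apply' (E' : Matrix Unit I2 ℂ) (i j m n : Fin 2) :
    row12 E' m (i, j, n) = (1 : M2) m n * E' () (i, j) := by
  simp [row12, Matrix.one_apply]

/-- This is `X_col23` in terms of representations: `Ẽ` spans a line in the tensor square of `σ` on
which `w` acts by the scalar `β²`. -/
theorem sconv_sigma_col (m n : Fin 2) :
    sconv sigmaRep sigmaRep (w G.flat m n) * G.Et = (G.β ^ 2 * (1 : M2) m n) • G.Et := by
  ext ⟨i, j⟩ u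
  have := congrFun (congrFun (X_col23 G) (i, j, m)) n
  rw [Matrix.smul_apply, col_apply, smul_eq_mul, ← mul_assoc] at this
  rw [Matrix.smul_apply, smul_eq_mul, ← this, Matrix.mul_apply, Matrix.mul_apply]
  simp only [Fintype.sum_prod_type, sconv_sigma_apply]
  fin_cases n <;> simp [col23]

theorem sconv_sigma_row (m n : Fin 2) :
    G.Et' * sconv sigmaRep sigmaRep (w G.flat m n) = (G.β ^ 2 * (1 : M2) m n) • G.Et' := by
  ext u ⟨k, l⟩
  have := congrFun (congrFun (X_row12 G) m) (n, k, l)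
  rw [Matrix.smul_apply, row_apply, smul_eq_mul, ← mul_assoc] at this
  rw [Matrix.smul_apply, smul_eq_mul, ← this, Matrix.mul_apply, Matrix.mul_apply]
  simp only [Fintype.sum_prod_type, sconv_sigma_apply]
  fin_cases m <;> simp [row12]

theorem X_inv_row23 : row23 G.Et' * (op12 G.X⁻¹ * op23 G.X⁻¹) = (G.β ^ 2)⁻¹ • row12 G.Et' := by
  have h := congrArg (fun M => (G.β ^ 2)⁻¹ • (M * (op12 G.X⁻¹ * op23 G.X⁻¹))) (X_row12 G)
  simp only [Matrix.smul_mul, smul_smul, inv_mul_cancel₀ (pow_ne_zero 2 G.β_ne), one_smul] at h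
  rw [← h, Matrix.mul_assoc, Matrix.mul_assoc, ← Matrix.mul_assoc (op12 G.X), op12_X_mul_inv,
    Matrix.one_mul, op23_X_mul_inv, Matrix.mul_one]

/-- Transposes occur because the block indices in `σ'` are transposed; the factor is now `β⁻²`
because `X⁻¹` replaces `X`. -/
theorem kconv_sigma_col (m n : Fin 2) : G.Et.transpose * kconv sigmaRep' sigmaRep' (w G.flat m n) =
    ((G.β ^ 2)⁻¹ * (1 : M2) m n) • G.Et.transpose := by
  ext u ⟨i, j⟩
  have := congrFun (congrFun (X_inv_col12 G) (m, i, j)) n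
  rw [Matrix.smul_apply, col23_apply', smul_eq_mul, ← mul_assoc] at this
  rw [Matrix.smul_apply, smul_eq_mul, Matrix.transpose_apply, ← this, Matrix.mul_apply,
    Matrix.mul_apply]
  simp only [Fintype.sum_prod_type, kconv_sigma_apply]
  fin_cases n <;> simp [col12, mul_comm]

theorem kconv_sigma_row (m n : Fin 2) : kconv sigmaRep' sigmaRep' (w G.flat m n) * G.Et'.transpose =
    ((G.β ^ 2)⁻¹ * (1 : M2) m n) • G.Et'.transpose := by
  ext ⟨k, l⟩ u
  have := congrFun (congrFun (X_inv_row23 (G := G)) m) (k, l, n)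
  rw [Matrix.smul_apply, row12_apply', smul_eq_mul, ← mul_assoc] at this
  rw [Matrix.smul_apply, smul_eq_mul, Matrix.transpose_apply, ← this, Matrix.mul_apply,
    Matrix.mul_apply]
  simp only [Fintype.sum_prod_type, kconv_sigma_apply]
  fin_cases m <;> simp [row23, mul_comm]

/-- The square of `β²` is forced to be `1`. -/
theorem beta_pow_four (G : Data) : G.β ^ 2 * G.β ^ 2 = 1 := by
  obtain ⟨i, j, hij⟩ := exists_ne_zero_of_form (sqR_mul_sqL G)
  obtain ⟨k, l, hkl⟩ := exists_ne_zero_of_form (sqR_mul_sqL_t G)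
  have h := congrFun (congrFun (((sat_w G.flat).map G.flat
    (sconv sigmaRep sigmaRep : Poly G.flat →ₐ[ℂ] _)).E) (i, j)) ()
  rw [Matrix.mul_apply] at h
  -- Let the relation `(w ⊗ w)E = E`, read in the tensor square of `σ`, act on `Ẽ`. Each `w`
  -- contributes `β²`, so `E` is multiplied by `β⁴`.
  have h2 := congrArg (fun M => M * G.Et) h
  simp only [Matrix.sum_mul, Matrix.kroneckerMap_apply, Matrix.map_apply, cst,
    Algebra.algebraMap_eq_smul_one, Matrix.mul_smul, Matrix.smul_mul, Matrix.mul_one,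
    Matrix.mul_assoc, sconv_sigma_col, Matrix.one_mul] at h2
  rw [Fintype.sum_eq_single (i, j)] at h2
  · have h3 := congrFun (congrFun h2 (k, l)) ()
    simp only [Matrix.smul_apply, smul_eq_mul, Matrix.one_apply_eq, mul_one] at h3
    have h4 : G.flat.E (i, j) () = G.E (i, j) () := rfl
    rw [h4] at h3
    refine mul_left_cancel₀ hij (mul_right_cancel₀ hkl ?_)
    linear_combination h3
  · rintro ⟨a, b⟩ hab
    simp only [Matrix.one_apply]
    by_cases hia : i = a
    · have : j ≠ b := fun h => hab (by rw [hia, h])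
      simp [this]
    · simp [hia]

theorem beta_sq_inv (G : Data) : (G.β ^ 2)⁻¹ = G.β ^ 2 :=
  inv_eq_of_mul_eq_one_right (beta_pow_four G)

/-- The identity `β⁴ = 1` is exactly what lets `w ↦ β²` respect the relations of `E` and `E'`. -/
theorem sat_chi : Sat G.flat (G.β ^ 2 • (1 : Matrix (Fin 2) (Fin 2) (Matrix Unit Unit ℂ))) 1 := by
  constructor
  · rw [Matrix.smul_kronecker, Matrix.kronecker_smul, smul_smul, beta_pow_four, one_smul,
      Matrix.one_kronecker_one, Matrix.one_mul]
  · rw [Matrix.one_kronecker_one, Matrix.one_mul]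
  · rw [Matrix.smul_kronecker, Matrix.kronecker_smul, smul_smul, beta_pow_four, one_smul,
      Matrix.one_kronecker_one, Matrix.mul_one]
  · rw [Matrix.one_kronecker_one, Matrix.mul_one]
  · exact flip_comm

/-- The character `w ↦ β²`. -/
def chiRep : Poly G.flat →ₐ[ℂ] Matrix Unit Unit ℂ := lift (sat_chi (G := G))

theorem chiRep_w (i j : Fin 2) :
    chiRep (w G.flat i j) = (G.β ^ 2 * (1 : M2) i j) • (1 : Matrix Unit Unit ℂ) := by
  rw [chiRep, lift_w, Matrix.smul_apply, Matrix.one_apply, Matrix.one_apply, mul_smul]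
  split_ifs <;> simp

theorem chiRep_wt (i j : Fin 2) :
    chiRep (wt G.flat i j) = (1 : M2) i j • (1 : Matrix Unit Unit ℂ) := by
  rw [chiRep, lift_wt, Matrix.one_apply, Matrix.one_apply]
  split_ifs <;> simp

/-- Translations by a character are algebra homomorphisms. Together the left and right ones scale
`w` by `β⁴ = 1` and fix `w̃`. -/
theorem lTr_chi_mul_rTr_chi :
    lTr (fe (chiRep (G := G)) () ()) * rTr (fe (chiRep (G := G)) () ()) = 1 := by
  ext z
  rw [Module.End.mul_apply, Module.End.one_apply]
  induction z using induction_V with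
  | h_one => rw [rTr_fe, map_one, Matrix.one_apply_eq, lTr_fe, map_one, Matrix.one_apply_eq]
  | h_smul c x hx => rw [map_smul, map_smul, hx]
  | h_add x y hx hy => rw [map_add, map_add, hx, hy]
  | h_mul x y hx hy =>
    rw [rTr_fe] at hx hy ⊢
    rw [lTr_fe] at hx hy ⊢
    rw [map_mul, Matrix.mul_apply, Fintype.sum_unique, map_mul, Matrix.mul_apply,
      Fintype.sum_unique]
    exact congrArg₂ _ hx hy
  | h_V b i j =>
    rw [rTr_fe, rhoHom_V, map_sum]
    simp only [map_smul, lTr_fe, lamHom_V]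
    cases b
    · simp [chiRep_w, Matrix.one_apply, smul_smul, beta_pow_four]
    · simp [chiRep_wt, Matrix.one_apply]

end

section

variable {G : Data}

/-! ### A representation of `𝒜` on the split algebra -/

theorem transpose_cst_mul {B : Type*} [Ring B] [Algebra ℂ B] {l m n : Type*} [Fintype m]
    (M : Matrix l m ℂ) (K : Matrix m n B) :
    (cst B M * K).transpose = K.transpose * cst B M.transpose := by
  ext p r
  simp only [Matrix.transpose_apply, Matrix.mul_apply, cst, Matrix.map_apply, Algebra.commutes]

theorem transpose_mul_cst {B : Type*} [Ring B] [Algebra ℂ B] {l m n : Type*} [Fintype m]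
    (K : Matrix l m B) (M : Matrix m n ℂ) :
    (K * cst B M).transpose = cst B M.transpose * K.transpose := by
  ext p r
  simp only [Matrix.transpose_apply, Matrix.mul_apply, cst, Matrix.map_apply, Algebra.commutes]

variable (G) in
/-- The linear endomorphisms of the split algebra. -/
abbrev TransEnd : Type := Module.End ℂ (Poly G.flat)

variable (G) in
/-- The operators `z ↦ σ_{im}(z⁽¹⁾) z⁽²⁾`. -/
def lamMat : Matrix (Fin 2) (Fin 2) (TransEnd G) :=
  fun i m => lTr (fe sigmaRep i m)

variable (G) in
/-- The operators `z ↦ z⁽¹⁾ σ'_{jm}(z⁽²⁾)`. -/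
def rhoMat : Matrix (Fin 2) (Fin 2) (TransEnd G) :=
  fun m j => rTr (fe sigmaRep' j m)

section

variable {m n : Type*} [Fintype m] [DecidableEq m] [Fintype n] [DecidableEq n]

/-- The operators `z ↦ F_{ij}(z⁽¹⁾) z⁽²⁾`. -/
def lMat (F : Poly G.flat →ₐ[ℂ] Matrix n n ℂ) : Matrix n n (TransEnd G) :=
  ((fe F).map MulOpposite.op).map lTrHom

/-- The operators `z ↦ z⁽¹⁾ F_{ij}(z⁽²⁾)`, transposed. -/
def rMat (F : Poly G.flat →ₐ[ℂ] Matrix n n ℂ) : Matrix n n (TransEnd G) :=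
  (fe F).transpose.map rTrHom

variable {F : Poly G.flat →ₐ[ℂ] Matrix n n ℂ} {F' : Poly G.flat →ₐ[ℂ] Matrix m m ℂ}
  {N : Matrix m n ℂ}

theorem lMat_mul_cst (h : ∀ b i j, N * F (V G.flat b i j) = F' (V G.flat b i j) * N) :
    lMat F' * cst (TransEnd G) N = cst (TransEnd G) N * lMat F := by
  calc _ = ((fe F').map MulOpposite.op * cst (Fn G.flat)ᵐᵒᵖ N).map lTrHom := by
        rw [map_mul', map_cst]; rfl
    _ = ((fe F' * cst (Fn G.flat) N).map MulOpposite.op).map lTrHom := by rw [map_op_mul_cst]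
    _ = ((cst (Fn G.flat) N * fe F).map MulOpposite.op).map lTrHom := by rw [intertwine h]
    _ = (cst (Fn G.flat)ᵐᵒᵖ N * (fe F).map MulOpposite.op).map lTrHom := by rw [cst_mul_map_op]
    _ = _ := by rw [map_mul', map_cst]; rfl

theorem rMat_mul_cst (h : ∀ b i j, N * F (V G.flat b i j) = F' (V G.flat b i j) * N) :
    rMat F * cst (TransEnd G) N.transpose = cst (TransEnd G) N.transpose * rMat F' := by
  calc _ = ((fe F).transpose * cst (Fn G.flat) N.transpose).map rTrHom := by
        rw [map_mul', map_cst]; rfl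
    _ = (cst (Fn G.flat) N * fe F).transpose.map rTrHom := by rw [transpose_cst_mul]
    _ = (fe F' * cst (Fn G.flat) N).transpose.map rTrHom := by rw [intertwine h]
    _ = (cst (Fn G.flat) N.transpose * (fe F').transpose).map rTrHom := by rw [transpose_mul_cst]
    _ = _ := by rw [map_mul', map_cst]; rfl

end

theorem lamMat_kron : lamMat G ⊗ₖ lamMat G = lMat (sconv sigmaRep (sigmaRep (G := G))) := by
  rw [lMat, fe_sconv, ← kron_op, map_kron]; rfl

theorem rhoMat_kron : rhoMat G ⊗ₖ rhoMat G = rMat (kconv sigmaRep' (sigmaRep' (G := G))) := by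
  rw [rMat, fe_kconv]
  ext1 p r
  rw [Matrix.map_apply, Matrix.transpose_apply, Matrix.kroneckerMap_apply,
    Matrix.kroneckerMap_apply, map_mul]
  rfl

variable (G) in
/-- The operator `z ↦ χ(z⁽¹⁾) z⁽²⁾`, as a `1 × 1`-matrix. -/
def lamChi : Matrix Unit Unit (TransEnd G) :=
  fun _ _ => lTr (fe (chiRep (G := G)) () ())

variable (G) in
/-- The operator `z ↦ z⁽¹⁾ χ(z⁽²⁾)`, as a `1 × 1`-matrix. -/
def rhoChi : Matrix Unit Unit (TransEnd G) :=
  fun _ _ => rTr (fe (chiRep (G := G)) () ())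

theorem lamChi_mul_rhoChi : lamChi G * rhoChi G = 1 := by
  ext1 i j
  rw [Matrix.mul_apply, Fintype.sum_unique, Matrix.one_apply_eq]
  exact lTr_chi_mul_rTr_chi

/-- Left translation preserves `Ẽ` only up to translation by `χ`; this defect is to be cancelled by
the one of right translation. -/
theorem lamMat_col : (lamMat G ⊗ₖ lamMat G) * cst (TransEnd G) G.Et =
    cst (TransEnd G) G.Et * lamChi G := by
  rw [lamMat_kron]
  refine lMat_mul_cst (F := chiRep) fun b i j => ?_
  cases b
  · rw [V_false, sconv_sigma_col, chiRep_w, Matrix.mul_smul, Matrix.mul_one]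
  · rw [V_true, sconv_sigma_wt, chiRep_wt, Matrix.mul_smul, Matrix.mul_one, Matrix.smul_mul,
      Matrix.one_mul]

theorem lamMat_row : cst (TransEnd G) G.Et' * (lamMat G ⊗ₖ lamMat G) =
    lamChi G * cst (TransEnd G) G.Et' := by
  rw [lamMat_kron]
  refine (lMat_mul_cst (F' := chiRep) fun b i j => ?_).symm
  cases b
  · rw [V_false, sconv_sigma_row, chiRep_w, Matrix.smul_mul, Matrix.one_mul]
  · rw [V_true, sconv_sigma_wt, chiRep_wt, Matrix.mul_smul, Matrix.mul_one, Matrix.smul_mul,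
      Matrix.one_mul]

theorem rhoMat_col : (rhoMat G ⊗ₖ rhoMat G) * cst (TransEnd G) G.Et =
    cst (TransEnd G) G.Et * rhoChi G := by
  rw [rhoMat_kron]
  refine rMat_mul_cst (F' := chiRep) (N := G.Et.transpose) fun b i j => ?_
  cases b
  · rw [V_false, kconv_sigma_col, beta_sq_inv, chiRep_w, Matrix.smul_mul, Matrix.one_mul]
  · rw [V_true, kconv_sigma_wt, chiRep_wt, Matrix.mul_smul, Matrix.mul_one, Matrix.smul_mul,
      Matrix.one_mul]

theorem rhoMat_row : cst (TransEnd G) G.Et' * (rhoMat G ⊗ₖ rhoMat G) =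
    rhoChi G * cst (TransEnd G) G.Et' := by
  rw [rhoMat_kron]
  refine (rMat_mul_cst (F := chiRep) (N := G.Et'.transpose) fun b i j => ?_).symm
  cases b
  · rw [V_false, kconv_sigma_row, beta_sq_inv, chiRep_w, Matrix.mul_smul, Matrix.mul_one]
  · rw [V_true, kconv_sigma_wt, chiRep_wt, Matrix.mul_smul, Matrix.mul_one, Matrix.smul_mul,
      Matrix.one_mul]

theorem cst_mul_end_apply {l n : Type*} {m : Type*} [Fintype m] (N : Matrix l m ℂ)
    (K : Matrix m n (TransEnd G)) (p : l) (r : n) (z : Poly G.flat) :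
    (cst (TransEnd G) N * K) p r z = ∑ q, N p q • K q r z := by
  rw [Matrix.mul_apply, LinearMap.sum_apply]
  rfl

theorem mul_cst_end_apply {l n : Type*} {m : Type*} [Fintype m] (K : Matrix l m (TransEnd G))
    (N : Matrix m n ℂ) (p : l) (r : n) (z : Poly G.flat) :
    (K * cst (TransEnd G) N) p r z = ∑ q, N q r • K p q z := by
  rw [Matrix.mul_apply, LinearMap.sum_apply]
  refine Finset.sum_congr rfl fun q _ => ?_
  exact map_smul (K p q) (N q r) z

/-- Translation by a representation is multiplicative, so moving it past left multiplication by `w`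
costs its value on `w`, namely `X`. For `rhoMat` the cost is `X⁻¹`. -/
theorem lamMat_w_mul (i m j k : Fin 2) (y : Poly G.flat) :
    lamMat G i m (w G.flat j k * y) =
      ∑ p, ∑ n, G.X (i, j) (p, n) • (w G.flat p k * lamMat G n m y) := by
  simp only [lamMat, lTr_fe, map_mul, Matrix.mul_apply]
  rw [Finset.sum_comm]
  refine Finset.sum_congr rfl fun n _ => ?_
  rw [show w G.flat j k = V G.flat false j k from rfl, lamHom_V]
  simp only [V_false, sigmaRep_w, Finset.sum_mul, smul_mul_assoc]

theorem rhoMat_w_mul (m a j b : Fin 2) (z : Poly G.flat) :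
    rhoMat G m a (w G.flat j b * z) =
      ∑ p, ∑ c, G.X⁻¹ (p, c) (a, b) • (w G.flat j p * rhoMat G m c z) := by
  simp only [rhoMat, rTr_fe, map_mul, Matrix.mul_apply]
  rw [Finset.sum_comm]
  refine Finset.sum_congr rfl fun n _ => ?_
  rw [show w G.flat j b = V G.flat false j b from rfl, rhoHom_V]
  simp only [V_false, sigmaRep'_w, Finset.sum_mul, smul_mul_assoc]

theorem sum_rhoMat_w_mul (m j k l : Fin 2) (z : Poly G.flat) :
    ∑ a, ∑ b, G.X (a, b) (k, l) • rhoMat G m a (w G.flat j b * z) =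
      w G.flat j k * rhoMat G m l z := by
  simp only [rhoMat_w_mul]
  have h : ∀ p c, ∑ a, ∑ b, G.X⁻¹ (p, c) (a, b) * G.X (a, b) (k, l) =
      (1 : Matrix I2 I2 ℂ) (p, c) (k, l) := by
    intro p c
    rw [← inv_mul_X, Matrix.mul_apply, Fintype.sum_prod_type]
  calc _ = ∑ p, ∑ c, (∑ a, ∑ b, G.X⁻¹ (p, c) (a, b) * G.X (a, b) (k, l)) •
        (w G.flat j p * rhoMat G m c z) := by
        simp only [Fin.sum_univ_two, smul_add, smul_smul, add_smul, mul_comm (G.X⁻¹ _ _)]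
        abel
    _ = _ := by
        simp only [h]
        fin_cases k <;> fin_cases l <;> simp [Matrix.one_apply]

variable (G) in
/-- Left multiplication by `w`. -/
def mulW : Matrix (Fin 2) (Fin 2) (TransEnd G) :=
  (w G.flat).map (Algebra.lmul ℂ (Poly G.flat))

theorem mulW_apply (i j : Fin 2) (z : Poly G.flat) : mulW G i j z = w G.flat i j * z := rfl

/-- Left and right translations commute, so tensor squares split and the two `χ`-defects on `Ẽ`
cancel. In the `X` relation, the `X` from moving the left translation past `w` stands on one side,
and the `X⁻¹` from the right translation is absorbed by the `X` on the other. -/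
theorem sat_twist : Sat G (mulW G) (lamMat G * rhoMat G) := by
  have hk := kron_mul (lamMat G) (rhoMat G) (lamMat G) (rhoMat G)
    fun i j k l => (commute_lTr_rTr _ _).symm
  constructor
  · exact ((sat_w G.flat).map G.flat (Algebra.lmul ℂ (Poly G.flat))).E
  · rw [hk, Matrix.mul_assoc, rhoMat_col, ← Matrix.mul_assoc, lamMat_col, Matrix.mul_assoc,
      lamChi_mul_rhoChi, Matrix.mul_one]
  · exact ((sat_w G.flat).map G.flat (Algebra.lmul ℂ (Poly G.flat))).E'
  · rw [hk, ← Matrix.mul_assoc, lamMat_row, Matrix.mul_assoc, rhoMat_row, ← Matrix.mul_assoc,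
      lamChi_mul_rhoChi, Matrix.one_mul]
  · ext1 ⟨i, j⟩ ⟨k, l⟩
    ext1 z
    have h : ∀ m, lamMat G i m (w G.flat j k * rhoMat G m l z) =
        ∑ a, ∑ b, G.X (a, b) (k, l) • lamMat G i m (rhoMat G m a (w G.flat j b * z)) := by
      intro m
      rw [← sum_rhoMat_w_mul]
      simp only [map_sum, map_smul]
    calc _ = ∑ m, lamMat G i m (w G.flat j k * rhoMat G m l z) := by
          rw [cst_mul_end_apply]
          simp only [lamMat_w_mul, Fintype.sum_prod_type, Matrix.kroneckerMap_apply,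
            Module.End.mul_apply, mulW_apply, Matrix.mul_apply, LinearMap.add_apply,
            Fin.sum_univ_two, mul_add, smul_add]
          abel
      _ = _ := by
          rw [mul_cst_end_apply]
          simp only [h, Fintype.sum_prod_type, Matrix.kroneckerMap_apply,
            Module.End.mul_apply, mulW_apply, Matrix.mul_apply, LinearMap.add_apply,
            Fin.sum_univ_two, smul_add]
          abel

/-- A representation of `𝒜` on the split algebra. -/
def twistRep : Poly G →ₐ[ℂ] TransEnd G := lift sat_twist

/-- The action of `𝒜` on the unit of the split algebra. -/
def evOne : Poly G →ₗ[ℂ] Poly G.flat :=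
  LinearMap.applyₗ (1 : Poly G.flat) ∘ₗ (twistRep (G := G)).toLinearMap

theorem evOne_apply (x : Poly G) : evOne x = twistRep x 1 := rfl

/-- Compatibility with left multiplication by `w` is all that is required of `evOne`, since `w` is
the first factor in both `w ⊗ w` and `w ⊗ w̃`. -/
theorem evOne_w_mul (i j : Fin 2) (x : Poly G) :
    evOne (w G i j * x) = w G.flat i j * evOne x := by
  rw [evOne_apply, map_mul, Module.End.mul_apply, twistRep, lift_w, mulW_apply]; rfl

theorem evOne_one : evOne (1 : Poly G) = 1 := by
  rw [evOne_apply, map_one (twistRep (G := G)), Module.End.one_apply]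

theorem evOne_w (i j : Fin 2) : evOne (w G i j) = w G.flat i j := by
  rw [← mul_one (w G i j), evOne_w_mul, evOne_one, mul_one]

/-- Translations by representations act on the unit through the identity matrix, so `w̃` becomes
trivial. -/
theorem evOne_wt (i j : Fin 2) : evOne (wt G i j) = (1 : Matrix _ _ (Poly G.flat)) i j := by
  rw [evOne_apply, twistRep, lift_wt, Matrix.mul_apply]
  simp only [LinearMap.sum_apply, Module.End.mul_apply, rhoMat, rTr_fe, map_one]
  have h : ∀ m : Fin 2, lamMat G i m ((1 : Matrix (Fin 2) (Fin 2) (Poly G.flat)) j m) =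
      (1 : Matrix _ _ (Poly G.flat)) j m * (1 : Matrix _ _ (Poly G.flat)) i m := by
    intro m
    by_cases hjm : j = m
    · rw [hjm, Matrix.one_apply_eq, one_mul, lamMat, lTr_fe, map_one]
    · rw [Matrix.one_apply_ne hjm, map_zero, zero_mul]
  simp only [h]
  fin_cases i <;> fin_cases j <;> simp [Matrix.one_apply]

theorem map_evOne_cst_mul {m n : Type*} [Fintype m] (N : Matrix n m ℂ) (K : Matrix m n (Poly G)) :
    (cst (Poly G) N * K).map evOne = cst (Poly G.flat) N * K.map evOne := by
  ext p r
  simp [Matrix.mul_apply, cst, Algebra.algebraMap_eq_smul_one]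

theorem map_evOne_mul_cst {m n : Type*} [Fintype m] (K : Matrix n m (Poly G)) (N : Matrix m n ℂ) :
    (K * cst (Poly G) N).map evOne = K.map evOne * cst (Poly G.flat) N := by
  ext p r
  simp [Matrix.mul_apply, cst, Algebra.algebraMap_eq_smul_one]

/-- Intertwiners of `w ⊗ w`, in the split algebra. -/
theorem commute_flat_w_w {N : Matrix I2 I2 ℂ}
    (h : cst _ N * (w G ⊗ₖ w G) = (w G ⊗ₖ w G) * cst _ N) :
    cst _ N * (w G.flat ⊗ₖ w G.flat) = (w G.flat ⊗ₖ w G.flat) * cst _ N := by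
  have hw : (w G ⊗ₖ w G).map evOne = w G.flat ⊗ₖ w G.flat := by
    ext p r
    rw [Matrix.map_apply, Matrix.kroneckerMap_apply, evOne_w_mul, evOne_w]; rfl
  have h2 := congrArg (fun M => M.map evOne) h
  simpa only [map_evOne_cst_mul, map_evOne_mul_cst, hw] using h2

/-- Intertwiners of `w ⊗ w̃`, in the split algebra. -/
theorem commute_flat_w_wt {N : Matrix I2 I2 ℂ}
    (h : cst _ N * (w G ⊗ₖ wt G) = (w G ⊗ₖ wt G) * cst _ N) :
    cst _ N * (w G.flat ⊗ₖ 1) = (w G.flat ⊗ₖ 1) * cst _ N := by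
  have hw : (w G ⊗ₖ wt G).map evOne = w G.flat ⊗ₖ 1 := by
    ext p r
    rw [Matrix.map_apply, Matrix.kroneckerMap_apply, evOne_w_mul, evOne_wt]; rfl
  have h2 := congrArg (fun M => M.map evOne) h
  simpa only [map_evOne_cst_mul, map_evOne_mul_cst, hw] using h2

/-- In the split algebra `w` can be specialised to any `W` over `M₂(ℂ)` preserving `E`, with `w̃ ↦
1`. For the original `X` such a specialisation need not exist, hence the detour. -/
theorem commute_M2_w_w {N : Matrix I2 I2 ℂ}
    (h : cst _ N * (w G ⊗ₖ w G) = (w G ⊗ₖ w G) * cst _ N) {W : Matrix (Fin 2) (Fin 2) M2}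
    (hW : (W ⊗ₖ W) * cst M2 G.E = cst M2 G.E) :
    cst _ N * (W ⊗ₖ W) = (W ⊗ₖ W) * cst _ N := by
  have h2 := congrArg (fun M => M.map (lift (sat_flat hW))) (commute_flat_w_w h)
  have hw : (w G.flat).map (lift (sat_flat hW)) = W := by ext1 i j; exact lift_w _ i j
  simpa only [map_mul', map_cst, map_kron, hw] using h2

theorem commute_M2_w_wt {N : Matrix I2 I2 ℂ}
    (h : cst _ N * (w G ⊗ₖ wt G) = (w G ⊗ₖ wt G) * cst _ N) {W : Matrix (Fin 2) (Fin 2) M2}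
    (hW : (W ⊗ₖ W) * cst M2 G.E = cst M2 G.E) :
    cst _ N * (W ⊗ₖ 1) = (W ⊗ₖ 1) * cst _ N := by
  have h2 := congrArg (fun M => M.map (lift (sat_flat hW))) (commute_flat_w_wt h)
  have hw : (w G.flat).map (lift (sat_flat hW)) = W := by ext1 i j; exact lift_w _ i j
  have h1 : (1 : Matrix (Fin 2) (Fin 2) (Poly G.flat)).map (lift (sat_flat hW)) = 1 := by
    ext1 i j; rw [Matrix.map_apply, Matrix.one_apply, Matrix.one_apply]; split_ifs <;> simp
  simpa only [map_mul', map_cst, map_kron, hw, h1] using h2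

end

section

variable {G : Data}

/-! ### Commutants -/

/-- A family of upper triangular representations of the algebra of `[[s, t⁻¹], [-t, 0]]`. -/
def triRep (t s b c : ℂ) : Matrix (Fin 2) (Fin 2) M2 :=
  !![!![t, 0; 0, t⁻¹], !![s, b; 0, -s]; !![0, c; 0, 0], !![t⁻¹, 0; 0, t]]

/-- The form `[[s, t⁻¹], [-t, 0]]`. -/
def triCol (t s : ℂ) : Matrix I2 Unit ℂ := fun p _ => !![s, t⁻¹; -t, 0] p.1 p.2

/-- The inverse of the form `[[s, t⁻¹], [-t, 0]]`. -/
def triRow (t s : ℂ) : Matrix Unit I2 ℂ := fun _ p => !![0, -t⁻¹; t, s] p.1 p.2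

/-- The diagonal coefficients of `triRep` are `g = [[t, s], [0, t⁻¹]]` and `g⁻¹`, the upper
off-diagonal one is `f = [[0, b], [c, 0]]`. The tensor square then has off-diagonal coefficient `g ⊗
f + f ⊗ g⁻¹`, as for the raising and lowering operators of a quantum `sl₂`. -/
theorem triRep_col {t : ℂ} (ht : t ≠ 0) (s b c : ℂ) :
    (triRep t s b c ⊗ₖ triRep t s b c) * cst M2 (triCol t s) = cst M2 (triCol t s) := by
  ext ⟨i, j⟩ u m n
  rw [mul_cst_apply, cst_matrix_apply]
  fin_cases i <;> fin_cases j <;> fin_cases m <;> fin_cases n <;>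
    simp [Fintype.sum_prod_type, triRep, triCol] <;> field_simp <;> ring

/-- The coefficients of `triRep ⊗ triRep` off the diagonal. -/
def triOff (t s b c : ℂ) : Matrix I2 I2 ℂ :=
  fun p r => (triRep t s b c ⊗ₖ triRep t s b c) p r 0 1

/-- Commuting with the raising and lowering operators is a linear system for the sixteen entries of
`N`. Dividing by `t⁴ + 1` at three places leaves two free entries. -/
theorem commutant_tri {N : Matrix I2 I2 ℂ} {t s : ℂ} (ht : t ≠ 0) (h4 : t ^ 4 + 1 ≠ 0)
    (hE : N * triOff t s 1 0 = triOff t s 1 0 * N)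
    (hF : N * triOff t s 0 1 = triOff t s 0 1 * N) :
    ∃ x y : ℂ, N = x • 1 + y • (triCol t s * triRow t s) := by
  have eE := fun i j => congrFun (congrFun hE i) j
  have eF := fun i j => congrFun (congrFun hF i) j
  simp only [Matrix.mul_apply, Fintype.sum_prod_type, Fin.sum_univ_two, triOff, triRep,
    Matrix.kroneckerMap_apply] at eE eF
  have a1 := eE (0, 0) (0, 0)
  have a2 := eE (0, 1) (0, 0)
  have a3 := eE (0, 0) (0, 1)
  have a4 := eE (0, 1) (0, 1)
  have a5 := eE (1, 0) (0, 1)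
  have a6 := eE (0, 0) (1, 0)
  have a7 := eE (0, 1) (1, 0)
  have a8 := eE (0, 1) (1, 1)
  have a9 := eE (1, 0) (1, 1)
  have b1 := eF (0, 0) (0, 0)
  have b2 := eF (0, 0) (0, 1)
  have b3 := eF (0, 1) (0, 1)
  have b4 := eF (0, 1) (1, 0)
  have b5 := eF (1, 1) (1, 1)
  clear eE eF hE hF
  simp at a1 a2 a3 a4 a5 a6 a7 a8 a9 b1 b2 b3 b4 b5
  have hT : t * t⁻¹ = 1 := mul_inv_cancel₀ ht
  obtain ⟨T, hTe⟩ : ∃ T, t⁻¹ = T := ⟨_, rfl⟩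
  rw [hTe] at a1 a3 a5 a6 a7 a8 a9 b1 b4 b5 hT
  have n30 : N (1, 1) (0, 0) = 0 := a2.resolve_left ht
  have n20 : N (1, 0) (0, 0) = 0 := by
    refine (mul_eq_zero.mp (?_ : (t ^ 4 + 1) * _ = 0)).resolve_left h4
    linear_combination -t * a1 - (N (1, 0) (0, 0)) * hT + t ^ 3 * a5 - t * a4 +
      t * t * (N (1, 1) (0, 1)) * hT
  have n10 : N (0, 1) (0, 0) = 0 := by
    refine (mul_eq_zero.mp (?_ : t * _ = 0)).resolve_left ht
    linear_combination -a1 - T * n20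
  have n31 : N (1, 1) (0, 1) = 0 := by
    refine (mul_eq_zero.mp (?_ : t * _ = 0)).resolve_left ht
    linear_combination -a4 + t * n10
  have n32 : N (1, 1) (1, 0) = 0 := by
    refine (mul_eq_zero.mp (?_ : t * _ = 0)).resolve_left ht
    linear_combination -a7 + T * n10
  -- The product `triCol * triRow` has entry `1` at this position and `0` at `(0,0),(0,0)`. Hence
  -- `m` and `α` must be the coefficients of this product and of the identity.
  obtain ⟨m, hm⟩ : ∃ m, N (0, 1) (1, 0) = m := ⟨_, rfl⟩
  obtain ⟨α, hα⟩ : ∃ α, N (0, 0) (0, 0) = α := ⟨_, rfl⟩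
  have n11 : N (0, 1) (0, 1) = α - T ^ 2 * N (1, 0) (0, 1) := by
    linear_combination (-T) * a3 + (α - N (0, 1) (0, 1)) * hT + t * T * hα
  have n22 : N (1, 0) (1, 0) = α - t ^ 2 * m := by
    linear_combination (-t) * a6 + (α - N (1, 0) (1, 0)) * hT - t ^ 2 * hm + t * T * hα
  have n21 : N (1, 0) (0, 1) = m := by
    refine sub_eq_zero.mp ((mul_eq_zero.mp (?_ : (t ^ 4 + 1) * _ = 0)).resolve_left h4)
    rw [n11, hm] at a8
    rw [n22] at a9
    linear_combination -t ^ 2 * (T * a8 - t * a9) - (N (1, 0) (0, 1) * (t ^ 2 * T ^ 2 + t * T + 1) -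
      m * (t * T + 1) - t ^ 4 * m) * hT
  have n33 : N (1, 1) (1, 1) = α := by
    rw [n11, n21, hm] at a8
    linear_combination -T * a8 - (N (1, 1) (1, 1) - α + m * T ^ 2) * hT
  have n02 : N (0, 0) (1, 0) = -t ^ 2 * N (0, 0) (0, 1) := by
    linear_combination t * b1 - N (0, 0) (1, 0) * hT
  have n13 : N (0, 1) (1, 1) = N (0, 0) (0, 1) + 2 * s * m * T := by
    rw [n21, hm] at b3
    linear_combination T * b3 + (N (0, 0) (0, 1) - N (0, 1) (1, 1)) * hT
  have n01 : N (0, 0) (0, 1) = -s * T * m := by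
    refine sub_eq_zero.mp ((mul_eq_zero.mp (?_ : (t ^ 4 + 1) * _ = 0)).resolve_left h4)
    rw [n11, n22, n21, n02, n13] at b4
    linear_combination t * b4 + (-N (0, 0) (0, 1) - s * m * T + s * m * t ^ 3) * hT
  have n03 : N (0, 0) (1, 1) = s ^ 2 * m := by
    rw [n02, n01] at b2
    linear_combination T * b2 + (-N (0, 0) (1, 1) + s ^ 2 * m * (t * T + 1)) * hT
  have n23 : N (1, 0) (1, 1) = -t * s * m := by
    rw [n13, n01] at b5
    linear_combination -t * b5 + (-N (1, 0) (1, 1) - t * s * m) * hT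
  refine ⟨α, m, ?_⟩
  ext ⟨i, j⟩ ⟨k, l⟩
  fin_cases i <;> fin_cases j <;> fin_cases k <;> fin_cases l <;>
    simp [triCol, triRow, Matrix.mul_apply, *] <;>
    first | ring1 | linear_combination (s * t * m) * hT | linear_combination (-m) * hT

theorem exists_isotropic (E : Matrix I2 Unit ℂ) :
    ∃ p P : M2, P * p = 1 ∧ ((P ⊗ₖ P) * E) (1, 1) () = 0 := by
  by_cases h : E (1, 1) () = 0
  · exact ⟨1, 1, Matrix.one_mul 1, by simpa using h⟩
  · obtain ⟨d, hd⟩ := IsAlgClosed.exists_pow_nat_eq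
      ((E (0, 1) () + E (1, 0) ()) ^ 2 - 4 * E (0, 0) () * E (1, 1) ()) (n := 2) two_pos
    -- The quadratic formula for `E₀₀ + (E₀₁ + E₁₀)x + E₁₁x² = 0`, so that `(1, x)` is isotropic.
    obtain ⟨x, hx⟩ : ∃ x, x * (2 * E (1, 1) ()) = d - (E (0, 1) () + E (1, 0) ()) :=
      ⟨_, div_mul_cancel₀ _ (mul_ne_zero two_ne_zero h)⟩
    refine ⟨!![-x, 1; 1, 0], !![0, 1; 1, x], ?_, ?_⟩
    · ext i j; fin_cases i <;> fin_cases j <;> simp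
    · simp only [Matrix.mul_apply, Fintype.sum_prod_type, Fin.sum_univ_two,
        Matrix.kroneckerMap_apply, Matrix.of_apply, Matrix.cons_val', Matrix.cons_val_zero,
        Matrix.cons_val_one, Matrix.cons_val_fin_one]
      refine (mul_eq_zero.mp (?_ : 4 * E (1, 1) () * _ = 0)).resolve_left
        (mul_ne_zero (by norm_num) h)
      linear_combination (x * (2 * E (1, 1) ()) + d + (E (0, 1) () + E (1, 0) ())) * hx + hd

/-- A form with an isotropic vector, in normal form. -/
theorem exists_tri {e : Matrix I2 Unit ℂ} {e' : Matrix Unit I2 ℂ} (he : sqR e' * sqL e = 1)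
    (h0 : e (1, 1) () = 0) : ∃ δ t s : ℂ, t ≠ 0 ∧ e = δ • triCol t s ∧ triRow t s = δ • e' := by
  have h00 := congrFun (congrFun he 0) 0
  have h01 := congrFun (congrFun he 0) 1
  have h10 := congrFun (congrFun he 1) 0
  have h11 := congrFun (congrFun he 1) 1
  simp [Matrix.mul_apply, sqR, sqL, h0] at h00 h01 h10 h11
  -- After division by `δ` the antidiagonal entries must be `t⁻¹` and `-t`, with product `-1`; this
  -- fixes `δ²`.
  obtain ⟨δ, hδ⟩ := IsAlgClosed.exists_pow_nat_eq (-(e (0, 1) () * e (1, 0) ())) (n := 2) two_pos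
  have e01 : e (0, 1) () ≠ 0 := right_ne_zero_of_mul_eq_one h11
  have f00 : e' () (0, 0) = 0 := h01.resolve_right e01
  rw [f00, zero_mul, zero_add] at h00
  have e10 : e (1, 0) () ≠ 0 := right_ne_zero_of_mul_eq_one h00
  have hδ0 : δ ≠ 0 := by
    rintro rfl
    exact mul_ne_zero e01 e10 (by linear_combination hδ)
  have f11 : e' () (1, 1) * δ ^ 2 = e (0, 0) () := by
    rw [hδ]
    linear_combination (-e (0, 1) ()) * h10 + e (0, 0) () * h11
  refine ⟨δ, -e (1, 0) () / δ, e (0, 0) () / δ, div_ne_zero (neg_ne_zero.mpr e10) hδ0, ?_, ?_⟩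
  · ext ⟨i, j⟩ u
    fin_cases i <;> fin_cases j <;> simp [triCol, h0] <;> field_simp
    linear_combination hδ
  · ext u ⟨i, j⟩
    fin_cases i <;> fin_cases j <;> simp [triRow, f00] <;> field_simp
    · linear_combination -h00
    · linear_combination e (1, 0) () * h11 - e' () (1, 0) * hδ
    · linear_combination -f11

theorem cst_kron_cst {B : Type*} [Ring B] [Algebra ℂ B] (p q p' q' : M2)
    (W W' : Matrix (Fin 2) (Fin 2) B) :
    (cst B p * W * cst B p') ⊗ₖ (cst B q * W' * cst B q') =
      cst B (p ⊗ₖ q) * (W ⊗ₖ W') * cst B (p' ⊗ₖ q') := by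
  have h : cst B (p ⊗ₖ q) = cst B p ⊗ₖ cst B q := by ext; simp [cst]
  have h' : cst B (p' ⊗ₖ q') = cst B p' ⊗ₖ cst B q' := by ext; simp [cst]
  rw [h, h', kron_mul, kron_mul]
  · intro i j k l; exact Algebra.commute_algebraMap_right _ _
  · intro i j k l; exact Algebra.commute_algebraMap_left _ _

/-- An isotropic vector exists over `ℂ`. Taking it into the basis brings the form to triangular
shape, and conjugating `triRep` back gives representations preserving the original form. -/
theorem exists_tri_conj {E : Matrix I2 Unit ℂ} {E' : Matrix Unit I2 ℂ} (hE : sqR E' * sqL E = 1) :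
    ∃ (p P : M2) (δ t s : ℂ), P * p = 1 ∧ t ≠ 0 ∧ (P ⊗ₖ P) * E = δ • triCol t s ∧
      triRow t s = δ • (E' * (p ⊗ₖ p)) ∧ ∀ b c,
        ((cst M2 p * triRep t s b c * cst M2 P) ⊗ₖ (cst M2 p * triRep t s b c * cst M2 P)) *
          cst M2 E = cst M2 E := by
  obtain ⟨p, P, hPp, h0⟩ := exists_isotropic E
  have hpP : p * P = 1 := mul_eq_one_comm.mp hPp
  have kpP : (p ⊗ₖ p) * (P ⊗ₖ P) = 1 := by
    rw [← Matrix.mul_kronecker_mul, hpP, Matrix.one_kronecker_one]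
  have hL : sqL ((P ⊗ₖ P) * E) = P * sqL E * P.transpose := by
    ext i j
    simp [sqL, Matrix.mul_apply, Fintype.sum_prod_type]; ring
  have hR : sqR (E' * (p ⊗ₖ p)) = p.transpose * sqR E' * p := by
    ext i j
    simp [sqR, Matrix.mul_apply, Fintype.sum_prod_type]; ring
  have he : sqR (E' * (p ⊗ₖ p)) * sqL ((P ⊗ₖ P) * E) = 1 := by
    rw [hL, hR, Matrix.mul_assoc, Matrix.mul_assoc, Matrix.mul_assoc P, ← Matrix.mul_assoc p P,
      hpP, Matrix.one_mul, ← Matrix.mul_assoc (sqR E'), hE, Matrix.one_mul,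
      ← Matrix.transpose_mul, hPp, Matrix.transpose_one]
  obtain ⟨δ, t, s, ht, he1, he2⟩ := exists_tri he h0
  refine ⟨p, P, δ, t, s, hPp, ht, he1, he2, fun b c => ?_⟩
  have h3 : cst M2 (δ • triCol t s) = δ • cst M2 (triCol t s) := by
    ext1 i j; simp [cst, Algebra.smul_def]
  rw [cst_kron_cst, Matrix.mul_assoc, ← cst_mul, he1, Matrix.mul_assoc, h3, Matrix.mul_smul,
    triRep_col ht, ← h3, ← he1, ← cst_mul, ← Matrix.mul_assoc, kpP, Matrix.one_mul]

/-- After undoing the change of basis, a commutation relation over `M₂(ℂ)` is compared coefficient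
by coefficient. -/
theorem conj_commute {p P : M2} (hPp : P * p = 1) {N : Matrix I2 I2 ℂ}
    {T : Matrix I2 I2 M2}
    (h : cst M2 N * (cst M2 (p ⊗ₖ p) * T * cst M2 (P ⊗ₖ P)) =
      cst M2 (p ⊗ₖ p) * T * cst M2 (P ⊗ₖ P) * cst M2 N) (i j : Fin 2) :
    ((P ⊗ₖ P) * N * (p ⊗ₖ p)) * (Matrix.of fun a b => T a b i j) =
      (Matrix.of fun a b => T a b i j) * ((P ⊗ₖ P) * N * (p ⊗ₖ p)) := by
  have kPp : (P ⊗ₖ P) * (p ⊗ₖ p) = 1 := by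
    rw [← Matrix.mul_kronecker_mul, hPp, Matrix.one_kronecker_one]
  have h2 := congrArg (fun M => cst M2 (P ⊗ₖ P) * M * cst M2 (p ⊗ₖ p)) h
  simp only [Matrix.mul_assoc] at h2
  rw [← cst_mul (P ⊗ₖ P) (p ⊗ₖ p), kPp, cst_one, Matrix.mul_one,
    ← Matrix.mul_assoc (cst M2 (P ⊗ₖ P)) (cst M2 (p ⊗ₖ p)),
    ← cst_mul (P ⊗ₖ P) (p ⊗ₖ p), kPp, cst_one, Matrix.one_mul] at h2
  have h3 : cst M2 ((P ⊗ₖ P) * N * (p ⊗ₖ p)) * T = T * cst M2 ((P ⊗ₖ P) * N * (p ⊗ₖ p)) := by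
    simpa only [cst_mul, Matrix.mul_assoc] using h2
  ext a r
  have := congrFun (congrFun (congrFun (congrFun h3 a) r) i) j
  rwa [cst_mul_apply, mul_cst_apply] at this

theorem commutant_M2 {E : Matrix I2 Unit ℂ} {E' : Matrix Unit I2 ℂ} (hE : sqR E' * sqL E = 1)
    (hD : E' * E ≠ 0) {N : Matrix I2 I2 ℂ}
    (h : ∀ W : Matrix (Fin 2) (Fin 2) M2, (W ⊗ₖ W) * cst M2 E = cst M2 E →
      cst M2 N * (W ⊗ₖ W) = (W ⊗ₖ W) * cst M2 N) :
    ∃ x y : ℂ, N = x • 1 + y • (E * E') := by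
  obtain ⟨p, P, δ, t, s, hPp, ht, he1, he2, hW⟩ := exists_tri_conj hE
  have kpP : (p ⊗ₖ p) * (P ⊗ₖ P) = 1 := by
    rw [← Matrix.mul_kronecker_mul, mul_eq_one_comm.mp hPp, Matrix.one_kronecker_one]
  -- The loop value does not depend on the basis, and in normal form it is `-(t² + t⁻²)`.
  have h4 : t ^ 4 + 1 ≠ 0 := by
    intro h4
    apply hD
    have h1 : triRow t s * triCol t s = E' * E := by
      rw [he2, Matrix.smul_mul, ← Matrix.mul_smul, ← he1, Matrix.mul_assoc,
        ← Matrix.mul_assoc (p ⊗ₖ p), kpP, Matrix.one_mul]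
    rw [← h1]
    ext u v
    simp [triRow, triCol, Matrix.mul_apply, Fintype.sum_prod_type]
    field_simp
    linear_combination -h4
  have hoff : ∀ b c, ((P ⊗ₖ P) * N * (p ⊗ₖ p)) * triOff t s b c =
      triOff t s b c * ((P ⊗ₖ P) * N * (p ⊗ₖ p)) := by
    intro b c
    have h2 := h _ (hW b c)
    rw [cst_kron_cst] at h2
    exact conj_commute hPp h2 0 1
  obtain ⟨x, y, hxy⟩ := commutant_tri ht h4 (hoff 1 0) (hoff 0 1)
  refine ⟨x, y, ?_⟩
  have h5 := congrArg (fun M => (p ⊗ₖ p) * M * (P ⊗ₖ P)) hxy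
  rw [he2, Matrix.mul_smul, ← Matrix.smul_mul, ← he1] at h5
  simp only [Matrix.mul_assoc, Matrix.mul_add, Matrix.add_mul, Matrix.mul_smul, Matrix.smul_mul,
    kpP, Matrix.mul_one] at h5
  rw [← Matrix.mul_assoc (p ⊗ₖ p) (P ⊗ₖ P), ← Matrix.mul_assoc (p ⊗ₖ p) (P ⊗ₖ P), kpP,
    Matrix.one_mul, Matrix.one_mul] at h5
  exact h5

theorem eq_one_kron {N : Matrix I2 I2 ℂ}
    (hE : N * ((!![0, 1; 0, 0] : M2) ⊗ₖ (1 : M2)) = ((!![0, 1; 0, 0] : M2) ⊗ₖ (1 : M2)) * N)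
    (hF : N * ((!![0, 0; 1, 0] : M2) ⊗ₖ (1 : M2)) = ((!![0, 0; 1, 0] : M2) ⊗ₖ (1 : M2)) * N) :
    ∃ M : M2, N = (1 : M2) ⊗ₖ M := by
  refine ⟨Matrix.of fun j l => N (0, j) (0, l), ?_⟩
  ext ⟨i, j⟩ ⟨k, l⟩
  have h1 := congrFun (congrFun hE (0, j)) (1, l)
  have h2 := congrFun (congrFun hE (1, j)) (1, l)
  have h3 := congrFun (congrFun hF (0, j)) (0, l)
  simp [Matrix.mul_apply, Fintype.sum_prod_type, Matrix.one_apply] at h1 h2 h3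
  fin_cases i <;> fin_cases k <;> simp [h1, h2, h3]

/-- The off-diagonal coefficient of `W ⊗ 1` is `f ⊗ 1`, and varying `b`, `c` gives the two
off-diagonal matrix units, which generate `M₂(ℂ) ⊗ 1`. The nondegeneracy `t⁴ + 1 ≠ 0` plays no role
here. -/
theorem commutant_M2_one {E : Matrix I2 Unit ℂ} {E' : Matrix Unit I2 ℂ} (hE : sqR E' * sqL E = 1)
    {N : Matrix I2 I2 ℂ}
    (h : ∀ W : Matrix (Fin 2) (Fin 2) M2, (W ⊗ₖ W) * cst M2 E = cst M2 E →
      cst M2 N * (W ⊗ₖ 1) = (W ⊗ₖ 1) * cst M2 N) :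
    ∃ M : M2, N = (1 : M2) ⊗ₖ M := by
  obtain ⟨p, P, δ, t, s, hPp, ht, he1, he2, hW⟩ := exists_tri_conj hE
  have hpP := mul_eq_one_comm.mp hPp
  have kpP : (p ⊗ₖ p) * (P ⊗ₖ P) = 1 := by
    rw [← Matrix.mul_kronecker_mul, hpP, Matrix.one_kronecker_one]
  have hone : (1 : Matrix (Fin 2) (Fin 2) M2) = cst M2 p * 1 * cst M2 P := by
    rw [Matrix.mul_one, ← cst_mul, hpP, cst_one]
  have hc : ∀ b c, ((P ⊗ₖ P) * N * (p ⊗ₖ p)) * ((!![0, b; c, 0] : M2) ⊗ₖ (1 : M2)) =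
      ((!![0, b; c, 0] : M2) ⊗ₖ (1 : M2)) * ((P ⊗ₖ P) * N * (p ⊗ₖ p)) := by
    intro b c
    have h2 := h _ (hW b c)
    rw [hone, cst_kron_cst] at h2
    have h3 := conj_commute hPp h2 0 1
    have h4 : (Matrix.of fun x y => (triRep t s b c ⊗ₖ (1 : Matrix (Fin 2) (Fin 2) M2)) x y 0 1) =
        (!![0, b; c, 0] : M2) ⊗ₖ (1 : M2) := by
      ext ⟨i, j⟩ ⟨k, l⟩
      fin_cases i <;> fin_cases j <;> fin_cases k <;> fin_cases l <;> simp [triRep]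
    rwa [h4] at h3
  obtain ⟨M, hM⟩ := eq_one_kron (hc 1 0) (hc 0 1)
  refine ⟨p * M * P, ?_⟩
  have h5 := congrArg (fun M => (p ⊗ₖ p) * M * (P ⊗ₖ P)) hM
  simp only [← Matrix.mul_kronecker_mul, Matrix.mul_one, hpP] at h5
  rw [← h5, Matrix.mul_assoc, Matrix.mul_assoc, Matrix.mul_assoc, kpP, Matrix.mul_one,
    ← Matrix.mul_assoc, kpP, Matrix.one_mul]

/-! ### Endomorphisms of the tensor products of `w` and `w̃`. -/

theorem commutant_w_w {N : Matrix I2 I2 ℂ}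
    (h : cst _ N * (w G ⊗ₖ w G) = (w G ⊗ₖ w G) * cst _ N) :
    ∃ x y : ℂ, N = x • 1 + y • (G.E * G.E') :=
  commutant_M2 (sqR_mul_sqL G) G.E'_mul_E_ne fun _ hW => commute_M2_w_w h hW

/-- The image of an intertwining relation under the `*`-operation. -/
theorem star_intertwiner {N : Matrix I2 I2 ℂ} {a b c d : Bool}
    (h : cst _ N * (V G a ⊗ₖ V G b) = (V G c ⊗ₖ V G d) * cst _ N) :
    cst _ (tauConj N) * (V G (!b) ⊗ₖ V G (!a)) = (V G (!d) ⊗ₖ V G (!c)) * cst _ (tauConj N) := by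
  ext1 ⟨i, j⟩ ⟨k, l⟩
  have h2 := congrArg star (congrFun (congrFun h (j, i)) (l, k))
  simp only [Matrix.mul_apply, cst, Matrix.map_apply, Matrix.kroneckerMap_apply, star_sum,
    star_mul, IsBichar.star_V, Algebra.algebraMap_eq_smul_one, star_smul,
    Fintype.sum_prod_type, smul_mul_assoc, mul_smul_comm, one_mul, mul_one] at h2 ⊢
  rw [Finset.sum_comm]
  simp only [tauConj, Matrix.submatrix_apply, Matrix.map_apply, Prod.swap]
  refine Eq.trans h2 ?_
  rw [Finset.sum_comm]
  rfl

theorem commutant_wt_wt {N : Matrix I2 I2 ℂ}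
    (h : cst _ N * (wt G ⊗ₖ wt G) = (wt G ⊗ₖ wt G) * cst _ N) :
    ∃ x y : ℂ, N = x • 1 + y • (G.Et * G.Et') := by
  obtain ⟨x, y, hxy⟩ := commutant_w_w (star_intertwiner (a := true) (b := true) (c := true)
    (d := true) h)
  refine ⟨starRingEnd ℂ x, starRingEnd ℂ y, ?_⟩
  rw [← tauConj_tauConj N, hxy, tauConj_add, tauConj_smul, tauConj_smul, tauConj_one,
    tauConj_col_row]

/-- Making `w̃` trivial shows that `N` acts on the second leg only. The same holds for its image
`τN̄τ` under the star, which acts on the first leg; both together leave only scalars. -/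
theorem commutant_w_wt {N : Matrix I2 I2 ℂ}
    (h : cst _ N * (w G ⊗ₖ wt G) = (w G ⊗ₖ wt G) * cst _ N) : ∃ c : ℂ, N = c • 1 := by
  obtain ⟨M, hM⟩ := commutant_M2_one (sqR_mul_sqL G) fun _ hW => commute_M2_w_wt h hW
  obtain ⟨M', hM'⟩ := commutant_M2_one (sqR_mul_sqL G) fun _ hW => commute_M2_w_wt
    (star_intertwiner (a := false) (b := true) (c := false) (d := true) h) hW
  rw [hM] at hM' ⊢
  have e := fun i j k l => congrFun (congrFun hM' (i, j)) (k, l)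
  have h01 : M 0 1 = 0 := by simpa [tauConj] using e 0 0 1 0
  have h10 : M 1 0 = 0 := by simpa [tauConj] using e 1 0 0 0
  have h11 : M 1 1 = M 0 0 := by
    have h1 := e 0 0 0 0
    have h2 := e 1 0 1 0
    simp only [tauConj, Matrix.submatrix_apply, Matrix.map_apply, Prod.swap,
      Matrix.kroneckerMap_apply, Matrix.one_apply_eq, one_mul] at h1 h2
    exact (starRingEnd ℂ).injective (h2.trans h1.symm)
  refine ⟨M 0 0, ?_⟩
  ext ⟨i, j⟩ ⟨k, l⟩
  fin_cases i <;> fin_cases j <;> fin_cases k <;> fin_cases l <;> simp [h01, h10, h11]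

end

section

variable {G : Data}

/-! ### The form of coquasitriangular structures -/

theorem cst_X_inv_mul : cst (Poly G) G.X⁻¹ * cst (Poly G) G.X = 1 := by
  rw [← cst_mul, inv_mul_X, cst_one]

theorem cst_X_mul_inv : cst (Poly G) G.X * cst (Poly G) G.X⁻¹ = 1 := by
  rw [← cst_mul, X_mul_inv, cst_one]

theorem cst_X_inv : cst (Poly G) G.X⁻¹ * (wt G ⊗ₖ w G) = (w G ⊗ₖ wt G) * cst (Poly G) G.X⁻¹ := by
  have h := congrArg (fun M => cst (Poly G) G.X⁻¹ * M * cst (Poly G) G.X⁻¹) (sat_w G).X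
  simp only [Matrix.mul_assoc, cst_X_mul_inv, Matrix.mul_one] at h
  rw [← Matrix.mul_assoc, cst_X_inv_mul, Matrix.one_mul] at h
  exact h.symm

theorem cst_smul' {m n : Type*} (c : ℂ) (N : Matrix m n ℂ) :
    cst (Poly G) (c • N) = c • cst (Poly G) N := by
  ext1 i j; simp [cst, Algebra.smul_def]

theorem cst_add' {m n : Type*} (M N : Matrix m n ℂ) :
    cst (Poly G) (M + N) = cst (Poly G) M + cst (Poly G) N := by
  ext1 i j; simp [cst]

/-- Composition with the invertible intertwiner `X⁻¹` reduces to endomorphisms of `w ⊗ w̃`. -/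
theorem intertwiner_w_wt {M : Matrix I2 I2 ℂ}
    (h : cst _ M * (w G ⊗ₖ wt G) = (wt G ⊗ₖ w G) * cst _ M) : ∃ c : ℂ, M = c • G.X := by
  obtain ⟨c, hc⟩ := commutant_w_wt (G := G) (N := G.X⁻¹ * M) (by
    rw [cst_mul, Matrix.mul_assoc, h, ← Matrix.mul_assoc, cst_X_inv, Matrix.mul_assoc])
  refine ⟨c, ?_⟩
  rw [← Matrix.one_mul M, ← X_mul_inv G, Matrix.mul_assoc, hc, Matrix.mul_smul, Matrix.mul_one]

theorem intertwiner_wt_w {M : Matrix I2 I2 ℂ}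
    (h : cst _ M * (wt G ⊗ₖ w G) = (w G ⊗ₖ wt G) * cst _ M) : ∃ c : ℂ, M = c • G.X⁻¹ := by
  obtain ⟨c, hc⟩ := commutant_w_wt (G := G) (N := M * G.X) (by
    rw [cst_mul, Matrix.mul_assoc, (sat_w G).X, ← Matrix.mul_assoc, h, Matrix.mul_assoc])
  refine ⟨c, ?_⟩
  rw [← Matrix.mul_one M, ← X_mul_inv G, ← Matrix.mul_assoc, hc, Matrix.smul_mul, Matrix.one_mul]

theorem smul_col12_inj {e : Matrix I2 Unit ℂ} {e' : Matrix Unit I2 ℂ} (he : sqR e' * sqL e = 1)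
    {x y : ℂ} (h : x • col12 e = y • col12 e) : x = y := by
  refine sub_eq_zero.mp (col_independent he (x := x - y) (y := 0) ?_).1
  rw [sub_smul, h, sub_self, zero_smul, zero_add]

theorem smul_col23_inj {e : Matrix I2 Unit ℂ} {e' : Matrix Unit I2 ℂ} (he : sqR e' * sqL e = 1)
    {x y : ℂ} (h : x • col23 e = y • col23 e) : x = y := by
  refine sub_eq_zero.mp (col_independent he (x := 0) (y := x - y) ?_).2
  rw [sub_smul, h, sub_self, zero_smul, zero_add]

variable {R : Poly G ⊗[ℂ] Poly G →ₗ[ℂ] ℂ}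

theorem IsCQT.exists_params (hR : IsCQT R) :
    ∃ P : Params, P.Good G ∧ ∀ a b, Rmat R (V G a) (V G b) = P.mat G a b := by
  obtain ⟨x, y, hff⟩ := commutant_w_w (hR.intertwiner false false)
  obtain ⟨x', y', htt⟩ := commutant_wt_wt (hR.intertwiner true true)
  obtain ⟨s, hft⟩ := intertwiner_w_wt (hR.intertwiner false true)
  obtain ⟨s', htf⟩ := intertwiner_wt_w (hR.intertwiner true false)
  -- These cup relations fix the scalars: `e1` and `e2` give the equations for `c` and `d`, `e3`
  -- gives `s² = 1`, `e4` gives `s²β² = 1`, and `e5` gives `s'²β⁻² = 1`.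
  have e1 := blkL_col_iff.mp (hR.isBichar.satL false).E
  have e2 := blkL_col_iff.mp (hR.isBichar.satL true).Et
  have e3 := blkL_col_iff.mp (hR.isBichar.satL true).E
  have e4 := blkR_col_iff.mp (hR.isBichar.satR false).Et
  have e5 := blkL_col_iff.mp (hR.isBichar.satL false).Et
  rw [hff] at e1
  rw [htt] at e2
  rw [hft, smul_op12_op23, Matrix.smul_mul, X_col12] at e3
  rw [hft, smul_op23_op12, Matrix.smul_mul, X_col23, smul_smul] at e4
  rw [htf, smul_op12_op23, Matrix.smul_mul, X_inv_col12, smul_smul] at e5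
  obtain ⟨hx, hy, hxD⟩ := exists_braid_of_col12 (sqR_mul_sqL G) e1
  obtain ⟨hx', hy', hxD'⟩ := exists_braid_of_col12 (sqR_mul_sqL_t G) e2
  have hs : s ^ 2 = 1 := smul_col23_inj (sqR_mul_sqL G) (e3.trans (one_smul _ _).symm)
  have hβ : G.β ^ 2 = 1 := by
    have := smul_col12_inj (sqR_mul_sqL_t G) (e4.trans (one_smul _ _).symm)
    rwa [hs, one_mul] at this
  have hs' : s' ^ 2 = 1 := by
    have := smul_col23_inj (sqR_mul_sqL_t G) (e5.trans (one_smul _ _).symm)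
    rwa [hβ, inv_one, mul_one] at this
  refine ⟨⟨x, x', s, s'⟩, ⟨hx, hx', hxD, hxD', hs, hs', hβ⟩, fun a b => ?_⟩
  cases a <;> cases b
  · rw [hff, hy]; rfl
  · exact hft
  · exact htf
  · rw [htt, hy']; rfl

theorem braid_commute {e : Matrix I2 Unit ℂ} {e' : Matrix Unit I2 ℂ}
    {W : Matrix (Fin 2) (Fin 2) (Poly G)} (h : (W ⊗ₖ W) * cst (Poly G) e = cst (Poly G) e)
    (h' : cst (Poly G) e' * (W ⊗ₖ W) = cst (Poly G) e') (c : ℂ) :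
    cst (Poly G) (braid e e' c) * (W ⊗ₖ W) = (W ⊗ₖ W) * cst (Poly G) (braid e e' c) := by
  rw [braid, cst_add', cst_smul', cst_smul', cst_one, cst_mul, Matrix.add_mul, Matrix.mul_add,
    Matrix.smul_mul, Matrix.mul_smul, Matrix.smul_mul, Matrix.mul_smul, Matrix.one_mul,
    Matrix.mul_one, Matrix.mul_assoc, h', ← Matrix.mul_assoc, h]

theorem Params.mat_intertwiner (P : Params) (a b : Bool) :
    cst (Poly G) (P.mat G a b) * (V G a ⊗ₖ V G b) =
      (V G b ⊗ₖ V G a) * cst (Poly G) (P.mat G a b) := by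
  cases a <;> cases b
  · exact braid_commute (sat_w G).E (sat_w G).E' _
  · simp only [Params.mat, cst_smul', Matrix.smul_mul, Matrix.mul_smul]
    exact congrArg _ (sat_w G).X
  · simp only [Params.mat, cst_smul', Matrix.smul_mul, Matrix.mul_smul]
    exact congrArg _ cst_X_inv
  · exact braid_commute (sat_w G).Et (sat_w G).Et' _

theorem Params.Good.exists_isCQT {P : Params} (hP : P.Good G) :
    ∃ R : Poly G ⊗[ℂ] Poly G →ₗ[ℂ] ℂ, IsCQT R ∧
      ∀ a b, Rmat R (V G a) (V G b) = P.mat G a b := by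
  obtain ⟨R, hR, h⟩ := hP.exists_isBichar
  refine ⟨R, hR.isCQT fun a b => ?_, h⟩
  rw [h]
  exact P.mat_intertwiner a b

/-! ### Parametrisation by roots and signs; reality and cotriangularity in terms of the parameters.
-/

/-- The possible values of `c` in `R^{ww} = L_c`. -/
def IsRoot (G : Data) (c : ℂ) : Prop := c ≠ 0 ∧ c ^ 2 + (c ^ 2)⁻¹ = -(G.E' * G.E) () ()

theorem IsRoot.inv {c : ℂ} (h : IsRoot G c) : IsRoot G c⁻¹ :=
  ⟨inv_ne_zero h.1, by rw [inv_pow, inv_inv, add_comm, h.2]⟩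

theorem IsRoot.tauConj_L {d : ℂ} (hd : IsRoot G d) :
    tauConj (G.L d)⁻¹ = braid G.Et G.Et' (starRingEnd ℂ d⁻¹) := by
  rw [L_inv hd.1 hd.2, L_eq_braid, tauConj_braid]

/-- The two parametrisations of `R^{w̃w̃}` differ by `d ↦ conj d⁻¹`, because `L_d⁻¹ = L_{d⁻¹}` and
`tauConj` conjugates the coefficients. -/
theorem hasForm_iff {c d : ℂ} (hd : IsRoot G d) {s s' : ℤˣ} : HasForm G R c d s s' ↔
    ∀ a b, Rmat R (V G a) (V G b) =
      (⟨c, starRingEnd ℂ d⁻¹, ((s : ℤ) : ℂ), ((s' : ℤ) : ℂ)⟩ : Params).mat G a b := by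
  constructor
  · intro h a b
    cases a <;> cases b
    · exact h.w_w.trans (L_eq_braid G c)
    · exact h.w_wt
    · exact h.wt_w
    · exact h.wt_wt.trans hd.tauConj_L
  · intro h
    exact ⟨(h false false).trans (L_eq_braid G c).symm, (h true true).trans hd.tauConj_L.symm,
      h false true, h true false⟩

theorem units_sq (s : ℤˣ) : ((s : ℤ) : ℂ) ^ 2 = 1 := by
  rcases Int.units_eq_one_or s with rfl | rfl <;> simp

theorem exists_units {x : ℂ} (h : x ^ 2 = 1) : ∃ s : ℤˣ, ((s : ℤ) : ℂ) = x := by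
  rcases mul_self_eq_one_iff.mp ((sq x).symm.trans h) with rfl | rfl
  · exact ⟨1, by simp⟩
  · exact ⟨-1, by simp⟩

theorem units_cast_inj {s s' : ℤˣ} (h : ((s : ℤ) : ℂ) = ((s' : ℤ) : ℂ)) : s = s' :=
  Units.ext (Int.cast_injective h)

theorem IsCQT.exists_hasForm (hR : IsCQT R) : G.β ^ 2 = 1 ∧
    ∃ (c d : ℂ) (s s' : ℤˣ), IsRoot G c ∧ IsRoot G d ∧ HasForm G R c d s s' := by
  obtain ⟨⟨c, d, s, s'⟩, hP, h⟩ := hR.exists_params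
  obtain ⟨u, hu⟩ := exists_units hP.hs
  obtain ⟨u', hu'⟩ := exists_units hP.hs'
  dsimp only at hu hu'
  have hd : IsRoot G (starRingEnd ℂ d) := by
    refine ⟨(map_ne_zero _).mpr hP.d_ne, ?_⟩
    have := congrArg (starRingEnd ℂ) hP.hd
    rw [et_mul_et] at this
    simpa using this
  refine ⟨hP.hβ, c, (starRingEnd ℂ d)⁻¹, u, u', ⟨hP.c_ne, hP.hc⟩, hd.inv, ?_⟩
  rw [hasForm_iff hd.inv, inv_inv, Complex.conj_conj, hu, hu']
  exact h

theorem existsUnique_hasForm (hβ : G.β ^ 2 = 1) {c d : ℂ} (hc : IsRoot G c) (hd : IsRoot G d)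
    (s s' : ℤˣ) : ∃! R : Poly G ⊗[ℂ] Poly G →ₗ[ℂ] ℂ, IsCQT R ∧ HasForm G R c d s s' := by
  have hP : (⟨c, starRingEnd ℂ d⁻¹, ((s : ℤ) : ℂ), ((s' : ℤ) : ℂ)⟩ : Params).Good G :=
    ⟨hc.1, (map_ne_zero _).mpr hd.inv.1, hc.2, by
      rw [et_mul_et, ← map_pow, ← map_inv₀, ← map_add, hd.inv.2, map_neg], units_sq s,
      units_sq s', hβ⟩
  obtain ⟨R, hR, h⟩ := hP.exists_isCQT
  refine ⟨R, ⟨hR, (hasForm_iff hd).mpr h⟩, ?_⟩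
  rintro R' ⟨hR', h'⟩
  exact hR'.isBichar.ext_V hR.isBichar fun a b => ((hasForm_iff hd).mp h' a b).trans (h a b).symm

theorem L_inj {c c' : ℂ} (h : G.L c = G.L c') : c = c' := by
  rw [L_eq_braid, L_eq_braid] at h
  exact (smul_one_add_inj (sqR_mul_sqL G) h).1

theorem smul_X_inj {x y : ℂ} (h : x • G.X = y • G.X) : x = y := by
  have h2 := congrArg (fun M => M * G.X⁻¹) h
  simp only [Matrix.smul_mul, X_mul_inv] at h2
  simpa using congrFun (congrFun h2 (0, 0)) (0, 0)

theorem smul_X_inv_inj {x y : ℂ} (h : x • G.X⁻¹ = y • G.X⁻¹) : x = y := by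
  have h2 := congrArg (fun M => M * G.X) h
  simp only [Matrix.smul_mul, inv_mul_X] at h2
  simpa using congrFun (congrFun h2 (0, 0)) (0, 0)

theorem HasForm.unique {c d c' d' : ℂ} {s s' t t' : ℤˣ} (hd : IsRoot G d) (hd' : IsRoot G d')
    (h : HasForm G R c d s s') (h' : HasForm G R c' d' t t') :
    c = c' ∧ d = d' ∧ s = t ∧ s' = t' := by
  refine ⟨L_inj (h.w_w.symm.trans h'.w_w), ?_,
    units_cast_inj (smul_X_inj (h.w_wt.symm.trans h'.w_wt)),
    units_cast_inj (smul_X_inv_inj (h.wt_w.symm.trans h'.wt_w))⟩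
  have := congrArg tauConj (h.wt_wt.symm.trans h'.wt_wt)
  rw [tauConj_tauConj, tauConj_tauConj, L_inv hd.1 hd.2, L_inv hd'.1 hd'.2] at this
  exact inv_injective (L_inj this)

theorem tauConj_X_inv (hβ : G.β = 1) : tauConj G.X⁻¹ = G.X⁻¹ := by
  have h := congrArg tauConj (inv_mul_X G)
  rw [tauConj_mul, G.tauConj_X, hβ, inv_one, one_smul, tauConj_one] at h
  rw [← Matrix.mul_one (tauConj _), ← X_mul_inv G, ← Matrix.mul_assoc, h, Matrix.one_mul]

theorem conj_units (s : ℤˣ) : starRingEnd ℂ ((s : ℤ) : ℂ) = ((s : ℤ) : ℂ) := by simp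

/-- On the pair `w, w̃` reality compares `X` with `τX̄τ = β⁻¹X`, forcing `β = 1`. On `w, w` it
compares `L_c` with `L_d⁻¹ = L_{d⁻¹}`. The other two pairs add nothing. -/
theorem HasForm.real_iff {c d : ℂ} {s s' : ℤˣ} (hR : IsCQT R) (hd : IsRoot G d)
    (h : HasForm G R c d s s') : IsReal R ↔ G.β = 1 ∧ d = c⁻¹ := by
  rw [hR.isBichar.real_iff]
  constructor
  · intro h1
    constructor
    · have h2 := h1 false true
      simp only [Bool.not_true, Bool.not_false, V_false, V_true, h.w_wt, tauConj_smul,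
        conj_units, G.tauConj_X, smul_smul] at h2
      have h3 := smul_X_inj h2
      have hs : ((s : ℤ) : ℂ) ≠ 0 := fun h0 => by simpa [h0] using units_sq s
      exact inv_eq_one.mp (mul_left_cancel₀ hs (h3.trans (mul_one _).symm))
    · have h2 := h1 false false
      simp only [Bool.not_false, V_false, V_true, h.w_w, h.wt_wt, tauConj_tauConj] at h2
      rw [L_inv hd.1 hd.2] at h2
      rw [← L_inj h2, inv_inv]
  · rintro ⟨hβ, rfl⟩ a b
    have hL : (G.L c⁻¹)⁻¹ = G.L c := by rw [L_inv hd.1 hd.2, inv_inv]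
    cases a <;> cases b <;> simp only [Bool.not_true, Bool.not_false, V_false, V_true]
    · rw [h.wt_wt, h.w_w, tauConj_tauConj, hL]
    · rw [h.w_wt, tauConj_smul, conj_units, G.tauConj_X, hβ, inv_one, one_smul]
    · rw [h.wt_w, tauConj_smul, conj_units, tauConj_X_inv hβ]
    · rw [h.wt_wt, h.w_w, hL]

/-- The inverse of `L_c` is `L_{c⁻¹}` and `c ↦ L_c` is injective, so `L_c` is an involution only for
`c = c⁻¹`. -/
theorem IsRoot.L_mul_self_iff {c : ℂ} (hc : IsRoot G c) : G.L c * G.L c = 1 ↔ c ^ 2 = 1 := by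
  have h1 : G.L c * G.L c⁻¹ = 1 := by
    rw [L_eq_braid, L_eq_braid, braid_mul_braid_inv hc.1 hc.2]
  have h2 : G.L c * G.L c = 1 ↔ c = c⁻¹ := by
    constructor
    · intro h
      exact L_inj (left_inv_eq_right_inv h h1)
    · intro h
      conv_lhs => rw [h]
      rw [← h1, ← h]
  rw [h2, sq]
  refine ⟨fun h => ?_, fun h => eq_inv_of_mul_eq_one_left h⟩
  nth_rewrite 2 [h]
  exact mul_inv_cancel₀ hc.1

theorem HasForm.ct_iff {c d : ℂ} {s s' : ℤˣ} (hR : IsCQT R) (hc : IsRoot G c) (hd : IsRoot G d)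
    (h : HasForm G R c d s s') : IsCT R ↔ (c ^ 2 = 1 ∧ d ^ 2 = 1) ∧ s = s' := by
  have h0 : IsCT R ↔ ∀ a b, Rmat R (V G a) (V G b) * Rmat R (V G b) (V G a) = 1 := by
    rw [← hR.isBichar.inv_iff]
    exact ⟨fun h => h.inv, fun h => ⟨hR, h⟩⟩
  have hs : ((s : ℤ) : ℂ) * ((s' : ℤ) : ℂ) = 1 ↔ s = s' := by
    rw [← Int.cast_mul, ← Units.val_mul]
    rcases Int.units_eq_one_or s with rfl | rfl <;> rcases Int.units_eq_one_or s' with rfl | rfl <;>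
      norm_num
  have hff : Rmat R (V G false) (V G false) * Rmat R (V G false) (V G false) = 1 ↔ c ^ 2 = 1 := by
    rw [V_false, h.w_w, hc.L_mul_self_iff]
  have htt : Rmat R (V G true) (V G true) * Rmat R (V G true) (V G true) = 1 ↔ d ^ 2 = 1 := by
    rw [V_true, h.wt_wt, ← tauConj_mul, L_inv hd.1 hd.2]
    have h1 : tauConj (G.L d⁻¹ * G.L d⁻¹) = 1 ↔ G.L d⁻¹ * G.L d⁻¹ = 1 :=
      ⟨fun h => by rw [← tauConj_tauConj (_ * _), h, tauConj_one], fun h => by rw [h, tauConj_one]⟩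
    rw [h1, hd.inv.L_mul_self_iff, inv_pow, inv_eq_one]
  have hft : Rmat R (V G false) (V G true) * Rmat R (V G true) (V G false) = 1 ↔ s = s' := by
    rw [V_true, V_false, h.w_wt, h.wt_w, Matrix.smul_mul, Matrix.mul_smul, X_mul_inv, smul_smul,
      ← hs]
    exact ⟨fun h => by simpa using congrFun (congrFun h (0, 0)) (0, 0),
      fun h => by rw [h, one_smul]⟩
  rw [h0, ← hff, ← htt, ← hft]
  constructor
  · exact fun h => ⟨⟨h _ _, h _ _⟩, h _ _⟩
  · rintro ⟨⟨h1, h2⟩, h3⟩ a b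
    cases a <;> cases b
    exacts [h1, h3, mul_eq_one_comm.mp h3, h2]

end

section

variable {G : Data}

/-! ### Counting -/

theorem isRoot_iff {q r : ℂ} (hq : q ≠ 0) (hE : (G.E' * G.E) () () = -(q + q⁻¹)) (hr : r ^ 2 = q)
    (c : ℂ) : IsRoot G c ↔ ∃ i, qroot r i = c := by
  have hr0 : r ≠ 0 := by rintro rfl; exact hq (by rw [← hr]; simp)
  simp only [Fin.exists_fin_succ, qroot]
  rw [IsRoot, hE, neg_neg, ← hr]
  constructor
  · rintro ⟨hc, h⟩
    have h2 : (c - r) * (c + r) * ((c - r⁻¹) * (c + r⁻¹)) = 0 := by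
      -- Clearing denominators, `c² + c⁻² - r² - r⁻²` factors with the four roots `±r`, `±r⁻¹`.
      have h3 : (c - r) * (c + r) * ((c - r⁻¹) * (c + r⁻¹)) =
          c ^ 2 * (c ^ 2 + (c ^ 2)⁻¹ - (r ^ 2 + (r ^ 2)⁻¹)) := by
        field_simp; ring
      rw [h3, h, sub_self, mul_zero]
    rcases mul_eq_zero.mp h2 with h3 | h3 <;> rcases mul_eq_zero.mp h3 with h4 | h4
    · simp [sub_eq_zero.mp h4]
    · simp [eq_neg_of_add_eq_zero_left h4]
    · simp [sub_eq_zero.mp h4]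
    · simp [eq_neg_of_add_eq_zero_left h4]
  · simp only [Matrix.cons_val_zero, Matrix.cons_val_succ, IsEmpty.exists_iff, or_false]
    rintro (rfl | rfl | rfl | rfl) <;> refine ⟨by simpa using hr0, ?_⟩ <;> field_simp <;> ring

/-- The set of all `q_i`. -/
def rootSet (r : ℂ) : Finset ℂ := Finset.univ.image (qroot r)

theorem mem_rootSet {r c : ℂ} : c ∈ rootSet r ↔ ∃ i, qroot r i = c := by simp [rootSet]

/-- A coincidence `r = r⁻¹` would mean `q = 1`, and `r = -r⁻¹` would mean `q = -1`; the remaining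
ones are excluded by `r ≠ 0`. -/
theorem card_rootSet {q r : ℂ} (hq : q ≠ 0) (hr : r ^ 2 = q) (h : ¬(q = 1 ∨ q = -1)) :
    (rootSet r).card = 4 := by
  have hr0 : r ≠ 0 := by rintro rfl; exact hq (by rw [← hr]; simp)
  have h1 : r ≠ r⁻¹ := fun h1 => h (Or.inl (by
    rw [← hr, sq]; nth_rewrite 2 [h1]; exact mul_inv_cancel₀ hr0))
  have h2 : r ≠ -r⁻¹ := fun h1 => h (Or.inr (by
    rw [← hr, sq]; nth_rewrite 2 [h1]; rw [mul_neg, mul_inv_cancel₀ hr0]))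
  have h3 : ∀ x : ℂ, x ≠ 0 → x ≠ -x := fun x hx hx' => hx (self_eq_neg.mp hx')
  have hinj : Function.Injective (qroot r) := by
    have h4 : -r ≠ r⁻¹ := fun h => h2 (by rw [← h, neg_neg])
    have h5 : -r ≠ -r⁻¹ := fun h => h1 (neg_injective h)
    intro i j hij
    fin_cases i <;> fin_cases j <;>
      simp [qroot, h1, h2, h4, h1.symm, h2.symm, h4.symm, h3 _ hr0, (h3 _ hr0).symm,
        h3 _ (inv_ne_zero hr0), (h3 _ (inv_ne_zero hr0)).symm] at hij ⊢
  rw [rootSet, Finset.card_image_of_injective _ hinj]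
  rfl

theorem card_rootSet' {q r : ℂ} (hr : r ^ 2 = q) (h : q = 1 ∨ q = -1) :
    (rootSet r).card = 2 := by
  have hr0 : r ≠ 0 := by
    rintro rfl
    rw [← hr] at h; norm_num at h
  have h1 : rootSet r = {r, -r} := by
    ext c
    rw [mem_rootSet]
    simp only [Fin.exists_fin_succ, qroot, Matrix.cons_val_zero, Matrix.cons_val_succ,
      IsEmpty.exists_iff, or_false, Finset.mem_insert, Finset.mem_singleton]
    rcases h with rfl | rfl
    · have : r⁻¹ = r := inv_eq_of_mul_eq_one_right (by rw [← sq, hr])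
      rw [this]; grind
    · have : r⁻¹ = -r := inv_eq_of_mul_eq_one_right (by rw [mul_neg, ← sq, hr, neg_neg])
      rw [this, neg_neg]; grind
  rw [h1, Finset.card_pair]
  exact fun h => hr0 (self_eq_neg.mp h)

/-- Existence, uniqueness and injectivity of the parameters identify CQT structures with tuples `(c,
d, s, s')`, so a property expressed through the parameters is counted by a finite set of tuples.
Counting values `c`, `d` rather than indices avoids double counting when `q = ±1`. -/
theorem encard_cqt (hβ : G.β ^ 2 = 1) {Q : (Poly G ⊗[ℂ] Poly G →ₗ[ℂ] ℂ) → Prop}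
    {K : Finset (ℂ × ℂ × ℤˣ × ℤˣ)} (hK : ∀ x ∈ K, IsRoot G x.1 ∧ IsRoot G x.2.1)
    (h : ∀ R c d s s', IsCQT R → IsRoot G c → IsRoot G d → HasForm G R c d s s' →
      (Q R ↔ (c, d, s, s') ∈ K)) :
    {R | IsCQT R ∧ Q R}.encard = K.card := by
  have h1 : ∀ x ∈ K, ∃ R : Poly G ⊗[ℂ] Poly G →ₗ[ℂ] ℂ, IsCQT R ∧
      HasForm G R x.1 x.2.1 x.2.2.1 x.2.2.2 := fun x hx =>
    (existsUnique_hasForm hβ (hK x hx).1 (hK x hx).2 _ _).exists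
  choose! f hf using h1
  have hinj : Set.InjOn f K := by
    intro x hx y hy hxy
    have h2 := (hf x hx).2
    rw [hxy] at h2
    obtain ⟨e1, e2, e3, e4⟩ := HasForm.unique (hK x hx).2 (hK y hy).2 h2 (hf y hy).2
    exact Prod.ext e1 (Prod.ext e2 (Prod.ext e3 e4))
  rw [← Set.encard_coe_eq_coe_finsetCard, ← hinj.encard_image]
  congr 1
  ext R
  constructor
  · rintro ⟨hR, hQ⟩
    obtain ⟨-, c, d, s, s', hc, hd, hform⟩ := hR.exists_hasForm
    have hx := (h R c d s s' hR hc hd hform).mp hQ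
    refine ⟨_, hx, ?_⟩
    exact (existsUnique_hasForm hβ hc hd s s').unique (hf _ hx) ⟨hR, hform⟩
  · rintro ⟨x, hx, rfl⟩
    exact ⟨(hf x hx).1, (h _ _ _ _ _ (hf x hx).1 (hK x hx).1 (hK x hx).2 (hf x hx).2).mpr hx⟩

theorem setOf_isCQT_eq_empty (hβ : ¬ G.β ^ 2 = 1) (Q : (Poly G ⊗[ℂ] Poly G →ₗ[ℂ] ℂ) → Prop) :
    {R | IsCQT R ∧ Q R}.encard = 0 := by
  rw [Set.encard_eq_zero, Set.eq_empty_iff_forall_notMem]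
  exact fun R hR => hβ hR.1.exists_hasForm.1

section

variable {q r : ℂ}

theorem mem_rootSet_iff (hq : q ≠ 0) (hE : (G.E' * G.E) () () = -(q + q⁻¹)) (hr : r ^ 2 = q)
    (c : ℂ) : c ∈ rootSet r ↔ IsRoot G c := by
  rw [isRoot_iff hq hE hr, mem_rootSet]

theorem encard_isCQT (hq : q ≠ 0) (hE : (G.E' * G.E) () () = -(q + q⁻¹)) (hr : r ^ 2 = q)
    (hβ : G.β ^ 2 = 1) : {R : Poly G ⊗[ℂ] Poly G →ₗ[ℂ] ℂ | IsCQT R}.encard =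
      ((rootSet r).card * ((rootSet r).card * 4) : ℕ) := by
  have hm := mem_rootSet_iff hq hE hr
  have h := encard_cqt hβ (Q := fun _ => True)
    (K := rootSet r ×ˢ rootSet r ×ˢ (Finset.univ : Finset (ℤˣ × ℤˣ)))
    (fun x hx => by simpa [hm] using hx) (fun R c d s s' _ hc hd _ => by simp [hm, hc, hd])
  simpa [Finset.card_product] using h

theorem encard_isReal (hq : q ≠ 0) (hE : (G.E' * G.E) () () = -(q + q⁻¹)) (hr : r ^ 2 = q)
    (hβ : G.β = 1) : {R : Poly G ⊗[ℂ] Poly G →ₗ[ℂ] ℂ | IsCQT R ∧ IsReal R}.encard =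
      ((rootSet r).card * 4 : ℕ) := by
  have hm := mem_rootSet_iff hq hE hr
  have hinj : Function.Injective
      (fun x : ℂ × ℤˣ × ℤˣ => ((x.1, x.1⁻¹, x.2) : ℂ × ℂ × ℤˣ × ℤˣ)) := by
    rintro ⟨x, y⟩ ⟨x', y'⟩ h
    simp only [Prod.mk.injEq] at h ⊢
    exact ⟨h.1, h.2.2⟩
  have h := encard_cqt (G := G) (by rw [hβ, one_pow]) (Q := IsReal)
    (K := (rootSet r ×ˢ (Finset.univ : Finset (ℤˣ × ℤˣ))).image
      fun x => (x.1, x.1⁻¹, x.2))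
    (fun x hx => by
      obtain ⟨y, hy, rfl⟩ := Finset.mem_image.mp hx
      have := (hm _).mp (Finset.mem_product.mp hy).1
      exact ⟨this, this.inv⟩)
    (fun R c d s s' hR hc hd hf => by
      rw [hf.real_iff hR hd]
      simp only [Finset.mem_image, Finset.mem_product, Prod.mk.injEq, Prod.exists]
      constructor
      · rintro ⟨-, rfl⟩
        exact ⟨c, s, s', ⟨(hm c).mpr hc, Finset.mem_univ _⟩, rfl, rfl, rfl, rfl⟩
      · rintro ⟨a, b, b', -, rfl, rfl, -⟩
        exact ⟨hβ, rfl⟩)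
  rw [h, Finset.card_image_of_injective _ hinj, Finset.card_product]
  rfl

/-- From `c² + c⁻² = q + q⁻¹`: if either `c²` or `q` is `1`, the common value is `2`, and `x + x⁻¹ =
2` means `(x - 1)² = 0`. -/
theorem IsRoot.sq_eq_one_iff (hq : q ≠ 0) (hE : (G.E' * G.E) () () = -(q + q⁻¹)) {c : ℂ}
    (hc : IsRoot G c) : c ^ 2 = 1 ↔ q = 1 := by
  obtain ⟨hc0, h⟩ := hc
  rw [hE, neg_neg] at h
  constructor
  · intro h1
    rw [h1, inv_one] at h
    field_simp at h
    exact sub_eq_zero.mp (pow_eq_zero_iff two_ne_zero |>.mp (by linear_combination -h))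
  · rintro rfl
    field_simp at h
    exact sub_eq_zero.mp (pow_eq_zero_iff two_ne_zero |>.mp (by linear_combination h))

theorem HasForm.isCT_iff (hq : q ≠ 0) (hE : (G.E' * G.E) () () = -(q + q⁻¹))
    {R : Poly G ⊗[ℂ] Poly G →ₗ[ℂ] ℂ} {c d : ℂ} {s s' : ℤˣ} (hR : IsCQT R) (hc : IsRoot G c)
    (hd : IsRoot G d) (h : HasForm G R c d s s') : IsCT R ↔ q = 1 ∧ s = s' := by
  rw [h.ct_iff hR hc hd, hc.sq_eq_one_iff hq hE, hd.sq_eq_one_iff hq hE, and_self]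

theorem setOf_isCT : {R : Poly G ⊗[ℂ] Poly G →ₗ[ℂ] ℂ | IsCT R} = {R | IsCQT R ∧ IsCT R} :=
  Set.ext fun _ => ⟨fun h => ⟨h.toIsCQT, h⟩, fun h => h.2⟩

theorem setOf_isCT_isReal : {R : Poly G ⊗[ℂ] Poly G →ₗ[ℂ] ℂ | IsCT R ∧ IsReal R} =
    {R | IsCQT R ∧ IsCT R ∧ IsReal R} :=
  Set.ext fun _ => ⟨fun h => ⟨h.1.toIsCQT, h⟩, fun h => h.2⟩

theorem eq_one_of_isCT (hq : q ≠ 0) (hE : (G.E' * G.E) () () = -(q + q⁻¹))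
    {R : Poly G ⊗[ℂ] Poly G →ₗ[ℂ] ℂ} (h : IsCT R) : q = 1 ∧ G.β ^ 2 = 1 := by
  obtain ⟨hβ, c, d, s, s', hc, hd, hf⟩ := h.toIsCQT.exists_hasForm
  exact ⟨((hf.isCT_iff hq hE h.toIsCQT hc hd).mp h).1, hβ⟩

theorem encard_isCT (hE : (G.E' * G.E) () () = -(1 + 1⁻¹)) (hr : r ^ 2 = 1)
    (hβ : G.β ^ 2 = 1) : {R : Poly G ⊗[ℂ] Poly G →ₗ[ℂ] ℂ | IsCT R}.encard = 8 := by
  have hm := mem_rootSet_iff one_ne_zero hE hr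
  have hinj : Function.Injective
      (fun x : ℂ × ℂ × ℤˣ => ((x.1, x.2.1, x.2.2, x.2.2) : ℂ × ℂ × ℤˣ × ℤˣ)) := by
    rintro ⟨x, y, z⟩ ⟨x', y', z'⟩ h
    simp only [Prod.mk.injEq] at h ⊢
    exact ⟨h.1, h.2.1, h.2.2.1⟩
  have h := encard_cqt hβ (Q := IsCT)
    (K := (rootSet r ×ˢ rootSet r ×ˢ (Finset.univ : Finset ℤˣ)).image
      fun x => (x.1, x.2.1, x.2.2, x.2.2))
    (fun x hx => by
      obtain ⟨y, hy, rfl⟩ := Finset.mem_image.mp hx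
      simp only [Finset.mem_product, hm] at hy
      exact ⟨hy.1, hy.2.1⟩)
    (fun R c d s s' hR hc hd hf => by
      rw [hf.isCT_iff one_ne_zero hE hR hc hd]
      simp only [Finset.mem_image, Finset.mem_product, Prod.mk.injEq, Prod.exists]
      constructor
      · rintro ⟨-, rfl⟩
        exact ⟨c, d, s, ⟨(hm c).mpr hc, (hm d).mpr hd, Finset.mem_univ _⟩, rfl, rfl, rfl, rfl⟩
      · rintro ⟨a, b, b', -, -, -, rfl, rfl⟩
        exact ⟨trivial, rfl⟩)
  rw [setOf_isCT, h, Finset.card_image_of_injective _ hinj, Finset.card_product,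
    Finset.card_product, card_rootSet' hr (Or.inl rfl)]
  rfl

theorem encard_isCT_isReal (hE : (G.E' * G.E) () () = -(1 + 1⁻¹)) (hr : r ^ 2 = 1)
    (hβ : G.β = 1) : {R : Poly G ⊗[ℂ] Poly G →ₗ[ℂ] ℂ | IsCT R ∧ IsReal R}.encard = 4 := by
  have hm := mem_rootSet_iff one_ne_zero hE hr
  have hinj : Function.Injective
      (fun x : ℂ × ℤˣ => ((x.1, x.1⁻¹, x.2, x.2) : ℂ × ℂ × ℤˣ × ℤˣ)) := by
    rintro ⟨x, y⟩ ⟨x', y'⟩ h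
    simp only [Prod.mk.injEq] at h ⊢
    exact ⟨h.1, h.2.2.1⟩
  have h := encard_cqt (G := G) (by rw [hβ, one_pow]) (Q := fun R => IsCT R ∧ IsReal R)
    (K := (rootSet r ×ˢ (Finset.univ : Finset ℤˣ)).image fun x => (x.1, x.1⁻¹, x.2, x.2))
    (fun x hx => by
      obtain ⟨y, hy, rfl⟩ := Finset.mem_image.mp hx
      have := (hm _).mp (Finset.mem_product.mp hy).1
      exact ⟨this, this.inv⟩)
    (fun R c d s s' hR hc hd hf => by
      rw [hf.isCT_iff one_ne_zero hE hR hc hd, hf.real_iff hR hd]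
      simp only [Finset.mem_image, Finset.mem_product, Prod.mk.injEq, Prod.exists]
      constructor
      · rintro ⟨⟨-, rfl⟩, -, rfl⟩
        exact ⟨c, s, ⟨(hm c).mpr hc, Finset.mem_univ _⟩, rfl, rfl, rfl, rfl⟩
      · rintro ⟨a, b, -, rfl, rfl, rfl, rfl⟩
        exact ⟨⟨trivial, rfl⟩, hβ, rfl⟩)
  rw [setOf_isCT_isReal, h, Finset.card_image_of_injective _ hinj, Finset.card_product,
    card_rootSet' hr (Or.inl rfl)]
  rfl

end

end

end QLorentz

end

/-- Coquasitriangular structures on quantum Lorentz groups. -/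
theorem mainTheorem4 (G : QLorentz.Data) (q r : ℂ) (hq : q ≠ 0)
    (hE : (G.E' * G.E) () () = -(q + q⁻¹)) (hr : r ^ 2 = q) :
    -- every CQT structure is of the stated form, and exists only for `β = ±1`
    (∀ R : QLorentz.Poly G ⊗[ℂ] QLorentz.Poly G →ₗ[ℂ] ℂ, QLorentz.IsCQT R →
      (G.β = 1 ∨ G.β = -1) ∧
      ∃ (i j : Fin 4) (s s' : ℤˣ),
        QLorentz.HasForm G R (QLorentz.qroot r i) (QLorentz.qroot r j) s s') ∧
    -- for `β = ±1`, each choice is realized by exactly one CQT structure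
    (G.β = 1 ∨ G.β = -1 → ∀ (i j : Fin 4) (s s' : ℤˣ),
      ∃! R : QLorentz.Poly G ⊗[ℂ] QLorentz.Poly G →ₗ[ℂ] ℂ, QLorentz.IsCQT R ∧
        QLorentz.HasForm G R (QLorentz.qroot r i) (QLorentz.qroot r j) s s') ∧
    -- number of CQT structures
    {R : QLorentz.Poly G ⊗[ℂ] QLorentz.Poly G →ₗ[ℂ] ℂ | QLorentz.IsCQT R}.encard =
      (if G.β = 1 ∨ G.β = -1 then (if q = 1 ∨ q = -1 then 16 else 64) else 0) ∧
    -- which of them are CQT `*`-structures, cotriangular, cotriangular `*`-structures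
    (∀ R : QLorentz.Poly G ⊗[ℂ] QLorentz.Poly G →ₗ[ℂ] ℂ, QLorentz.IsCQT R →
      ∀ (i j : Fin 4) (s s' : ℤˣ),
        QLorentz.HasForm G R (QLorentz.qroot r i) (QLorentz.qroot r j) s s' →
        (QLorentz.IsReal R ↔
          G.β = 1 ∧ QLorentz.qroot r j = (QLorentz.qroot r i)⁻¹) ∧
        (QLorentz.IsCT R ↔ q = 1 ∧ s = s') ∧
        (QLorentz.IsCT R ∧ QLorentz.IsReal R ↔
          q = 1 ∧ G.β = 1 ∧ QLorentz.qroot r j = (QLorentz.qroot r i)⁻¹ ∧ s = s')) ∧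
    -- number of CQT `*`-structures
    {R : QLorentz.Poly G ⊗[ℂ] QLorentz.Poly G →ₗ[ℂ] ℂ |
        QLorentz.IsCQT R ∧ QLorentz.IsReal R}.encard =
      (if G.β = 1 then (if q = 1 ∨ q = -1 then 8 else 16) else 0) ∧
    -- number of cotriangular structures
    {R : QLorentz.Poly G ⊗[ℂ] QLorentz.Poly G →ₗ[ℂ] ℂ | QLorentz.IsCT R}.encard =
      (if q = 1 ∧ (G.β = 1 ∨ G.β = -1) then 8 else 0) ∧
    -- number of cotriangular `*`-structures
    {R : QLorentz.Poly G ⊗[ℂ] QLorentz.Poly G →ₗ[ℂ] ℂ |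
        QLorentz.IsCT R ∧ QLorentz.IsReal R}.encard =
      (if q = 1 ∧ G.β = 1 then 4 else 0) := by 
  have hβ : G.β = 1 ∨ G.β = -1 ↔ G.β ^ 2 = 1 := by rw [sq, mul_self_eq_one_iff]
  have hroot : ∀ i, QLorentz.IsRoot G (QLorentz.qroot r i) := fun i =>
    (QLorentz.isRoot_iff hq hE hr _).mpr ⟨i, rfl⟩
  refine ⟨fun R hR => ?_, fun h i j s s' => QLorentz.existsUnique_hasForm (hβ.mp h) (hroot i)
    (hroot j) s s', ?_, fun R hR i j s s' hf => ?_, ?_, ?_, ?_⟩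
  · obtain ⟨hb, c, d, s, s', hc, hd, hf⟩ := hR.exists_hasForm
    obtain ⟨i, rfl⟩ := (QLorentz.isRoot_iff hq hE hr c).mp hc
    obtain ⟨j, rfl⟩ := (QLorentz.isRoot_iff hq hE hr d).mp hd
    exact ⟨hβ.mpr hb, i, j, s, s', hf⟩
  · split_ifs with h1 h2
    · rw [QLorentz.encard_isCQT hq hE hr (hβ.mp h1), QLorentz.card_rootSet' hr h2]; rfl
    · rw [QLorentz.encard_isCQT hq hE hr (hβ.mp h1), QLorentz.card_rootSet hq hr h2]; rfl
    · simpa using QLorentz.setOf_isCQT_eq_empty (fun h => h1 (hβ.mpr h)) fun _ => True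
  · have h1 := hf.real_iff hR (hroot j)
    have h2 := hf.isCT_iff hq hE hR (hroot i) (hroot j)
    refine ⟨h1, h2, ?_⟩
    rw [h1, h2]
    tauto
  · split_ifs with h1 h2
    · rw [QLorentz.encard_isReal hq hE hr h1, QLorentz.card_rootSet' hr h2]; rfl
    · rw [QLorentz.encard_isReal hq hE hr h1, QLorentz.card_rootSet hq hr h2]; rfl
    · rw [Set.encard_eq_zero, Set.eq_empty_iff_forall_notMem]
      rintro R ⟨hR, hreal⟩
      obtain ⟨-, c, d, s, s', hc, hd, hf⟩ := hR.exists_hasForm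
      exact h1 ((hf.real_iff hR hd).mp hreal).1
  · split_ifs with h1
    · obtain ⟨rfl, hb⟩ := h1
      exact QLorentz.encard_isCT hE hr (hβ.mp hb)
    · rw [Set.encard_eq_zero, Set.eq_empty_iff_forall_notMem]
      intro R hR
      obtain ⟨h2, h3⟩ := QLorentz.eq_one_of_isCT hq hE hR
      exact h1 ⟨h2, hβ.mpr h3⟩
  · split_ifs with h1
    · obtain ⟨rfl, hb⟩ := h1
      exact QLorentz.encard_isCT_isReal hE hr hb
    · rw [Set.encard_eq_zero, Set.eq_empty_iff_forall_notMem]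
      rintro R ⟨hR, hreal⟩
      obtain ⟨-, c, d, s, s', hc, hd, hf⟩ := hR.toIsCQT.exists_hasForm
      exact h1 ⟨(QLorentz.eq_one_of_isCT hq hE hR).1, ((hf.real_iff hR.toIsCQT hd).mp hreal).1⟩
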